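/- Let $\mathcal X$ be a projective, geometrically irreducible, nonsingular algebraic curve of genus $g$ defined over the finite field $\mathbb F_q$, and let $N_r$ be its number of $\mathbb F_{q^r}$-rational points. Let $n\ge 2$, let $u,m$ be coprime integers with $m>u\ge 1$, and let $\phi=(f_0:\dots:f_n):\mathcal X\to\mathbb P^n(\overline{\mathbb F}_q)$ be a nondegenerate morphism defined over $\mathbb F_q$, i.e. $f_0,\dots,f_n\in\mathbb F_q(\mathcal X)$ are linearly independent over $\overline{\mathbb F}_q$. Put $e_P=-\min_i v_P(f_i)$ for $P\in\mathcal X$, $E=\sum_P e_P P$, and let $d=\deg E$ be the degree of the linear series $\mathcal D=\{\operatorname{div}(\sum_i a_if_i)+E : (a_0:\dots:a_n)\in\mathbb P^n(\overline{\mathbb F}_q)\}$. For $P\in\mathcal X$ let $j_0(P)<j_1(P)<\dots<j_n(P)$ be the $(\mathcal D,P)$-orders, i.e. the integers $v_P(D)$ with $D\in\mathcal D$. Let $t\in\mathbb F_q(\mathcal X)$ be a separating variable and let $D_t^{(r)}$ denote the $r$-th Hasse derivative with respect to $t$. For integers $0\le\rho_0<\dots<\rho_{n-2}$ let $\mathcal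 A_t^{\rho_0,\dots,\rho_{n-2}}$ be the determinant of the $(n+1)\times(n+1)$ matrix with rows $(f_j^{q^m})_j$, $(f_j^{q^u})_j$, $(D_t^{(\rho_0)}f_j)_j,\dots,(D_t^{(\rho_{n-2})}f_j)_j$. Let $(\kappa_0,\dots,\kappa_{n-2})$ be the lexicographically minimal such sequence with $\mathcal A_t^{\kappa_0,\dots,\kappa_{n-2}}\ne0$ (the $(q^u,q^m)$-Frobenius order-sequence), and let $$T_{u,m}=\operatorname{div}\bigl(\mathcal A_t^{\kappa_0,\dots,\kappa_{n-2}}\bigr)+(\kappa_0+\dots+\kappa_{n-2})\operatorname{div}(dt)+(q^m+q^u+n-1)E .$$ Assume that $\mathcal X$ is $(q^u,q^m)$-Frobenius classical with respect to $\phi$, that is, $\kappa_i=i$ for $i=0,\dots,n-2$. For $P\in\mathcal X(\mathbb F_q)$ put $B(P)=v_P(T_{u,m})-\bigl(q^u+2(n-1)\bigr)$. Then $$(n-1)N_u+(n-1)N_m+q^uN_{m-u}\le (n-1)(n-2)(g-1)+d\,(q^m+q^u+n-1)-\sum_{P\in\mathcal X(\mathbb F_q)}B(P),$$ and, for every $P\in\mathcal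 X(\mathbb F_q)$, $$B(P)\ge q^u\bigl(j_1(P)-1\bigr)+\sum_{i=2}^n\bigl(j_i(P)-i\bigr).$$ -/

import Mathlib

open scoped WithZero PowerSeries

noncomputable section

namespace FrobeniusCurve

/-! Curves are handled through their function fields. Throughout, `k` is the finite field of
constants, `K` an algebraic closure of `k`, `F` the function field of the curve over `k`, and `L` the
function field of the curve over `K`. -/

/-- `F` is a field of algebraic functions of one variable over `k`: it is finitely generated as a
field over `k` and has transcendence degree one. -/
structure IsFunctionField (k F : Type*) [Field k] [Field F] [Algebra k F] : Prop where
  essFiniteType : Algebra.EssFiniteType k F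
  trdeg_eq_one : Algebra.trdeg k F = 1

/-- `t` is a separating variable of `F` over `k`: the extension `F / k(t)` is (algebraic and)
separable. -/
def IsSeparating (k : Type*) {F : Type*} [Field k] [Field F] [Algebra k F] (t : F) : Prop :=
  Algebra.IsSeparable (IntermediateField.adjoin k {t}) F

/-- The points of the nonsingular projective curve over the algebraically closed field `K` with
function field `L`: normalized discrete valuations of `L` that are trivial on `K`. -/
@[ext]
structure Place (K L : Type*) [Field K] [Field L] [Algebra K L] where
  /-- the valuation, written multiplicatively: `v f = exp (- v_P f)` -/
  v : Valuation L ℤᵐ⁰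
  surjective : Function.Surjective v
  trivial : ∀ c : K, c ≠ 0 → v (algebraMap K L c) = 1

theorem exists_lift_aux {R A S : Type*} [CommRing R] [CommRing A] [CommRing S] [Algebra R A]
    [Algebra.FormallySmooth R A] (g : R →+* S) (I : Ideal S) [IsAdicComplete I S] (p : S →+* A)
    (hp : Function.Surjective p) (hI : RingHom.ker p = I) (hg : p.comp g = algebraMap R A) :
    ∃ τ : A →+* S, p.comp τ = RingHom.id A ∧ τ.comp (algebraMap R A) = g := by
  subst hI
  let := g.toAlgebra
  let p' : S →ₐ[R] A := { p with commutes' := fun r => congr($hg r) }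
  have : IsAdicComplete (RingHom.ker p') S := ‹IsAdicComplete (RingHom.ker p) S›
  obtain ⟨τ, hτ⟩ := Algebra.FormallySmooth.exists_mkₐ_comp_eq_of_isAdicComplete
    (I := RingHom.ker p') (Ideal.quotientKerAlgEquivOfSurjective (f := p') hp).symm.toAlgHom
  refine ⟨τ.toRingHom, ?_, ?_⟩
  · ext x
    have := congr((Ideal.quotientKerAlgEquivOfSurjective (f := p') hp) ($hτ x))
    simp at this
    exact this
  · ext r
    exact τ.commutes r

theorem uniq_lift_aux {R A S : Type*} [CommRing R] [CommRing A] [CommRing S] [Algebra R A]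
    [Algebra.FormallyUnramified R A] (I : Ideal S) [IsHausdorff I S]
    (p : S →+* A) (hI : RingHom.ker p = I)
    (τ₁ τ₂ : A →+* S) (h₁ : p.comp τ₁ = RingHom.id A) (h₂ : p.comp τ₂ = RingHom.id A)
    (h : τ₁.comp (algebraMap R A) = τ₂.comp (algebraMap R A)) : τ₁ = τ₂ := by
  subst hI
  let := (τ₁.comp (algebraMap R A)).toAlgebra
  let a₁ : A →ₐ[R] S := { τ₁ with commutes' := fun r => rfl }
  let a₂ : A →ₐ[R] S := { τ₂ with commutes' := fun r => congr($h.symm r) }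
  have : a₁ = a₂ := by
    apply Algebra.FormallyUnramified.ext_of_iInf (I := RingHom.ker p)
    · have := IsHausdorff.iInf_pow_smul (I := RingHom.ker p) (M := S) ‹_›
      simpa using this
    · intro x
      rw [Ideal.Quotient.eq, RingHom.mem_ker, map_sub]
      have e1 := congr($h₁ x)
      have e2 := congr($h₂ x)
      simp only [RingHom.comp_apply, RingHom.id_apply] at e1 e2
      exact sub_eq_zero.2 (e1.trans e2.symm)
  ext x
  exact congr($this x)

section Curve

variable {K L : Type*} [Field K] [Field L] [Algebra K L]

/-- The order `v_P(f)` of a function at a point, for `f ≠ 0` (with junk value `0` at `f = 0`). -/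
def Place.ord (P : Place K L) (f : L) : ℤ := -WithZero.log (P.v f)

/-- The order `v_P(ω)` of a nonzero differential at a point: if `ω = h dπ` with `π` a local
parameter at `P`, then `v_P(ω) = v_P(h)`. -/
def Place.ordDiff (P : Place K L) (ω : Ω[L⁄K]) : ℤ :=
  P.ord (Classical.epsilon fun h : L =>
    ∃ π : L, P.ord π = 1 ∧ ω = h • KaehlerDifferential.D K L π)

/-- The differentials regular at `P`: the finite sums of `a db` with `a`, `b` regular at `P`. -/
def Place.regularDiff (P : Place K L) : Submodule K Ω[L⁄K] :=
  Submodule.span K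
    {ω | ∃ a b : L, P.v a ≤ 1 ∧ P.v b ≤ 1 ∧ ω = a • KaehlerDifferential.D K L b}

variable (K L) in
/-- The genus of the curve: the dimension of the space of everywhere regular differentials. -/
def genus : ℕ := Module.finrank K (⨅ P : Place K L, P.regularDiff : Submodule K Ω[L⁄K])

/-- The degree of a divisor `∑ D(P) P`. -/
def degree (D : Place K L → ℤ) : ℤ := ∑ᶠ P, D P

/-- `τ` is the Taylor expansion with respect to `t`: the `K`-algebra homomorphism `L → L⟦X⟧`
with `τ t = t + X` that reduces to the identity modulo `X`. -/
def IsTaylor (t : L) (τ : L →ₐ[K] L⟦X⟧) : Prop :=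
  (∀ f, PowerSeries.constantCoeff (τ f) = f) ∧ τ t = PowerSeries.C t + PowerSeries.X

/-- The Taylor expansion with respect to a separating variable exists and is unique. -/
theorem existsUnique_isTaylor (t : L) (htr : Transcendental K t) (ht : IsSeparating K t) :
    ∃! τ : L →ₐ[K] L⟦X⟧, IsTaylor t τ := by
  let M := IntermediateField.adjoin K {t}
  have : Algebra.IsSeparable M L := ht
  have : Algebra.FormallyEtale M L := Algebra.FormallyEtale.of_isSeparable M L
  let : Algebra (Polynomial K) M :=
    (Polynomial.aeval (⟨t, IntermediateField.mem_adjoin_simple_self K t⟩ : M)).toRingHom.toAlgebra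
  let : Algebra (Polynomial K) L := (Polynomial.aeval t).toRingHom.toAlgebra
  have : IsScalarTower (Polynomial K) M L := by
    refine IsScalarTower.of_algebraMap_eq' ?_
    ext x
    · simp [RingHom.algebraMap_toAlgebra]
    · simp [RingHom.algebraMap_toAlgebra]
  have hM : ∀ r : Polynomial K, ((algebraMap (Polynomial K) M r : M) : L) = Polynomial.aeval t r :=
    fun r => (IsScalarTower.algebraMap_apply (Polynomial K) M L r).symm
  have : IsFractionRing (Polynomial K) M := by
    have : FaithfulSMul (Polynomial K) M := by
      rw [faithfulSMul_iff_algebraMap_injective]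
      intro a b hab
      refine transcendental_iff_injective.1 htr ?_
      rw [← hM, ← hM, hab]
    refine .of_field _ _ fun ⟨x, hx⟩ => ?_
    obtain ⟨r, s, e⟩ := (IntermediateField.mem_adjoin_simple_iff K x).1 hx
    refine ⟨r, s, Subtype.ext ?_⟩
    rw [IntermediateField.coe_div, hM, hM]
    exact e
  have : Algebra.FormallyEtale (Polynomial K) M :=
    Algebra.FormallyEtale.of_isLocalization (nonZeroDivisors (Polynomial K))
  have : Algebra.FormallyEtale (Polynomial K) L := Algebra.FormallyEtale.comp _ M _
  let p : L⟦X⟧ →+* L := PowerSeries.constantCoeff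
  have hp : Function.Surjective p := fun x => ⟨PowerSeries.C x, by simp [p]⟩
  have hI : RingHom.ker p = Ideal.span {PowerSeries.X} := by
    ext x
    rw [RingHom.mem_ker, Ideal.mem_span_singleton, PowerSeries.X_dvd_iff]
  let g : Polynomial K →+* L⟦X⟧ := (Polynomial.aeval (PowerSeries.C t + PowerSeries.X)).toRingHom
  have hg : p.comp g = algebraMap (Polynomial K) L := by
    ext x
    · simp [RingHom.algebraMap_toAlgebra, p, g, PowerSeries.algebraMap_apply]
    · simp [RingHom.algebraMap_toAlgebra, p, g]
  obtain ⟨τ, h1, h2⟩ := exists_lift_aux g _ p hp hI hg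
  have key : ∀ x : K, τ (algebraMap K L x) = algebraMap K L⟦X⟧ x := fun x => by
    have := congr($h2 (Polynomial.C x))
    simpa [RingHom.algebraMap_toAlgebra, g] using this
  refine ⟨{ τ with commutes' := key }, ⟨fun f => congr($h1 f), ?_⟩, ?_⟩
  · have := congr($h2 Polynomial.X)
    simpa [RingHom.algebraMap_toAlgebra, g] using this
  · rintro σ ⟨s1, s2⟩
    have : σ.toRingHom = τ := by
      refine uniq_lift_aux (R := Polynomial K) _ p hI _ _ (RingHom.ext s1) h1 ?_
      rw [h2]
      ext x
      · simp [RingHom.algebraMap_toAlgebra, g]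
      · simp [RingHom.algebraMap_toAlgebra, g, s2]
    ext x : 1
    exact congr($this x)

variable (K) in
open Classical in
/-- The Hasse derivative `D_t^{(r)} f`: the coefficient of `X ^ r` in the Taylor expansion of `f`
with respect to `t`, which exists and is unique for a separating variable `t`. -/
def hasseDeriv (t : L) (r : ℕ) (f : L) : L :=
  if h : ∃ τ : L →ₐ[K] L⟦X⟧, IsTaylor t τ then PowerSeries.coeff r (h.choose f) else 0

variable {n : ℕ}

/-- `e_P = - min (v_P(f₀), …, v_P(fₙ))`, so that `E = ∑ e_P P`. -/
def baseDivisor (f : Fin (n + 1) → L) (P : Place K L) : ℤ :=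
  -Finset.univ.inf' Finset.univ_nonempty fun i => P.ord (f i)

/-- The linear series of the morphism `(f₀ : … : fₙ)`: the divisors `div (∑ aᵢ fᵢ) + E`. -/
def linearSeries (f : Fin (n + 1) → L) : Set (Place K L → ℤ) :=
  {D | ∃ a : Fin (n + 1) → K, a ≠ 0 ∧
    D = fun P => P.ord (∑ i, a i • f i) + baseDivisor f P}

variable (K) in
/-- The degree of the linear series of `(f₀ : … : fₙ)`, which is the degree of `E`. -/
def seriesDegree (f : Fin (n + 1) → L) : ℤ :=
  degree (baseDivisor f : Place K L → ℤ)

/-- `j` is an order at `P` of the linear series of `(f₀ : … : fₙ)`. -/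
def IsOrderAt (f : Fin (n + 1) → L) (P : Place K L) (j : ℕ) : Prop :=
  ∃ D ∈ linearSeries (K := K) f, D P = j

/-- The order-sequence `j₀(P) < j₁(P) < … < jₙ(P)` at `P`: the orders at `P` enumerated increasingly
from index `0`. -/
def orderAt (f : Fin (n + 1) → L) (P : Place K L) (i : ℕ) : ℕ := Nat.nth (IsOrderAt f P) i

variable (K) in
/-- The determinant with first two rows `(f_j ^ Q₂)`, `(f_j ^ Q₁)` followed by the `n - 1` rows
`(D_t^{(ρ_i)} f_j)`. -/
def frobDet (Q₁ Q₂ : ℕ) (t : L) (f : Fin (n + 1) → L) (ρ : Fin (n - 1) → ℕ) : L :=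
  Matrix.det (Matrix.of fun i j : Fin (n + 1) =>
    if i.val = 0 then f j ^ Q₂
    else if i.val = 1 then f j ^ Q₁
    else if h : i.val - 2 < n - 1 then hasseDeriv K t (ρ ⟨i.val - 2, h⟩) (f j)
    else 0)

variable (K) in
/-- `κ` is the `(Q₁, Q₂)`-Frobenius order-sequence: the lexicographically minimal one among the
sequences `0 ≤ κ₀ < … < κ_{n-2}` whose determinant does not vanish. -/
structure IsFrobOrderSeq (Q₁ Q₂ : ℕ) (t : L) (f : Fin (n + 1) → L) (κ : Fin (n - 1) → ℕ) :
    Prop where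
  strictMono : StrictMono κ
  det_ne_zero : frobDet K Q₁ Q₂ t f κ ≠ 0
  minimal : ∀ ρ : Fin (n - 1) → ℕ, StrictMono ρ → frobDet K Q₁ Q₂ t f ρ ≠ 0 → toLex κ ≤ toLex ρ

/-- The `(Q₁, Q₂)`-Frobenius divisor
`div (det) + (κ₀ + … + κ_{n-2}) div (dt) + (Q₂ + Q₁ + n - 1) E`. -/
def frobDivisor (Q₁ Q₂ : ℕ) (t : L) (f : Fin (n + 1) → L) (κ : Fin (n - 1) → ℕ)
    (P : Place K L) : ℤ :=
  P.ord (frobDet K Q₁ Q₂ t f κ)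
    + (∑ i, (κ i : ℤ)) * P.ordDiff (KaehlerDifferential.D K L t)
    + ((Q₂ : ℤ) + Q₁ + n - 1) * baseDivisor f P

variable (K L) in
/-- The points rational over the field with `Q` elements, `Q` a power of `#k`: the points `P` at
which every function of `F` that is regular at `P` has a value `c` with `c ^ Q = c`. -/
def rationalPoints (F : Type*) [Field F] [Algebra F L] (Q : ℕ) : Set (Place K L) :=
  {P | ∀ f : F, P.v (algebraMap F L f) ≤ 1 →
    P.v (algebraMap F L f ^ Q - algebraMap F L f) < 1}

variable (K L) in
/-- The number of points rational over the field with `Q` elements. -/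
def numPoints (F : Type*) [Field F] [Algebra F L] (Q : ℕ) : ℕ := (rationalPoints K L F Q).ncard

end Curve

end FrobeniusCurve

end

open scoped WithZero PowerSeries

noncomputable section

namespace FrobeniusCurve

/-! ### Orders at a place -/

section Order

variable {K L : Type*} [Field K] [Field L] [Algebra K L] (P : Place K L)

/-! The argument is that of Stöhr and Voloch: the divisor `T` (`frobDivisor`) is effective, its
degree is controlled by the genus, and it has large multiplicity at the rational points. Put `r = n
- 1`.

Local side. At a place `P` divide all `f_j` by one of minimal order and expand in a local parameter
`π`. Scaling the functions by `h` multiplies the determinant by `h ^ (q^m + q^u + r)`, and passing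
from derivatives in `t` to derivatives in `π` multiplies it by a power of `dt/dπ`. These are exactly
the corrections by `E` and `div (dt)`, so `v_P(T)` is bounded below by the order of a determinant of
power series (`le_frobDivisor`); in particular `T ≥ 0`. If `P` is rational over a field with `Q`
elements and `π` is taken in `F`, the expansions have coefficients fixed by the `Q`-power map
(`coeff_expansion_fixed`). The functions can then be recombined, over the fixed field, into ones
with strictly increasing orders, and the recombination commutes with the `Q`-power row. Weighing
rows and columns (`pow_dvd_det_of_weights`) gives `v_P(T) ≥ r` at points over `q^u` or `q^m`. At
points over `q^(m-u)` the difference of the two Frobenius rows is a `q^u`-th power of functions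
vanishing at `P`, so `v_P(T) ≥ q^u`. At points over `q` both Frobenius rows are compatible with the
recombination, and subtracting `f₀ ^ (q^m - q^u)` times the second row from the first gives `v_P(T)
≥ ∑ j_i + (q^u - 1) j₁ - ∑_{i<r} i`, which is the second claim.

Global side. Principal divisors have degree zero, and `deg div (dt) ≤ 2g - 2`; the inequality
suffices because its coefficient `0 + 1 + … + (r - 1)` is nonnegative. Both facts are proved over
`K(t)`. Norms push the orders over a place down to the projective line (`Place.ord_norm`). The
different is identified with the divisor of the differential of a parameter
(`Place.IsGenerator.ord_derivative_minpoly`). A basis of the integers over `K[X]` that is reduced at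
infinity (`exists_reduced_basis`) computes, through its pole orders `m_i`, both the degree of `dX`
and the space of regular differentials.

Counting. By coprimality the three sets of rational points meet pairwise exactly in the points over
`q`. There the weights add up to `q^u + 2r`, and `B(P)` is what remains of `v_P(T)`
(`ncard_add_ncard_add_ncard_le`). -/

theorem Place.v_eq_exp {x : L} (hx : x ≠ 0) : P.v x = WithZero.exp (-P.ord x) := by
  rw [Place.ord, neg_neg, WithZero.exp_log ((P.v.ne_zero_iff).2 hx)]

theorem Place.v_le_exp_iff {x : L} (hx : x ≠ 0) (n : ℤ) :
    P.v x ≤ WithZero.exp (-n) ↔ n ≤ P.ord x := by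
  rw [P.v_eq_exp hx, WithZero.exp_le_exp, neg_le_neg_iff]

theorem Place.v_le_one_iff {x : L} (hx : x ≠ 0) : P.v x ≤ 1 ↔ 0 ≤ P.ord x := by
  simpa using P.v_le_exp_iff hx 0

theorem Place.v_lt_one_iff {x : L} (hx : x ≠ 0) : P.v x < 1 ↔ 0 < P.ord x := by
  rw [P.v_eq_exp hx, ← WithZero.exp_zero, WithZero.exp_lt_exp, neg_lt_zero]

theorem Place.v_eq_one_iff {x : L} (hx : x ≠ 0) : P.v x = 1 ↔ P.ord x = 0 := by
  rw [P.v_eq_exp hx, ← WithZero.exp_zero, WithZero.exp_inj, neg_eq_zero]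

theorem Place.v_eq_exp_iff {x : L} (n : ℤ) : P.v x = WithZero.exp (-n) ↔ x ≠ 0 ∧ P.ord x = n := by
  constructor
  · intro h
    have hx : x ≠ 0 := by
      rintro rfl
      simp at h
      exact WithZero.exp_ne_zero h.symm
    rw [P.v_eq_exp hx, WithZero.exp_inj, neg_inj] at h
    exact ⟨hx, h⟩
  · rintro ⟨hx, rfl⟩
    exact P.v_eq_exp hx

theorem Place.v_lt_one_iff_le {x : L} : P.v x < 1 ↔ P.v x ≤ WithZero.exp (-1) := by
  by_cases hx : x = 0
  · simp [hx]
  · rw [P.v_lt_one_iff hx, P.v_le_exp_iff hx]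
    rfl

@[simp] theorem Place.ord_one : P.ord 1 = 0 := by simp [Place.ord]

@[simp] theorem Place.ord_zero : P.ord 0 = 0 := by simp [Place.ord]

theorem Place.ord_mul {x y : L} (hx : x ≠ 0) (hy : y ≠ 0) : P.ord (x * y) = P.ord x + P.ord y := by
  simp only [Place.ord, map_mul]
  rw [WithZero.log_mul ((P.v.ne_zero_iff).2 hx) ((P.v.ne_zero_iff).2 hy), neg_add]

theorem Place.ord_inv (x : L) : P.ord x⁻¹ = -P.ord x := by
  simp [Place.ord, WithZero.log_inv]

theorem Place.ord_pow (x : L) (n : ℕ) : P.ord (x ^ n) = n * P.ord x := by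
  simp [Place.ord, WithZero.log_pow]

theorem Place.ord_zpow (x : L) (n : ℤ) : P.ord (x ^ n) = n * P.ord x := by
  simp [Place.ord, WithZero.log_zpow]

theorem Place.ord_div {x y : L} (hx : x ≠ 0) (hy : y ≠ 0) : P.ord (x / y) = P.ord x - P.ord y := by
  rw [div_eq_mul_inv, P.ord_mul hx (inv_ne_zero hy), P.ord_inv, sub_eq_add_neg]

theorem Place.ord_prod {ι : Type*} (s : Finset ι) (g : ι → L) (hg : ∀ i ∈ s, g i ≠ 0) :
    P.ord (∏ i ∈ s, g i) = ∑ i ∈ s, P.ord (g i) := by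
  classical
  induction s using Finset.induction_on with
  | empty => simp
  | insert a s ha ih =>
    rw [Finset.prod_insert ha, Finset.sum_insert ha, P.ord_mul (hg _ (Finset.mem_insert_self _ _))
      (Finset.prod_ne_zero_iff.2 fun i hi => hg i (Finset.mem_insert_of_mem hi)),
      ih fun i hi => hg i (Finset.mem_insert_of_mem hi)]

@[simp] theorem Place.ord_neg (x : L) : P.ord (-x) = P.ord x := by
  simp [Place.ord, Valuation.map_neg]

theorem Place.v_algebraMap_le_one (c : K) : P.v (algebraMap K L c) ≤ 1 := by
  by_cases hc : c = 0
  · simp [hc]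
  · exact (P.trivial c hc).le

theorem Place.v_algebraMap_lt_one_iff (c : K) : P.v (algebraMap K L c) < 1 ↔ c = 0 := by
  by_cases hc : c = 0
  · simp [hc]
  · simp [hc, P.trivial c hc]

theorem Place.v_aeval_le_one {x : L} (hx : P.v x ≤ 1) (p : Polynomial K) :
    P.v (Polynomial.aeval x p) ≤ 1 := by
  rw [Polynomial.aeval_eq_sum_range]
  refine P.v.map_sum_le fun i _ => ?_
  rw [Algebra.smul_def, map_mul, map_pow]
  exact mul_le_one' (P.v_algebraMap_le_one _) (pow_le_one' hx _)

theorem Place.exists_uniformizer : ∃ π : L, P.v π = WithZero.exp (-1) := P.surjective _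

theorem Place.v_sub_lt_one_unique {y : L} {c c' : K} (h : P.v (y - algebraMap K L c) < 1)
    (h' : P.v (y - algebraMap K L c') < 1) : c = c' := by
  have := P.v.map_sub_lt h' h
  rwa [sub_sub_sub_cancel_left, ← map_sub, P.v_algebraMap_lt_one_iff, sub_eq_zero] at this

/-- Every regular function takes a value in `K` at every place. -/
class HasValues (K L : Type*) [Field K] [Field L] [Algebra K L] : Prop where
  exists_value : ∀ (P : Place K L) (y : L), P.v y ≤ 1 → ∃ c : K, P.v (y - algebraMap K L c) < 1

/-- The polynomial splits, and every factor `y - c` is regular at `P` without vanishing there. -/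
theorem Place.v_aeval_eq_one [IsAlgClosed K] {y : L} (hy : P.v y ≤ 1)
    (h : ∀ c : K, ¬ P.v (y - algebraMap K L c) < 1) {p : Polynomial K} (hp : p ≠ 0) :
    P.v (Polynomial.aeval y p) = 1 := by
  have e := (IsAlgClosed.splits p).eq_prod_roots
  rw [e, map_mul, Polynomial.aeval_C, map_multiset_prod, map_mul,
    P.trivial _ (Polynomial.leadingCoeff_ne_zero.2 hp), one_mul, map_multiset_prod]
  refine Multiset.prod_eq_one fun x hx => ?_
  simp only [Multiset.map_map, Function.comp_apply, Multiset.mem_map] at hx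
  obtain ⟨c, _, rfl⟩ := hx
  have h1 : P.v (y - algebraMap K L c) ≤ 1 := P.v.map_sub_le hy (P.v_algebraMap_le_one c)
  simpa using le_antisymm h1 (not_lt.1 (h c))

/-- If `y` had no value in `K`, then `y` and a parameter `π` would be algebraically independent. In
a polynomial in `π` over `K[y]` all nonzero coefficients have value one, so the nonzero terms have
pairwise distinct orders and the lowest one dominates the sum. -/
theorem hasValues_of_trdeg_le [IsAlgClosed K] (h : Algebra.trdeg K L ≤ 1) : HasValues K L where
  exists_value P y hy := by
    by_contra! hc
    have hc' : ∀ c : K, ¬ P.v (y - algebraMap K L c) < 1 := fun c => not_lt.2 (hc c)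
    obtain ⟨π, hπ⟩ := P.exists_uniformizer
    have key : AlgebraicIndependent K (fun o : Option Unit => o.elim π (fun _ => y)) := by
      rw [AlgebraicIndependent.option_iff]
      constructor
      · rw [algebraicIndependent_unique_type_iff, transcendental_iff]
        intro p hp
        by_contra hp0
        have := P.v_aeval_eq_one hy hc' hp0
        rw [hp] at this
        simp at this
      · rw [transcendental_iff]
        intro r hr
        by_contra hr0
        have hcoef : ∀ a : Algebra.adjoin K (Set.range fun _ : Unit => y), a ≠ 0 →
            P.v (a : L) = 1 := by
          rintro ⟨a, ha⟩ ha0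
          rw [Set.range_const, Algebra.adjoin_singleton_eq_range_aeval] at ha
          obtain ⟨p, rfl⟩ := ha
          refine P.v_aeval_eq_one hy hc' ?_
          rintro rfl
          exact ha0 (Subtype.ext (by simp))
        have hterm : ∀ i, r.coeff i ≠ 0 → P.v (r.coeff i • π ^ i) = WithZero.exp (-(i : ℤ)) := by
          intro i hi
          rw [Algebra.smul_def, map_mul, map_pow, hπ]
          have : P.v (algebraMap _ L (r.coeff i)) = 1 := hcoef _ hi
          rw [this, one_mul, ← WithZero.exp_nsmul]
          simp
        have hd := Polynomial.trailingCoeff_nonzero_iff_nonzero.2 hr0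
        have hmem : r.natTrailingDegree ∈ r.support :=
          Polynomial.natTrailingDegree_mem_support_of_nonzero hr0
        rw [Polynomial.aeval_eq_sum_range, ← Finset.add_sum_erase _ _
          (Finset.mem_range.2 (Nat.lt_succ_of_le (Polynomial.natTrailingDegree_le_natDegree r)))] at hr
        have hlt : P.v (∑ i ∈ (Finset.range (r.natDegree + 1)).erase r.natTrailingDegree,
            r.coeff i • π ^ i) < WithZero.exp (-(r.natTrailingDegree : ℤ)) := by
          refine P.v.map_sum_lt WithZero.exp_ne_zero fun i hi => ?_
          rw [Finset.mem_erase] at hi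
          by_cases h0 : r.coeff i = 0
          · simp [h0]
          · rw [hterm i h0, WithZero.exp_lt_exp]
            have := Polynomial.natTrailingDegree_le_of_ne_zero h0
            have := hi.1
            omega
        rw [add_eq_zero_iff_eq_neg] at hr
        have h1 := hterm _ (Polynomial.mem_support_iff.1 hmem)
        rw [hr, Valuation.map_neg] at h1
        exact hlt.ne h1
    have h2 := key.lift_cardinalMk_le_trdeg
    simp only [Cardinal.mk_fintype, Fintype.card_option, Fintype.card_unit] at h2
    have h3 := h2.trans (Cardinal.lift_le.2 h)
    norm_num at h3

end Order

/-! ### Hasse derivatives of power series -/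

section PowerSeriesTaylor

variable {R : Type*} [CommRing R]

/-- The Hasse derivative of a power series. -/
def psHasse (i : ℕ) (g : R⟦X⟧) : R⟦X⟧ :=
  PowerSeries.mk fun m => ((m + i).choose i : R) * PowerSeries.coeff (m + i) g

theorem coeff_psHasse (i m : ℕ) (g : R⟦X⟧) :
    PowerSeries.coeff m (psHasse i g) = ((m + i).choose i : R) * PowerSeries.coeff (m + i) g := by
  simp [psHasse]

theorem coeff_psHasse_trunc (i m N : ℕ) (h : m + i < N) (g : R⟦X⟧) :
    PowerSeries.coeff m (psHasse i g) =
      (Polynomial.hasseDeriv i (PowerSeries.trunc N g)).coeff m := by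
  rw [coeff_psHasse, Polynomial.hasseDeriv_coeff, PowerSeries.coeff_trunc, if_pos h]

/-- A single coefficient of either side involves only finitely many coefficients of `f` and `g`, so
the Leibniz rule for polynomials applies to truncations. -/
theorem psHasse_mul (i : ℕ) (f g : R⟦X⟧) :
    psHasse i (f * g) = ∑ ij ∈ Finset.HasAntidiagonal.antidiagonal i, psHasse ij.1 f * psHasse ij.2 g := by
  ext m
  set N := m + i + 1
  have h1 : PowerSeries.coeff m (psHasse i (f * g)) =
      (Polynomial.hasseDeriv i (PowerSeries.trunc N f * PowerSeries.trunc N g)).coeff m := by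
    rw [coeff_psHasse, Polynomial.hasseDeriv_coeff,
      PowerSeries.coeff_mul_eq_coeff_trunc_mul_trunc₂ f g (n := m + i) (a := N) (b := N)
        (by omega) (by omega), ← Polynomial.coe_mul, Polynomial.coeff_coe]
  rw [h1, Polynomial.hasseDeriv_mul, Polynomial.finsetSum_coeff, map_sum]
  refine Finset.sum_congr rfl fun ij hij => ?_
  rw [Polynomial.coeff_mul, PowerSeries.coeff_mul]
  refine Finset.sum_congr rfl fun ab hab => ?_
  rw [Finset.HasAntidiagonal.mem_antidiagonal] at hij hab
  rw [coeff_psHasse_trunc ij.1 ab.1 N (by omega), coeff_psHasse_trunc ij.2 ab.2 N (by omega)]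

theorem psHasse_C (i : ℕ) (hi : i ≠ 0) (c : R) : psHasse i (PowerSeries.C c) = 0 := by
  ext m
  rw [coeff_psHasse, PowerSeries.coeff_C, if_neg (by omega)]
  simp

theorem psHasse_zero (g : R⟦X⟧) : psHasse 0 g = g := by
  ext m
  simp [coeff_psHasse]

/-- The Taylor expansion `g(X) ↦ g(X + Y)`. -/
def psTaylor : R⟦X⟧ →+* R⟦X⟧⟦X⟧ where
  toFun g := PowerSeries.mk fun i => psHasse i g
  map_one' := by
    ext i : 1
    by_cases hi : i = 0
    · subst hi
      simp [psHasse_zero]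
    · rw [PowerSeries.coeff_mk, ← map_one PowerSeries.C, psHasse_C i hi, PowerSeries.coeff_one,
        if_neg hi]
  map_zero' := by
    ext i m
    simp [coeff_psHasse]
  map_mul' f g := by
    ext i : 1
    simp [psHasse_mul, PowerSeries.coeff_mul]
  map_add' f g := by
    ext i m
    simp [coeff_psHasse, mul_add]

@[simp] theorem coeff_psTaylor (i : ℕ) (g : R⟦X⟧) :
    PowerSeries.coeff i (psTaylor g) = psHasse i g := by
  simp [psTaylor]

theorem constantCoeff_psTaylor (g : R⟦X⟧) : PowerSeries.constantCoeff (psTaylor g) = g := by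
  rw [← PowerSeries.coeff_zero_eq_constantCoeff_apply, coeff_psTaylor, psHasse_zero]

theorem psTaylor_C (c : R) : psTaylor (PowerSeries.C c) = PowerSeries.C (PowerSeries.C c) := by
  ext i : 1
  by_cases hi : i = 0
  · subst hi
    simp [psHasse_zero]
  · rw [coeff_psTaylor, psHasse_C i hi, PowerSeries.coeff_C, if_neg hi]

/-- Differentiating `i` times lowers the order by at most `i`. The factor `X ^ i` replaces the
subtraction `w - i`, so no case `i > w` has to be set apart. -/
theorem X_pow_dvd_psHasse {w i : ℕ} {g : R⟦X⟧} (h : PowerSeries.X ^ w ∣ g) :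
    PowerSeries.X ^ w ∣ PowerSeries.X ^ i * psHasse i g := by
  rw [PowerSeries.X_pow_dvd_iff] at h ⊢
  intro m hm
  rw [PowerSeries.coeff_X_pow_mul']
  split_ifs with hi
  · rw [coeff_psHasse, Nat.sub_add_cancel hi, h m hm, mul_zero]
  · rfl

theorem psHasse_one_X : psHasse 1 (PowerSeries.X : R⟦X⟧) = 1 := by
  ext m
  rw [coeff_psHasse, PowerSeries.coeff_X, PowerSeries.coeff_one]
  by_cases hm : m = 0 <;> simp [hm]

/-- The extension of `psTaylor` to Laurent series. -/
def laurentTaylor (k : Type*) [Field k] : LaurentSeries k →+* (LaurentSeries k)⟦X⟧ :=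
  IsLocalization.lift (M := nonZeroDivisors k⟦X⟧)
    (g := (PowerSeries.map (algebraMap k⟦X⟧ (LaurentSeries k))).comp (psTaylor (R := k))) (by
      intro y
      rw [PowerSeries.isUnit_iff_constantCoeff, RingHom.comp_apply,
        ← PowerSeries.coeff_zero_eq_constantCoeff_apply, PowerSeries.coeff_map, coeff_psTaylor,
        psHasse_zero, isUnit_iff_ne_zero, ne_eq, FaithfulSMul.algebraMap_eq_zero_iff]
      exact nonZeroDivisors.coe_ne_zero y)

theorem laurentTaylor_algebraMap {k : Type*} [Field k] (g : k⟦X⟧) :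
    laurentTaylor k (algebraMap k⟦X⟧ (LaurentSeries k) g) =
      PowerSeries.map (algebraMap k⟦X⟧ (LaurentSeries k)) (psTaylor g) := by
  simp only [laurentTaylor]
  rw [IsLocalization.lift_eq]
  rfl

theorem constantCoeff_laurentTaylor {k : Type*} [Field k] (g : LaurentSeries k) :
    PowerSeries.constantCoeff (laurentTaylor k g) = g := by
  have : (PowerSeries.constantCoeff.comp (laurentTaylor k)) = RingHom.id (LaurentSeries k) := by
    refine IsLocalization.ringHom_ext (nonZeroDivisors k⟦X⟧) ?_
    ext1 a
    rw [RingHom.comp_apply, RingHom.comp_apply, laurentTaylor_algebraMap,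
      ← PowerSeries.coeff_zero_eq_constantCoeff_apply, PowerSeries.coeff_map,
      PowerSeries.coeff_zero_eq_constantCoeff_apply, constantCoeff_psTaylor]
    rfl
  exact congr($this g)

end PowerSeriesTaylor

/-! ### Expansion of functions at a place -/

section Expansion

theorem Place.uniformizer_ne_zero {K L : Type*} [Field K] [Field L] [Algebra K L] {P : Place K L}
    {π : L} (hπ : P.v π = WithZero.exp (-1)) : π ≠ 0 :=
  ((P.v_eq_exp_iff 1).1 hπ).1

theorem Place.v_div_uniformizer_le {K L : Type*} [Field K] [Field L] [Algebra K L] {P : Place K L}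
    {π : L} (hπ : P.v π = WithZero.exp (-1)) {y : L} {n : ℕ} :
    P.v (y / π) ≤ WithZero.exp (-(n : ℤ)) ↔ P.v y ≤ WithZero.exp (-((n + 1 : ℕ) : ℤ)) := by
  rw [map_div₀, hπ, div_le_iff₀ (by simp), ← WithZero.exp_add]
  push_cast
  rw [neg_add]

variable {K L : Type*} [Field K] [Field L] [Algebra K L] [HasValues K L] (P : Place K L)

/-- The ring of functions regular at `P`. -/
abbrev Place.ring : ValuationSubring L := P.v.valuationSubring

theorem Place.exists_value (y : P.ring) : ∃ c : K, P.v ((y : L) - algebraMap K L c) < 1 :=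
  HasValues.exists_value P y y.2

/-- The value at `P` of a function regular at `P`. -/
def Place.value : P.ring →+* K where
  toFun y := (P.exists_value y).choose
  map_one' := P.v_sub_lt_one_unique (P.exists_value 1).choose_spec (by simp)
  map_zero' := P.v_sub_lt_one_unique (P.exists_value 0).choose_spec (by simp)
  map_add' x y := by
    refine P.v_sub_lt_one_unique (P.exists_value (x + y)).choose_spec ?_
    have := P.v.map_add_lt (P.exists_value x).choose_spec (P.exists_value y).choose_spec
    rw [map_add]
    push_cast
    rwa [add_sub_add_comm]
  map_mul' x y := by
    refine P.v_sub_lt_one_unique (P.exists_value (x * y)).choose_spec ?_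
    have hx := (P.exists_value x).choose_spec
    have hy := (P.exists_value y).choose_spec
    set c := (P.exists_value x).choose
    set d := (P.exists_value y).choose
    have e : ((x * y : P.ring) : L) - algebraMap K L (c * d) =
        (x : L) * (y - algebraMap K L d) + (x - algebraMap K L c) * algebraMap K L d := by
      rw [map_mul]; push_cast; ring
    rw [e]
    refine P.v.map_add_lt ?_ ?_
    · rw [map_mul]
      exact (mul_le_of_le_one_left' x.2).trans_lt hy
    · rw [map_mul]
      exact (mul_le_of_le_one_right' (P.v_algebraMap_le_one d)).trans_lt hx

theorem Place.v_sub_value (y : P.ring) : P.v ((y : L) - algebraMap K L (P.value y)) < 1 :=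
  (P.exists_value y).choose_spec

theorem Place.value_eq_of_lt {y : P.ring} {c : K} (h : P.v ((y : L) - algebraMap K L c) < 1) :
    P.value y = c :=
  P.v_sub_lt_one_unique (P.v_sub_value y) h

theorem Place.value_eq_zero_iff (y : P.ring) : P.value y = 0 ↔ P.v (y : L) < 1 := by
  constructor
  · intro h
    simpa [h] using P.v_sub_value y
  · intro h
    exact P.value_eq_of_lt (by simpa using h)

variable {P} {π : L} (hπ : P.v π = WithZero.exp (-1))

/-- The function `(y - y(P)) / π`. -/
def Place.shift (y : P.ring) : P.ring :=
  ⟨((y : L) - algebraMap K L (P.value y)) / π, by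
    have h := P.v_lt_one_iff_le.1 (P.v_sub_value y)
    have := (Place.v_div_uniformizer_le hπ (n := 0)).2 (by simpa using h)
    simpa using this⟩

theorem Place.shift_add (x y : P.ring) :
    Place.shift hπ (x + y) = Place.shift hπ x + Place.shift hπ y := by
  ext
  simp only [Place.shift, map_add, AddMemClass.coe_add]
  ring

theorem Place.value_const (c : K) (h : P.v (algebraMap K L c) ≤ 1) :
    P.value ⟨algebraMap K L c, h⟩ = c :=
  P.value_eq_of_lt (by simp)

/-- A constant as a regular function. -/
def Place.const (P : Place K L) (c : K) : P.ring := ⟨algebraMap K L c, P.v_algebraMap_le_one c⟩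

theorem Place.shift_mul (x y : P.ring) :
    Place.shift hπ (x * y) = Place.shift hπ x * y + P.const (P.value x) * Place.shift hπ y := by
  ext
  simp only [Place.shift, Place.const, map_mul, AddMemClass.coe_add, MulMemClass.coe_mul]
  ring

/-- The coefficients of the expansion in powers of `π`. -/
def Place.expCoeff (n : ℕ) (y : P.ring) : K := P.value ((Place.shift hπ)^[n] y)

theorem Place.expCoeff_succ (n : ℕ) (y : P.ring) :
    Place.expCoeff hπ (n + 1) y = Place.expCoeff hπ n (Place.shift hπ y) := by
  simp [Place.expCoeff]

theorem Place.expCoeff_add (n : ℕ) : ∀ x y : P.ring,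
    Place.expCoeff hπ n (x + y) = Place.expCoeff hπ n x + Place.expCoeff hπ n y := by
  induction n with
  | zero => intro x y; simp [Place.expCoeff]
  | succ n ih => intro x y; simp only [Place.expCoeff_succ, Place.shift_add, ih]

theorem Place.shift_const_mul (c : K) (y : P.ring) :
    Place.shift hπ (P.const c * y) = P.const c * Place.shift hπ y := by
  ext
  simp only [Place.shift, Place.const, map_mul, MulMemClass.coe_mul, Place.value_const]
  ring

theorem Place.expCoeff_const_mul (n : ℕ) (c : K) : ∀ y : P.ring,
    Place.expCoeff hπ n (P.const c * y) = c * Place.expCoeff hπ n y := by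
  induction n with
  | zero =>
    intro y
    simp only [Place.expCoeff, Function.iterate_zero, id, map_mul]
    rw [Place.const, Place.value_const]
  | succ n ih => intro y; simp only [Place.expCoeff_succ, Place.shift_const_mul, ih]

theorem Place.expCoeff_mul (n : ℕ) : ∀ x y : P.ring,
    Place.expCoeff hπ n (x * y) =
      PowerSeries.coeff n (PowerSeries.mk (fun m => Place.expCoeff hπ m x) *
        PowerSeries.mk (fun m => Place.expCoeff hπ m y)) := by
  induction n with
  | zero => intro x y; simp [Place.expCoeff]
  | succ n ih =>
    intro x y
    have e : PowerSeries.mk (fun m => Place.expCoeff hπ m x) =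
        PowerSeries.C (P.value x) +
          PowerSeries.X * PowerSeries.mk (fun m => Place.expCoeff hπ m (Place.shift hπ x)) := by
      ext m
      cases m with
      | zero => simp [Place.expCoeff]
      | succ m => simp [Place.expCoeff_succ, PowerSeries.coeff_succ_X_mul]
    rw [e, add_mul, map_add, mul_assoc, PowerSeries.coeff_succ_X_mul, ← ih, Place.expCoeff_succ,
      Place.shift_mul, Place.expCoeff_add, Place.expCoeff_const_mul, PowerSeries.coeff_C_mul,
      PowerSeries.coeff_mk, Place.expCoeff_succ, add_comm]

/-- The expansion in powers of `π` of the functions regular at `P`. -/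
def Place.expansion : P.ring →+* K⟦X⟧ where
  toFun y := PowerSeries.mk fun n => Place.expCoeff hπ n y
  map_one' := by
    ext n
    have h1 : (1 : P.ring) = P.const 1 := by ext; simp [Place.const]
    have h0 : Place.shift hπ (1 : P.ring) = 0 := by ext; simp [Place.shift]
    have h00 : Place.shift hπ (0 : P.ring) = 0 := by ext; simp [Place.shift]
    have hz : ∀ m, Place.expCoeff hπ m (0 : P.ring) = 0 := by
      intro m
      induction m with
      | zero => simp [Place.expCoeff]
      | succ m ih => rw [Place.expCoeff_succ, h00, ih]
    cases n with
    | zero => simp [Place.expCoeff]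
    | succ n => simp [Place.expCoeff_succ, h0, hz, PowerSeries.coeff_one]
  map_zero' := by
    ext n
    have h := Place.expCoeff_const_mul hπ n 0 0
    simpa using h
  map_mul' x y := by
    ext n
    rw [PowerSeries.coeff_mk, Place.expCoeff_mul]
  map_add' x y := by
    ext n
    simp [Place.expCoeff_add]

theorem Place.coeff_zero_expansion (y : P.ring) :
    PowerSeries.constantCoeff (Place.expansion hπ y) = P.value y := by
  rw [← PowerSeries.coeff_zero_eq_constantCoeff_apply]
  simp [Place.expansion, Place.expCoeff]

theorem Place.coeff_succ_expansion (n : ℕ) (y : P.ring) :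
    PowerSeries.coeff (n + 1) (Place.expansion hπ y) =
      PowerSeries.coeff n (Place.expansion hπ (Place.shift hπ y)) := by
  simp [Place.expansion, Place.expCoeff_succ]

theorem Place.expansion_const (c : K) : Place.expansion hπ (P.const c) = PowerSeries.C c := by
  have h0 : Place.shift hπ (P.const c) = 0 := by
    ext; simp [Place.shift, Place.const, Place.value_const]
  ext n
  cases n with
  | zero =>
    rw [PowerSeries.coeff_zero_eq_constantCoeff_apply, Place.coeff_zero_expansion]
    simp [Place.const, Place.value_const]
  | succ n => simp [Place.coeff_succ_expansion, h0]

theorem Place.expansion_eq (y : P.ring) : Place.expansion hπ y =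
    PowerSeries.C (P.value y) + PowerSeries.X * Place.expansion hπ (Place.shift hπ y) := by
  ext n
  cases n with
  | zero =>
    rw [PowerSeries.coeff_zero_eq_constantCoeff_apply, Place.coeff_zero_expansion]
    simp
  | succ n => simp [Place.coeff_succ_expansion, PowerSeries.coeff_succ_X_mul]

theorem Place.expansion_uniformizer (h : P.v π ≤ 1) :
    Place.expansion hπ ⟨π, h⟩ = PowerSeries.X := by
  have hlt : P.v π < 1 := P.v_lt_one_iff_le.2 hπ.le
  have h0 : P.value ⟨π, h⟩ = 0 := (P.value_eq_zero_iff _).2 hlt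
  have hne : π ≠ 0 := Place.uniformizer_ne_zero hπ
  have h1 : Place.shift hπ ⟨π, h⟩ = 1 := by
    ext; simp [Place.shift, h0, hne]
  rw [Place.expansion_eq, h0, h1]
  simp

/-- Each shift divides by `π` on the function side and by `X` on the series side, so the two orders
drop together. -/
theorem Place.X_pow_dvd_expansion_iff (n : ℕ) : ∀ y : P.ring,
    PowerSeries.X ^ n ∣ Place.expansion hπ y ↔ P.v (y : L) ≤ WithZero.exp (-(n : ℤ)) := by
  induction n with
  | zero =>
    intro y
    have : P.v (y : L) ≤ 1 := y.2
    simpa using this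
  | succ n ih =>
    intro y
    by_cases h0 : P.value y = 0
    · have hs : (Place.shift hπ y : L) = y / π := by simp [Place.shift, h0]
      rw [Place.expansion_eq, h0, map_zero, zero_add, pow_succ', mul_dvd_mul_iff_left
        PowerSeries.X_ne_zero, ih, hs, Place.v_div_uniformizer_le hπ]
    · constructor
      · intro h
        have : PowerSeries.X ∣ Place.expansion hπ y := (dvd_pow_self _ (by omega)).trans h
        rw [PowerSeries.X_dvd_iff, Place.coeff_zero_expansion] at this
        exact absurd this h0
      · intro h
        refine absurd ((P.value_eq_zero_iff y).2 (h.trans_lt ?_)) h0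
        rw [← WithZero.exp_zero, WithZero.exp_lt_exp]
        push_cast
        omega

theorem Place.expansion_injective : Function.Injective (Place.expansion hπ) := by
  rw [injective_iff_map_eq_zero]
  intro y hy
  by_contra h
  have h' : (y : L) ≠ 0 := fun e => h (Subtype.ext e)
  have := (Place.X_pow_dvd_expansion_iff hπ ((P.ord y).toNat + 1) y).1 (by simp [hy])
  rw [P.v_le_exp_iff h'] at this
  push_cast at this
  omega

/-- The Laurent expansion in powers of `π`. -/
def Place.laurent : L →+* LaurentSeries K :=
  IsFractionRing.lift (A := P.ring)
    (g := (algebraMap K⟦X⟧ (LaurentSeries K)).comp (Place.expansion hπ))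
    ((FaithfulSMul.algebraMap_injective _ _).comp (Place.expansion_injective hπ))

theorem Place.laurent_coe (y : P.ring) :
    Place.laurent hπ (y : L) = algebraMap K⟦X⟧ (LaurentSeries K) (Place.expansion hπ y) := by
  have : (y : L) = algebraMap P.ring L y := rfl
  simp only [Place.laurent]
  rw [this, IsFractionRing.lift_algebraMap]
  rfl

theorem Place.laurent_const (c : K) : Place.laurent hπ (algebraMap K L c) =
    algebraMap K⟦X⟧ (LaurentSeries K) (PowerSeries.C c) := by
  rw [← Place.expansion_const hπ c, ← Place.laurent_coe]
  rfl

/-- Regularity of `y` is part of the conclusion. If `y` had a pole, the expansion of `y⁻¹` would be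
a multiple of `X` and an inverse of `g`, which would make `X` a unit. -/
theorem Place.v_le_of_laurent_eq {y : L} {g : K⟦X⟧}
    (h : Place.laurent hπ y = algebraMap K⟦X⟧ (LaurentSeries K) g) {n : ℕ}
    (hn : PowerSeries.X ^ n ∣ g) : P.v y ≤ WithZero.exp (-(n : ℤ)) := by
  have hinj : Function.Injective (algebraMap K⟦X⟧ (LaurentSeries K)) :=
    FaithfulSMul.algebraMap_injective _ _
  rcases le_or_gt (P.v y) 1 with hy | hy
  · have e := Place.laurent_coe hπ ⟨y, hy⟩
    rw [h] at e
    exact (Place.X_pow_dvd_expansion_iff hπ n ⟨y, hy⟩).1 (hinj e ▸ hn)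
  · have hy0 : y ≠ 0 := by
      rintro rfl
      simp at hy
    have hlt : P.v y⁻¹ < 1 := by
      rw [map_inv₀]
      exact inv_lt_one_of_one_lt₀ hy
    have e := Place.laurent_coe hπ ⟨y⁻¹, hlt.le⟩
    have hX : PowerSeries.X ∣ Place.expansion hπ ⟨y⁻¹, hlt.le⟩ := by
      rw [PowerSeries.X_dvd_iff, Place.coeff_zero_expansion, P.value_eq_zero_iff]
      exact hlt
    have h1 : Place.expansion hπ ⟨y⁻¹, hlt.le⟩ * g = 1 := by
      apply hinj
      rw [map_mul, ← e, ← h, ← map_mul]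
      simp [hy0]
    have : IsUnit (PowerSeries.X : K⟦X⟧) := isUnit_of_dvd_one ((hX.mul_right g).trans h1.dvd)
    exact absurd this PowerSeries.X_prime.not_isUnit

end Expansion

/-! ### Change of variable and differentials -/

section Differentials

variable {K L : Type*} [Field K] [Field L] [Algebra K L]

/-- The two maps agree on `K(t)`, over which `L` is separable, hence formally unramified. A lift
along the `X`-adic filtration is then determined by its reduction modulo `X`. -/
theorem ringHom_eq_of_isSeparating {S : Type*} [CommRing S] {t : L} (ht : IsSeparating K t)
    (g₁ g₂ : L →+* S⟦X⟧) (hK : ∀ c : K, g₁ (algebraMap K L c) = g₂ (algebraMap K L c))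
    (h : g₁ t = g₂ t)
    (h0 : ∀ y, PowerSeries.constantCoeff (g₁ y) = PowerSeries.constantCoeff (g₂ y)) : g₁ = g₂ := by
  let M := IntermediateField.adjoin K {t}
  have : Algebra.IsSeparable M L := ht
  have : Algebra.FormallyUnramified M L := Algebra.FormallyUnramified.of_isSeparable M L
  have hp : ∀ p : Polynomial K, g₁ (Polynomial.aeval t p) = g₂ (Polynomial.aeval t p) := by
    intro p
    rw [Polynomial.aeval_eq_sum_range, map_sum, map_sum]
    refine Finset.sum_congr rfl fun i _ => ?_
    rw [Algebra.smul_def, map_mul, map_mul, map_pow, map_pow, hK, h]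
  have hM : ∀ x : M, g₁ x = g₂ x := by
    rintro ⟨x, hx⟩
    obtain ⟨r, s, rfl⟩ := (IntermediateField.mem_adjoin_simple_iff K x).1 hx
    change g₁ (_ / _) = g₂ (_ / _)
    by_cases hs : Polynomial.aeval t s = 0
    · simp [hs]
    · have hu : IsUnit (g₁ (Polynomial.aeval t s)) := (isUnit_iff_ne_zero.2 hs).map g₁
      refine hu.mul_left_injective ?_
      change g₁ _ * g₁ _ = g₂ _ * g₁ _
      rw [← map_mul, hp s, ← map_mul, div_mul_cancel₀ _ hs, hp]
  let := (g₁.comp (algebraMap M L)).toAlgebra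
  let a₁ : L →ₐ[M] S⟦X⟧ := { g₁ with commutes' := fun r => rfl }
  let a₂ : L →ₐ[M] S⟦X⟧ := { g₂ with commutes' := fun r => (hM r).symm }
  have hker : RingHom.ker (PowerSeries.constantCoeff (R := S)) = Ideal.span {PowerSeries.X} := by
    ext x
    rw [RingHom.mem_ker, Ideal.mem_span_singleton, PowerSeries.X_dvd_iff]
  have : a₁ = a₂ := by
    apply Algebra.FormallyUnramified.ext_of_iInf (I := Ideal.span {(PowerSeries.X : S⟦X⟧)})
    · have := IsHausdorff.iInf_pow_smul (I := Ideal.span {(PowerSeries.X : S⟦X⟧)}) (M := S⟦X⟧)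
        inferInstance
      simpa using this
    · intro x
      rw [Ideal.Quotient.eq, ← hker, RingHom.mem_ker, map_sub, sub_eq_zero]
      exact h0 x
  ext1 x
  exact congr($this x)

/-- The derivation attached to a Taylor expansion. -/
def taylorDerivation {t : L} {τ : L →ₐ[K] L⟦X⟧} (hτ : IsTaylor t τ) : Derivation K L L :=
  Derivation.mk' ((PowerSeries.coeff (R := L) 1).restrictScalars K ∘ₗ τ.toLinearMap) (by
    intro a b
    have ha := hτ.1 a
    have hb := hτ.1 b
    simp only [LinearMap.comp_apply, AlgHom.toLinearMap_apply, map_mul, smul_eq_mul]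
    change PowerSeries.coeff 1 _ = _ * PowerSeries.coeff 1 _ + _ * PowerSeries.coeff 1 _
    rw [PowerSeries.coeff_mul, Finset.Nat.antidiagonal_succ]
    simp [ha, hb]
    ring)

theorem taylorDerivation_apply {t : L} {τ : L →ₐ[K] L⟦X⟧} (hτ : IsTaylor t τ) (y : L) :
    taylorDerivation hτ y = PowerSeries.coeff 1 (τ y) := rfl

theorem taylorDerivation_self {t : L} {τ : L →ₐ[K] L⟦X⟧} (hτ : IsTaylor t τ) :
    taylorDerivation hτ t = 1 := by
  rw [taylorDerivation_apply, hτ.2]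
  simp

/-- On `K(t)` the quotient rule gives multiples of `dt`, and `L` adds nothing because the relative
differentials of the separable extension `L / K(t)` vanish. -/
theorem exists_eq_smul_D {t : L} (ht : IsSeparating K t) (ω : Ω[L⁄K]) :
    ∃ h : L, ω = h • KaehlerDifferential.D K L t := by
  let M := IntermediateField.adjoin K {t}
  have : Algebra.IsSeparable M L := ht
  have : Algebra.FormallyUnramified M L := Algebra.FormallyUnramified.of_isSeparable M L
  have hM : ∀ x : M, ∃ h : L, KaehlerDifferential.D K L x = h • KaehlerDifferential.D K L t := by
    rintro ⟨x, hx⟩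
    obtain ⟨r, s, rfl⟩ := (IntermediateField.mem_adjoin_simple_iff K x).1 hx
    simp only [Derivation.leibniz_div, Derivation.map_aeval, smul_smul, ← sub_smul]
    exact ⟨_, rfl⟩
  have hsurj : Function.Surjective (KaehlerDifferential.mapBaseChange K M L) := by
    intro x
    refine (KaehlerDifferential.exact_mapBaseChange_map K M L x).1 ?_
    exact Subsingleton.elim _ _
  have key : ∀ η : Ω[M⁄K], ∃ h : L,
      KaehlerDifferential.map K K M L η = h • KaehlerDifferential.D K L t := by
    intro η
    have hη : η ∈ Submodule.span M (Set.range (KaehlerDifferential.D K M)) := by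
      rw [KaehlerDifferential.span_range_derivation]
      trivial
    induction hη using Submodule.span_induction with
    | mem x hx =>
      obtain ⟨y, rfl⟩ := hx
      obtain ⟨h, hh⟩ := hM y
      exact ⟨h, by rw [KaehlerDifferential.map_D]; exact hh⟩
    | zero => exact ⟨0, by simp⟩
    | add x y _ _ hx hy =>
      obtain ⟨a, ha⟩ := hx
      obtain ⟨b, hb⟩ := hy
      exact ⟨a + b, by rw [map_add, ha, hb, add_smul]⟩
    | smul a x _ hx =>
      obtain ⟨b, hb⟩ := hx
      refine ⟨algebraMap M L a * b, ?_⟩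
      rw [map_smul, hb, mul_smul, algebraMap_smul]
  obtain ⟨z, rfl⟩ := hsurj ω
  induction z using TensorProduct.induction_on with
  | zero => exact ⟨0, by simp⟩
  | tmul x η =>
    obtain ⟨h, hh⟩ := key η
    exact ⟨x * h, by rw [KaehlerDifferential.mapBaseChange_tmul, hh, mul_smul]⟩
  | add x y hx hy =>
    obtain ⟨a, ha⟩ := hx
    obtain ⟨b, hb⟩ := hy
    exact ⟨a + b, by rw [map_add, ha, hb, add_smul]⟩

theorem lift_taylorDerivation_smul {t : L} {τ : L →ₐ[K] L⟦X⟧} (hτ : IsTaylor t τ) (h y : L) :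
    (taylorDerivation hτ).liftKaehlerDifferential (h • KaehlerDifferential.D K L y) =
      h * taylorDerivation hτ y := by
  rw [map_smul, Derivation.liftKaehlerDifferential_comp_D, smul_eq_mul]

theorem D_eq_smul_D {t : L} (ht : IsSeparating K t) {τ : L →ₐ[K] L⟦X⟧} (hτ : IsTaylor t τ)
    (y : L) : KaehlerDifferential.D K L y =
      taylorDerivation hτ y • KaehlerDifferential.D K L t := by
  obtain ⟨h, hh⟩ := exists_eq_smul_D ht (KaehlerDifferential.D K L y)
  have e := lift_taylorDerivation_smul hτ h t
  rw [← hh, Derivation.liftKaehlerDifferential_comp_D, taylorDerivation_self, mul_one] at e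
  rw [e, ← hh]

theorem smul_D_injective {t : L} {τ : L →ₐ[K] L⟦X⟧} (hτ : IsTaylor t τ) :
    Function.Injective fun h : L => h • KaehlerDifferential.D K L t := by
  intro a b hab
  have := congrArg (taylorDerivation hτ).liftKaehlerDifferential hab
  simpa [lift_taylorDerivation_smul, taylorDerivation_self] using this

theorem coeff_pow_eq_zero_of_constantCoeff {S : Type*} [CommRing S] {Z : S⟦X⟧}
    (hZ : PowerSeries.constantCoeff Z = 0) {d e : ℕ} (h : e < d) :
    PowerSeries.coeff e (Z ^ d) = 0 :=
  PowerSeries.X_pow_dvd_iff.1 (pow_dvd_pow_of_dvd (PowerSeries.X_dvd_iff.2 hZ) d) e h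

theorem coeff_pow_self {S : Type*} [CommRing S] {Z : S⟦X⟧}
    (hZ : PowerSeries.constantCoeff Z = 0) (d : ℕ) :
    PowerSeries.coeff d (Z ^ d) = PowerSeries.coeff 1 Z ^ d := by
  obtain ⟨W, rfl⟩ := PowerSeries.X_dvd_iff.2 hZ
  rw [mul_pow]
  have h1 := PowerSeries.coeff_X_pow_mul (W ^ d) d 0
  have h2 := PowerSeries.coeff_succ_X_mul 0 W
  rw [zero_add] at h1 h2
  rw [h1, h2]
  simp

variable [HasValues K L] {P : Place K L} {π : L} (hπ : P.v π = WithZero.exp (-1))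

/-- The Hasse derivatives in the uniformizer of the Laurent expansion are triangular combinations
of the Hasse derivatives in a separating variable. -/
theorem coeff_laurentTaylor_laurent {t : L} (ht : IsSeparating K t) {τ : L →ₐ[K] L⟦X⟧}
    (hτ : IsTaylor t τ) (y : L) (i : ℕ) :
    PowerSeries.coeff i (laurentTaylor K (Place.laurent hπ y)) =
      ∑ l ∈ Finset.range (i + 1), Place.laurent hπ (PowerSeries.coeff l (τ y)) *
        PowerSeries.coeff i ((laurentTaylor K (Place.laurent hπ t) -
          PowerSeries.C (Place.laurent hπ t)) ^ l) := by
  set ι := Place.laurent hπ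
  -- `Z` is the increment of `t` when `π` is replaced by `π + Y`. The formula says that Taylor
  -- expansion in `π` is Taylor expansion in `t` with `Z` substituted for the increment.
  set Z := laurentTaylor K (ι t) - PowerSeries.C (ι t) with hZdef
  have hZ : PowerSeries.constantCoeff Z = 0 := by
    simp [Z, constantCoeff_laurentTaylor]
  have hsub : PowerSeries.HasSubst Z := PowerSeries.HasSubst.of_constantCoeff_zero' hZ
  let g₂ : L →+* (LaurentSeries K)⟦X⟧ :=
    ((PowerSeries.substAlgHom (R := LaurentSeries K) hsub).toRingHom.comp
      (PowerSeries.map ι)).comp τ.toRingHom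
  have hg₂ : ∀ y, g₂ y = PowerSeries.subst Z (PowerSeries.map ι (τ y)) := fun y => by
    simp only [g₂, RingHom.comp_apply]
    change PowerSeries.substAlgHom hsub _ = _
    rw [PowerSeries.coe_substAlgHom]
    rfl
  have hcoeff : ∀ y i, PowerSeries.coeff i (g₂ y) = ∑ l ∈ Finset.range (i + 1),
      ι (PowerSeries.coeff l (τ y)) * PowerSeries.coeff i (Z ^ l) := by
    intro y i
    rw [hg₂, PowerSeries.coeff_subst' hsub, finsum_eq_sum_of_support_subset]
    · refine Finset.sum_congr rfl fun l _ => ?_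
      rw [PowerSeries.coeff_map, smul_eq_mul]
    · intro d hd
      rw [Function.mem_support] at hd
      by_contra hlt
      simp only [Finset.coe_range, Set.mem_Iio, not_lt] at hlt
      exact hd (by rw [coeff_pow_eq_zero_of_constantCoeff hZ (by omega), smul_zero])
  -- Both maps agree on constants, on `t`, and after setting the increment to zero; separability of
  -- `t` leaves no further freedom.
  have heq : (laurentTaylor K).comp ι = g₂ := by
    refine ringHom_eq_of_isSeparating ht _ _ (fun c => ?_) ?_ fun y => ?_
    · have h1 : τ (algebraMap K L c) = PowerSeries.C (algebraMap K L c) := by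
        rw [AlgHom.commutes, PowerSeries.algebraMap_apply]
      rw [RingHom.comp_apply, hg₂, h1, PowerSeries.map_C, PowerSeries.subst_C]
      simp only [ι]
      rw [Place.laurent_const, laurentTaylor_algebraMap, psTaylor_C, PowerSeries.map_C]
      rfl
    · rw [RingHom.comp_apply, hg₂, hτ.2, map_add, PowerSeries.map_C, PowerSeries.map_X,
        PowerSeries.subst_add hsub, PowerSeries.subst_C, PowerSeries.subst_X hsub, hZdef]
      exact (add_sub_cancel _ _).symm
    · rw [RingHom.comp_apply, constantCoeff_laurentTaylor,
        ← PowerSeries.coeff_zero_eq_constantCoeff_apply, hcoeff]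
      simp [hτ.1 y]
  rw [← hcoeff, ← heq]
  rfl

/-- The derivative of the Laurent expansion. -/
def Place.laurentDeriv (y : L) : LaurentSeries K :=
  PowerSeries.coeff 1 (laurentTaylor K (Place.laurent hπ y))

theorem Place.laurentDeriv_eq {t : L} (ht : IsSeparating K t) {τ : L →ₐ[K] L⟦X⟧}
    (hτ : IsTaylor t τ) (y : L) : Place.laurentDeriv hπ y =
      Place.laurent hπ (taylorDerivation hτ y) * Place.laurentDeriv hπ t := by
  rw [Place.laurentDeriv, coeff_laurentTaylor_laurent hπ ht hτ, Finset.sum_range_succ,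
    Finset.sum_range_one, taylorDerivation_apply, Place.laurentDeriv, pow_one, map_sub,
    PowerSeries.coeff_C]
  simp [PowerSeries.coeff_one]

theorem Place.laurentDeriv_coe (y : P.ring) : Place.laurentDeriv hπ (y : L) =
    algebraMap K⟦X⟧ (LaurentSeries K) (psHasse 1 (Place.expansion hπ y)) := by
  rw [Place.laurentDeriv, Place.laurent_coe, laurentTaylor_algebraMap, PowerSeries.coeff_map,
    coeff_psTaylor]

theorem Place.laurentDeriv_uniformizer : Place.laurentDeriv hπ π = 1 := by
  have h : P.v π ≤ 1 := (P.v_lt_one_iff_le.2 hπ.le).le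
  have := Place.laurentDeriv_coe hπ ⟨π, h⟩
  rw [Place.expansion_uniformizer hπ h, psHasse_one_X, map_one] at this
  exact this

variable {t : L} {τ : L →ₐ[K] L⟦X⟧}

theorem Place.taylorDerivation_uniformizer_ne_zero
    (hπ : P.v π = WithZero.exp (-1)) (ht : IsSeparating K t) (hτ : IsTaylor t τ) :
    taylorDerivation hτ π ≠ 0 := by
  intro h
  have := Place.laurentDeriv_eq hπ ht hτ π
  rw [Place.laurentDeriv_uniformizer, h, map_zero, zero_mul] at this
  exact one_ne_zero this

theorem Place.laurent_inv_taylorDerivation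
    (hπ : P.v π = WithZero.exp (-1)) (ht : IsSeparating K t) (hτ : IsTaylor t τ) :
    Place.laurent hπ (taylorDerivation hτ π)⁻¹ =
    Place.laurentDeriv hπ t := by
  have := Place.laurentDeriv_eq hπ ht hτ π
  rw [Place.laurentDeriv_uniformizer] at this
  rw [map_inv₀]
  exact inv_eq_of_mul_eq_one_right this.symm

/-- The quotient is `dy/dπ`, whose Laurent expansion is the termwise derivative of a power series.
-/
theorem Place.v_taylorDerivation_div_le
    (hπ : P.v π = WithZero.exp (-1)) (ht : IsSeparating K t) (hτ : IsTaylor t τ)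
    {y : L} (hy : P.v y ≤ 1) :
    P.v (taylorDerivation hτ y / taylorDerivation hτ π) ≤ 1 := by
  have h1 := Place.laurentDeriv_eq hπ ht hτ y
  rw [← Place.laurent_inv_taylorDerivation hπ ht hτ, ← map_mul, ← div_eq_mul_inv] at h1
  have h2 := Place.laurentDeriv_coe hπ ⟨y, hy⟩
  have := Place.v_le_of_laurent_eq hπ (h1.symm.trans h2) (n := 0) (by simp)
  simpa using this

theorem Place.v_taylorDerivation_eq
    (hπ : P.v π = WithZero.exp (-1)) (ht : IsSeparating K t) (hτ : IsTaylor t τ)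
    {ϖ : L} (hϖ : P.v ϖ = WithZero.exp (-1)) :
    P.v (taylorDerivation hτ ϖ) = P.v (taylorDerivation hτ π) := by
  have h1 := Place.v_taylorDerivation_div_le hπ ht hτ (P.v_lt_one_iff_le.2 hϖ.le).le
  have h2 := Place.v_taylorDerivation_div_le hϖ ht hτ (P.v_lt_one_iff_le.2 hπ.le).le
  have h3 := (P.v.ne_zero_iff).2 (Place.taylorDerivation_uniformizer_ne_zero hπ ht hτ)
  have h4 := (P.v.ne_zero_iff).2 (Place.taylorDerivation_uniformizer_ne_zero hϖ ht hτ)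
  rw [map_div₀, div_le_one₀ (zero_lt_iff.2 h3)] at h1
  rw [map_div₀, div_le_one₀ (zero_lt_iff.2 h4)] at h2
  exact le_antisymm h1 h2

/-- `ordDiff` refers to an unspecified local parameter `ϖ`. The choice is harmless because `dϖ/dt`
and `dπ/dt` have the same order for any two parameters. -/
theorem Place.ordDiff_smul_D_uniformizer
    (hπ : P.v π = WithZero.exp (-1)) (ht : IsSeparating K t) (hτ : IsTaylor t τ) (h : L) :
    P.ordDiff (h • KaehlerDifferential.D K L π) = P.ord h := by
  have hex : ∃ h' : L, ∃ ϖ : L, P.ord ϖ = 1 ∧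
      h • KaehlerDifferential.D K L π = h' • KaehlerDifferential.D K L ϖ :=
    ⟨h, π, ((P.v_eq_exp_iff 1).1 hπ).2, rfl⟩
  obtain ⟨ϖ, hϖ, e⟩ := Classical.epsilon_spec hex
  rw [Place.ordDiff]
  set h' := Classical.epsilon fun h' : L => ∃ ϖ : L, P.ord ϖ = 1 ∧
      h • KaehlerDifferential.D K L π = h' • KaehlerDifferential.D K L ϖ
  have hϖ' : P.v ϖ = WithZero.exp (-1) := by
    refine (P.v_eq_exp_iff 1).2 ⟨?_, hϖ⟩
    rintro rfl
    simp at hϖ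
  have e' := congrArg (taylorDerivation hτ).liftKaehlerDifferential e
  rw [lift_taylorDerivation_smul, lift_taylorDerivation_smul] at e'
  have e'' := congrArg P.v e'
  rw [map_mul, map_mul, Place.v_taylorDerivation_eq hπ ht hτ hϖ'] at e''
  have h3 := (P.v.ne_zero_iff).2 (Place.taylorDerivation_uniformizer_ne_zero hπ ht hτ)
  rw [Place.ord, Place.ord, mul_right_cancel₀ h3 e'']

theorem Place.ordDiff_D (hπ : P.v π = WithZero.exp (-1)) (ht : IsSeparating K t)
    (hτ : IsTaylor t τ) :
    P.ordDiff (KaehlerDifferential.D K L t) = -P.ord (taylorDerivation hτ π) := by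
  have h0 := Place.taylorDerivation_uniformizer_ne_zero hπ ht hτ
  have e : KaehlerDifferential.D K L t =
      (taylorDerivation hτ π)⁻¹ • KaehlerDifferential.D K L π := by
    rw [D_eq_smul_D ht hτ π, smul_smul, inv_mul_cancel₀ h0, one_smul]
  rw [e, Place.ordDiff_smul_D_uniformizer hπ ht hτ, P.ord_inv]

theorem Place.ordDiff_smul (ht : IsSeparating K t) (hτ : IsTaylor t τ) (P : Place K L) {h : L}
    (hh : h ≠ 0) {ω : Ω[L⁄K]} (hω : ω ≠ 0) : P.ordDiff (h • ω) = P.ord h + P.ordDiff ω := by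
  obtain ⟨π, hπ⟩ := P.exists_uniformizer
  have h0 := Place.taylorDerivation_uniformizer_ne_zero hπ ht hτ
  obtain ⟨a, rfl⟩ := exists_eq_smul_D ht ω
  have ha : a ≠ 0 := by
    rintro rfl
    simp at hω
  have e : ∀ b : L, b • KaehlerDifferential.D K L t =
      (b * (taylorDerivation hτ π)⁻¹) • KaehlerDifferential.D K L π := by
    intro b
    rw [D_eq_smul_D ht hτ π, smul_smul, mul_assoc, inv_mul_cancel₀ h0, mul_one]
  rw [smul_smul, e, e, Place.ordDiff_smul_D_uniformizer hπ ht hτ,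
    Place.ordDiff_smul_D_uniformizer hπ ht hτ, P.ord_mul (mul_ne_zero hh ha) (inv_ne_zero h0),
    P.ord_mul hh ha, P.ord_mul ha (inv_ne_zero h0), add_assoc]

/-- Dividing by `dπ` turns every generator `a db` into a regular function, and regularity passes to
`K`-linear combinations. Conversely, `ω` is its own coefficient times `dπ`. -/
theorem Place.smul_D_mem_regularDiff_iff (ht : IsSeparating K t) (hτ : IsTaylor t τ)
    (P : Place K L) {h : L} (hh : h ≠ 0) : h • KaehlerDifferential.D K L t ∈ P.regularDiff ↔
      0 ≤ P.ord h + P.ordDiff (KaehlerDifferential.D K L t) := by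
  obtain ⟨π, hπ⟩ := P.exists_uniformizer
  have h0 := Place.taylorDerivation_uniformizer_ne_zero hπ ht hτ
  have e : h • KaehlerDifferential.D K L t =
      (h * (taylorDerivation hτ π)⁻¹) • KaehlerDifferential.D K L π := by
    rw [D_eq_smul_D ht hτ π, smul_smul, mul_assoc, inv_mul_cancel₀ h0, mul_one]
  have key : 0 ≤ P.ord h + P.ordDiff (KaehlerDifferential.D K L t) ↔
      P.v (h / taylorDerivation hτ π) ≤ 1 := by
    rw [P.v_le_one_iff (div_ne_zero hh h0), P.ord_div hh h0, Place.ordDiff_D hπ ht hτ,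
      ← sub_eq_add_neg]
  rw [key]
  constructor
  · intro hmem
    have : ∀ ω ∈ P.regularDiff, P.v ((taylorDerivation hτ).liftKaehlerDifferential ω /
        taylorDerivation hτ π) ≤ 1 := by
      intro ω hω
      induction hω using Submodule.span_induction with
      | mem x hx =>
        obtain ⟨a, b, ha, hb, rfl⟩ := hx
        rw [lift_taylorDerivation_smul, mul_div_assoc, map_mul]
        exact mul_le_one' ha (Place.v_taylorDerivation_div_le hπ ht hτ hb)
      | zero => simp
      | add x y _ _ hx hy =>
        rw [map_add, add_div]
        exact P.v.map_add_le hx hy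
      | smul c x _ hx =>
        rw [LinearMap.map_smul_of_tower, Algebra.smul_def, mul_div_assoc, map_mul]
        exact mul_le_one' (P.v_algebraMap_le_one c) hx
    have := this _ hmem
    rwa [lift_taylorDerivation_smul, taylorDerivation_self, mul_one] at this
  · intro hv
    rw [e]
    exact Submodule.subset_span ⟨_, π, by simpa [div_eq_mul_inv] using hv,
      (P.v_lt_one_iff_le.2 hπ.le).le, rfl⟩

end Differentials

/-! ### Determinants with two Frobenius rows -/

section RowMatrix

variable {S : Type*} {r : ℕ}

/-- The square matrix with the rows `a`, `b` followed by the rows of `H`. -/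
def rowMatrix (a b : Fin (r + 2) → S) (H : Fin r → Fin (r + 2) → S) :
    Matrix (Fin (r + 2)) (Fin (r + 2)) S :=
  Matrix.of (Fin.cons a (Fin.cons b H))

@[simp] theorem rowMatrix_zero (a b : Fin (r + 2) → S) (H : Fin r → Fin (r + 2) → S) :
    rowMatrix a b H 0 = a := rfl

@[simp] theorem rowMatrix_one (a b : Fin (r + 2) → S) (H : Fin r → Fin (r + 2) → S) :
    rowMatrix a b H 1 = b := rfl

@[simp] theorem rowMatrix_succ_succ (a b : Fin (r + 2) → S) (H : Fin r → Fin (r + 2) → S)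
    (i : Fin r) : rowMatrix a b H i.succ.succ = H i := rfl

theorem rowMatrix_ext {M N : Matrix (Fin (r + 2)) (Fin (r + 2)) S} (h0 : M 0 = N 0)
    (h1 : M 1 = N 1) (h : ∀ i : Fin r, M i.succ.succ = N i.succ.succ) : M = N := by
  ext i j
  refine Fin.cases ?_ (fun i => Fin.cases ?_ (fun i => ?_) i) i
  · exact congrFun h0 j
  · exact congrFun h1 j
  · exact congrFun (h i) j

variable [CommRing S]

/-- The new rows arise by left multiplication with the lower triangular block matrix with blocks
`α`, `β`, `T`. -/
theorem det_rowMatrix_triangular (α β : S) (T : Fin r → Fin r → S)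
    (hT : ∀ i l, i < l → T i l = 0) (a b : Fin (r + 2) → S) (H : Fin r → Fin (r + 2) → S) :
    (rowMatrix (α • a) (β • b) fun i => ∑ l, T i l • H l).det =
      α * β * (∏ i, T i i) * (rowMatrix a b H).det := by
  let T' : Matrix (Fin (r + 2)) (Fin (r + 2)) S :=
    rowMatrix (Fin.cons α 0) (Fin.cons 0 (Fin.cons β 0)) fun i => Fin.cons 0 (Fin.cons 0 (T i))
  have h1 : rowMatrix (α • a) (β • b) (fun i => ∑ l, T i l • H l) = T' * rowMatrix a b H := by
    refine rowMatrix_ext ?_ ?_ fun i => ?_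
    · ext j
      simp [T', Matrix.mul_apply, Fin.sum_univ_succ]
    · ext j
      simp [T', Matrix.mul_apply, Fin.sum_univ_succ]
    · ext j
      simp [T', Matrix.mul_apply, Fin.sum_univ_succ]
  have h2 : T'.det = α * β * ∏ i, T i i := by
    rw [Matrix.det_of_isLowerTriangular, Fin.prod_univ_succ, Fin.prod_univ_succ]
    · simp [T', mul_assoc]
    · intro i j hij
      rw [OrderDual.toDual_lt_toDual] at hij
      revert hij
      refine Fin.cases ?_ (fun i => Fin.cases ?_ (fun i => ?_) i) i <;>
        refine Fin.cases ?_ (fun j => Fin.cases ?_ (fun j => ?_) j) j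
      · intro h; simp at h
      · intro; simp [T']
      · intro; simp [T']
      · intro h; simp at h
      · intro h; simp at h
      · intro; simp [T']
      · intro h; simp at h
      · intro h; exact absurd h (by simp [Fin.lt_def])
      · intro h
        simp only [Fin.succ_lt_succ_iff] at h
        simpa [T'] using hT i j h
  rw [h1, Matrix.det_mul, h2]

theorem det_rowMatrix_add_smul (c : S) (a b : Fin (r + 2) → S) (H : Fin r → Fin (r + 2) → S) :
    (rowMatrix (a + c • b) b H).det = (rowMatrix a b H).det := by
  rw [← Matrix.det_updateRow_add_smul_self (rowMatrix a b H) (i := 0) (j := 1) (by simp) c]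
  congr 1
  refine rowMatrix_ext ?_ ?_ fun i => ?_
  · simp
  · rw [Matrix.updateRow_ne (by simp)]
    simp
  · rw [Matrix.updateRow_ne (by simp)]
    simp

theorem det_rowMatrix_swap (a b : Fin (r + 2) → S) (H : Fin r → Fin (r + 2) → S) :
    (rowMatrix a b H).det = -(rowMatrix b a H).det := by
  have h : rowMatrix a b H = (rowMatrix b a H).submatrix (Equiv.swap 0 1) id := by
    refine rowMatrix_ext ?_ ?_ fun i => ?_
    · ext j; simp
    · ext j; simp
    · ext j
      rw [Matrix.submatrix_apply,
        Equiv.swap_apply_of_ne_of_ne (Fin.succ_ne_zero _) (Fin.succ_succ_ne_one _)]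
      simp
  rw [h, Matrix.det_permute]
  simp

theorem rowMatrix_mul (a b : Fin (r + 2) → S) (H : Fin r → Fin (r + 2) → S)
    (A : Matrix (Fin (r + 2)) (Fin (r + 2)) S) :
    rowMatrix a b H * A.transpose = rowMatrix (A.mulVec a) (A.mulVec b) fun i => A.mulVec (H i) := by
  refine rowMatrix_ext ?_ ?_ fun i => ?_ <;>
  · ext j
    simp [Matrix.mul_apply, Matrix.mulVec, dotProduct, mul_comm]

theorem map_det_rowMatrix {S' : Type*} [CommRing S'] (φ : S →+* S') (a b : Fin (r + 2) → S)
    (H : Fin r → Fin (r + 2) → S) : φ (rowMatrix a b H).det =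
      (rowMatrix (fun j => φ (a j)) (fun j => φ (b j)) fun i j => φ (H i j)).det := by
  rw [RingHom.map_det]
  congr 1
  refine rowMatrix_ext ?_ ?_ fun i => ?_ <;>
  · ext j
    simp

/-- The behaviour of the determinant under scaling, for Hasse derivatives given by a Taylor
expansion. -/
theorem det_rowMatrix_scale (τ : S →+* S⟦X⟧) (hτ : ∀ y, PowerSeries.constantCoeff (τ y) = y)
    (α β h : S) (a b f : Fin (r + 2) → S) :
    (rowMatrix (α • a) (β • b) fun i j => PowerSeries.coeff (i : ℕ) (τ (h * f j))).det =
      α * β * h ^ r * (rowMatrix a b fun i j => PowerSeries.coeff (i : ℕ) (τ (f j))).det := by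
  -- By the Leibniz rule the derivatives of `h f_j` are lower triangular combinations of those of
  -- `f_j`, with diagonal entry the constant coefficient of `τ h`, that is `h`.
  have e : (fun (i : Fin r) j => PowerSeries.coeff (i : ℕ) (τ (h * f j))) =
      fun (i : Fin r) => ∑ l : Fin r, (if (l : ℕ) ≤ i then PowerSeries.coeff ((i : ℕ) - l) (τ h) else 0) •
        fun j => PowerSeries.coeff (l : ℕ) (τ (f j)) := by
    ext i j
    rw [map_mul, mul_comm, PowerSeries.coeff_mul, Finset.Nat.sum_antidiagonal_eq_sum_range_succ
      (fun p q => PowerSeries.coeff p (τ (f j)) * PowerSeries.coeff q (τ h)), Finset.sum_apply]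
    simp only [Pi.smul_apply, smul_eq_mul, ite_mul, zero_mul]
    rw [Fin.sum_univ_eq_sum_range (fun l => if l ≤ (i : ℕ) then
      PowerSeries.coeff ((i : ℕ) - l) (τ h) * PowerSeries.coeff l (τ (f j)) else 0),
      ← Finset.sum_filter]
    have hi := i.2
    refine Finset.sum_congr ?_ fun l _ => mul_comm _ _
    ext l
    simp only [Finset.mem_range, Finset.mem_filter]
    omega
  rw [e, det_rowMatrix_triangular]
  · simp [hτ h]
  · intro i l hil
    rw [if_neg]
    simpa using hil

end RowMatrix

/-! ### Divisibility of a determinant by row and column weights -/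

section Weights

variable {S : Type*} [CommRing S] {m : Type*} [Fintype m] [DecidableEq m]

/-- After row `i` is multiplied by `x ^ ρ i`, a factor `x ^ a i` comes out of each row and `x ^ w j`
out of each column. The exponent `ρ i` is what row `i` loses by differentiation. -/
theorem pow_dvd_det_of_weights (x : S) (M : Matrix m m S) (w a ρ : m → ℕ)
    (h : ∀ i j, x ^ (w j + a i) ∣ x ^ ρ i * M i j) :
    x ^ (∑ j, w j + ∑ i, a i) ∣ x ^ (∑ i, ρ i) * M.det := by
  choose N hN using h
  have e : (Matrix.of fun i j => x ^ ρ i * M i j).det =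
      (Matrix.of fun i j => x ^ a i * (Matrix.of fun i j => x ^ w j * Matrix.of N i j) i j).det := by
    congr 1
    ext i j
    rw [Matrix.of_apply, Matrix.of_apply, Matrix.of_apply, Matrix.of_apply, hN, pow_add]
    ring
  rw [Matrix.det_mul_column, Matrix.det_mul_column, Matrix.det_mul_row, Finset.prod_pow_eq_pow_sum,
    Finset.prod_pow_eq_pow_sum, Finset.prod_pow_eq_pow_sum, ← mul_assoc, ← pow_add] at e
  rw [e, add_comm]
  exact dvd_mul_right _ _

end Weights

/-! ### Vanishing orders of determinants with Frobenius rows -/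

section Bounds

variable {K : Type*} [Field K] {r : ℕ}

theorem X_pow_dvd_of_dvd_mul {a b : ℕ} {g : K⟦X⟧}
    (h : (PowerSeries.X : K⟦X⟧) ^ (a + b) ∣ PowerSeries.X ^ a * g) : PowerSeries.X ^ b ∣ g := by
  rw [pow_add] at h
  exact (mul_dvd_mul_iff_left (pow_ne_zero _ PowerSeries.X_ne_zero)).1 h

theorem sum_rowWeights (x y : ℕ) (c : Fin r → ℕ) :
    ∑ i : Fin (r + 2), (Fin.cons x (Fin.cons y c) : Fin (r + 2) → ℕ) i = x + y + ∑ i, c i := by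
  rw [Fin.sum_univ_succ, Fin.sum_univ_succ]
  simp [add_assoc]

/-- Column `j` has weight `j`. The arbitrary row `a` may lose the largest weight `r + 1`, derivative
row `i` loses at most `i`, and the power row loses nothing. What remains is `(0 + … + (r + 1)) - (r
+ 1) - (0 + … + (r - 1)) = r`. -/
theorem X_pow_dvd_det_rowMatrix_of_one_row {Q : ℕ} (hQ : 1 ≤ Q) (a f : Fin (r + 2) → K⟦X⟧)
    (hf : ∀ j : Fin (r + 2), PowerSeries.X ^ (j : ℕ) ∣ f j) :
    PowerSeries.X ^ r ∣
      (rowMatrix a (fun j => f j ^ Q) fun i j => psHasse (i : ℕ) (f j)).det := by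
  have key := pow_dvd_det_of_weights (PowerSeries.X : K⟦X⟧)
    (rowMatrix a (fun j => f j ^ Q) fun i j => psHasse (i : ℕ) (f j)) (fun j => (j : ℕ))
    (fun _ => 0) (Fin.cons (r + 1) (Fin.cons 0 fun i : Fin r => (i : ℕ))) (by
      intro i j
      refine Fin.cases ?_ (fun i => Fin.cases ?_ (fun i => ?_) i) i
      · simp only [add_zero, Fin.cons_zero]
        exact (pow_dvd_pow _ (Nat.lt_succ_iff.1 j.2)).mul_right _
      · simp only [add_zero, Fin.cons_zero, Fin.cons_succ, pow_zero, one_mul]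
        exact (hf j).trans (dvd_pow_self _ (Nat.one_le_iff_ne_zero.1 ‹_›))
      · simp only [add_zero, Fin.cons_succ, rowMatrix_succ_succ]
        exact X_pow_dvd_psHasse (hf j))
  rw [sum_rowWeights] at key
  refine X_pow_dvd_of_dvd_mul (a := r + 1 + 0 + ∑ i : Fin r, (i : ℕ)) ?_
  convert key using 2
  rw [Fin.sum_univ_castSucc, Fin.sum_univ_castSucc]
  simp
  ring

theorem X_pow_dvd_det_rowMatrix_of_two_rows {Q₁ Q₂ : ℕ} (hQ₁ : 1 ≤ Q₁) (hQ : Q₁ ≤ Q₂)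
    (f : Fin (r + 2) → K⟦X⟧) (w : Fin (r + 2) → ℕ) (hw : Monotone w)
    (hf : ∀ j, PowerSeries.X ^ w j ∣ f j) :
    PowerSeries.X ^ (∑ j, w j + (Q₁ - 1) * w 1) ∣ PowerSeries.X ^ (∑ i : Fin r, (i : ℕ)) *
      (rowMatrix (fun j => f j ^ Q₂) (fun j => f j ^ Q₁) fun i j => psHasse (i : ℕ) (f j)).det := by
  -- This row operation makes the first row vanish in column `0`. Its other entries are then
  -- divisible by `X ^ (Q₁ w_j)`, and `Q₁ w_j ≥ w_j + (Q₁ - 1) w₁` since `w_j ≥ w₁`; this is the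
  -- gain of `(Q₁ - 1) w₁`.
  rw [← det_rowMatrix_add_smul (-(f 0 ^ (Q₂ - Q₁)))]
  have key := pow_dvd_det_of_weights (PowerSeries.X : K⟦X⟧)
    (rowMatrix ((fun j => f j ^ Q₂) + -(f 0 ^ (Q₂ - Q₁)) • fun j => f j ^ Q₁) (fun j => f j ^ Q₁)
      fun i j => psHasse (i : ℕ) (f j)) w
    (Fin.cons ((Q₁ - 1) * w 1) (Fin.cons 0 fun _ => 0))
    (Fin.cons 0 (Fin.cons 0 fun i : Fin r => (i : ℕ))) (by
      intro i j
      refine Fin.cases ?_ (fun i => Fin.cases ?_ (fun i => ?_) i) i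
      · simp only [Fin.cons_zero, pow_zero, one_mul, rowMatrix_zero, Pi.add_apply, Pi.smul_apply,
          smul_eq_mul]
        by_cases hj : j = 0
        · subst hj
          have : f 0 ^ Q₂ + -f 0 ^ (Q₂ - Q₁) * f 0 ^ Q₁ = 0 := by
            rw [neg_mul, ← pow_add, Nat.sub_add_cancel hQ, add_neg_cancel]
          rw [this]
          exact dvd_zero _
        · have h1 : w 1 ≤ w j := hw (by
            rw [Fin.le_def, Fin.val_one]
            have : (j : ℕ) ≠ 0 := fun h => hj (Fin.ext h)
            omega)
          have h2 : w j + (Q₁ - 1) * w 1 ≤ w j * Q₁ := by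
            obtain ⟨c, rfl⟩ : ∃ c, Q₁ = c + 1 := ⟨Q₁ - 1, by omega⟩
            simp only [Nat.add_sub_cancel]
            nlinarith
          have h3 : (PowerSeries.X : K⟦X⟧) ^ (w j + (Q₁ - 1) * w 1) ∣ f j ^ Q₁ :=
            (pow_dvd_pow _ h2).trans (by rw [pow_mul]; exact pow_dvd_pow_of_dvd (hf j) _)
          exact dvd_add (h3.trans (pow_dvd_pow _ hQ)) (h3.mul_left _)
      · simp only [add_zero, Fin.cons_zero, Fin.cons_succ, pow_zero, one_mul]
        exact (hf j).trans (dvd_pow_self _ (Nat.one_le_iff_ne_zero.1 ‹_›))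
      · simp only [add_zero, Fin.cons_succ, rowMatrix_succ_succ]
        exact X_pow_dvd_psHasse (hf j))
  rw [sum_rowWeights, sum_rowWeights] at key
  simpa using key

/-- Subtracting the second row from the first does not change the determinant. -/
theorem X_pow_dvd_det_rowMatrix_of_row {e : ℕ} (a b : Fin (r + 2) → K⟦X⟧)
    (H : Fin r → Fin (r + 2) → K⟦X⟧) (h : ∀ j, PowerSeries.X ^ e ∣ a j - b j) :
    PowerSeries.X ^ e ∣ (rowMatrix a b H).det := by
  rw [← det_rowMatrix_add_smul (-1)]
  have key := pow_dvd_det_of_weights (PowerSeries.X : K⟦X⟧)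
    (rowMatrix (a + (-1 : K⟦X⟧) • b) b H) (fun _ => 0)
    (Fin.cons e (Fin.cons 0 fun _ => 0)) (fun _ => 0) (by
      intro i j
      refine Fin.cases ?_ (fun i => Fin.cases ?_ (fun i => ?_) i) i
      · simpa [sub_eq_add_neg] using h j
      · simp
      · simp)
  rw [sum_rowWeights] at key
  simpa using key

end Bounds

/-! ### Bases with strictly increasing orders -/

section Adapted

variable {κ : Type*} [Field κ]

/-- Gaussian elimination from the lowest degree: if `j` is the least order occurring in `V`, the
series whose coefficient at `j` vanishes form a hyperplane, in which all orders exceed `j`. -/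
theorem exists_adapted_of_finrank (N : ℕ) : ∀ V : Submodule κ κ⟦X⟧, FiniteDimensional κ V →
    Module.finrank κ V = N → ∃ (b : Fin N → κ⟦X⟧) (w : Fin N → ℕ), StrictMono w ∧
      ∀ i, b i ∈ V ∧ PowerSeries.X ^ w i ∣ b i ∧ PowerSeries.coeff (w i) (b i) ≠ 0 := by
  classical
  induction N with
  | zero => exact fun V _ _ => ⟨Fin.elim0, Fin.elim0, fun i => i.elim0, fun i => i.elim0⟩
  | succ N ih =>
    intro V hfin hV
    have hex : ∃ j, ∃ v ∈ V, PowerSeries.coeff j v ≠ 0 := by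
      by_contra! h
      have : V = ⊥ := by
        rw [eq_bot_iff]
        intro v hv
        rw [Submodule.mem_bot]
        ext j
        simpa using h j v hv
      rw [this, finrank_bot] at hV
      omega
    set j := Nat.find hex with hj
    obtain ⟨b₀, hb₀, hb₀'⟩ := Nat.find_spec hex
    have hmin : ∀ v ∈ V, PowerSeries.X ^ j ∣ v := by
      intro v hv
      rw [PowerSeries.X_pow_dvd_iff]
      intro m hm
      by_contra h
      exact Nat.find_min hex hm ⟨v, hv, h⟩
    let φ : V →ₗ[κ] κ := (PowerSeries.coeff (R := κ) j).comp V.subtype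
    have hφ : LinearMap.range φ = ⊤ := by
      rw [LinearMap.range_eq_top]
      refine LinearMap.surjective ?_
      intro h
      exact hb₀' (congr($h ⟨b₀, hb₀⟩))
    have hker : Module.finrank κ (LinearMap.ker φ) = N := by
      have := LinearMap.finrank_range_add_finrank_ker φ
      rw [hφ, finrank_top, Module.finrank_self, hV] at this
      omega
    let V' := (LinearMap.ker φ).map V.subtype
    have hV' : Module.finrank κ V' = N := by
      rw [← hker]
      exact Submodule.finrank_map_subtype_eq V (LinearMap.ker φ)
    obtain ⟨b, w, hw, hb⟩ := ih V' inferInstance hV'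
    have hmem : ∀ i, b i ∈ V ∧ PowerSeries.coeff j (b i) = 0 := by
      intro i
      obtain ⟨⟨v, hv⟩, hvk, hvb⟩ := (hb i).1
      rw [← hvb]
      exact ⟨hv, hvk⟩
    have hgt : ∀ i, j < w i := by
      intro i
      by_contra hle
      have h1 := PowerSeries.X_pow_dvd_iff.1 (hmin _ (hmem i).1)
      rcases (not_lt.1 hle).lt_or_eq with h | h
      · exact (hb i).2.2 (h1 _ h)
      · exact (hb i).2.2 (h ▸ (hmem i).2)
    refine ⟨Fin.cons b₀ b, Fin.cons j w, ?_, ?_⟩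
    · intro i i' hii
      revert hii
      refine Fin.cases ?_ (fun i => ?_) i <;> refine Fin.cases ?_ (fun i' => ?_) i'
      · intro h; exact absurd h (lt_irrefl _)
      · intro _; simpa using hgt i'
      · intro h; exact absurd h (Fin.not_lt_zero _)
      · intro h; simpa using hw (by simpa using h)
    · intro i
      refine Fin.cases ?_ (fun i => ?_) i
      · exact ⟨hb₀, hmin _ hb₀, hb₀'⟩
      · exact ⟨(hmem i).1, (hb i).2.1, (hb i).2.2⟩

theorem linearIndependent_of_strictMono_order {N : ℕ} {b : Fin N → κ⟦X⟧} {w : Fin N → ℕ}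
    (hw : StrictMono w)
    (hb : ∀ i, PowerSeries.X ^ w i ∣ b i ∧ PowerSeries.coeff (w i) (b i) ≠ 0) :
    LinearIndependent κ b := by
  rw [Fintype.linearIndependent_iff]
  intro c hc i
  induction i using WellFoundedLT.induction with
  | ind i ih =>
    have h := congrArg (PowerSeries.coeff (w i)) hc
    rw [map_sum, map_zero, Finset.sum_eq_single i] at h
    · rw [map_smul, smul_eq_mul, mul_eq_zero] at h
      exact h.resolve_right (hb i).2
    · intro l _ hl
      rcases lt_or_gt_of_ne hl with h1 | h1
      · rw [ih l h1, zero_smul, map_zero]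
      · rw [map_smul, PowerSeries.X_pow_dvd_iff.1 (hb l).1 _ (hw h1), smul_zero]
    · simp

theorem exists_adapted {N : ℕ} {f : Fin N → κ⟦X⟧} (hf : LinearIndependent κ f) :
    ∃ (A : Matrix (Fin N) (Fin N) κ) (w : Fin N → ℕ), IsUnit A.det ∧ StrictMono w ∧
      ∀ i, PowerSeries.X ^ w i ∣ ∑ j, A i j • f j ∧
        PowerSeries.coeff (w i) (∑ j, A i j • f j) ≠ 0 := by
  obtain ⟨b, w, hw, hb⟩ := exists_adapted_of_finrank N (Submodule.span κ (Set.range f))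
    (FiniteDimensional.span_of_finite κ (Set.finite_range f)) (by simpa using finrank_span_eq_card hf)
  have hA : ∀ i, ∃ c : Fin N → κ, ∑ j, c j • f j = b i := fun i =>
    (Submodule.mem_span_range_iff_exists_fun κ).1 (hb i).1
  choose A hA using hA
  refine ⟨Matrix.of A, w, ?_, hw, fun i => ?_⟩
  -- A relation between the rows of `A` would be a relation between the `b i`, which are independent
  -- because their orders are distinct.
  · rw [← Matrix.isUnit_iff_isUnit_det, ← Matrix.linearIndependent_rows_iff_isUnit,
      Fintype.linearIndependent_iff]
    intro c hc
    have hli := linearIndependent_of_strictMono_order hw fun i => (hb i).2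
    rw [Fintype.linearIndependent_iff] at hli
    refine hli c ?_
    simp only [← hA, Finset.smul_sum, smul_smul]
    rw [Finset.sum_comm]
    refine Finset.sum_eq_zero fun j _ => ?_
    rw [← Finset.sum_smul]
    have := congrFun hc j
    simp only [Finset.sum_apply, Pi.smul_apply, smul_eq_mul, Pi.zero_apply, Matrix.row,
      Matrix.of_apply] at this
    rw [this, zero_smul]
  · simp only [Matrix.of_apply, hA]
    exact (hb i).2

end Adapted

/-! ### The Frobenius divisor in a local coordinate -/

section LocalFormula

variable {K L : Type*} [Field K] [Field L] [Algebra K L]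

theorem hasseDeriv_eq {t : L} (htr : Transcendental K t) (ht : IsSeparating K t)
    {τ : L →ₐ[K] L⟦X⟧} (hτ : IsTaylor t τ) (i : ℕ) (y : L) :
    hasseDeriv K t i y = PowerSeries.coeff i (τ y) := by
  have h : ∃ τ : L →ₐ[K] L⟦X⟧, IsTaylor t τ := ⟨τ, hτ⟩
  rw [hasseDeriv, dif_pos h, (existsUnique_isTaylor t htr ht).unique h.choose_spec hτ]

theorem frobDet_eq {t : L} (htr : Transcendental K t) (ht : IsSeparating K t)
    {τ : L →ₐ[K] L⟦X⟧} (hτ : IsTaylor t τ) {r : ℕ} (Q₁ Q₂ : ℕ) (f : Fin (r + 1 + 1) → L)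
    (κ : Fin (r + 1 - 1) → ℕ) (hκ : ∀ i, κ i = i) :
    frobDet K Q₁ Q₂ t f κ = (rowMatrix (r := r) (fun j => f j ^ Q₂) (fun j => f j ^ Q₁)
      fun i j => PowerSeries.coeff (i : ℕ) (τ (f j))).det := by
  rw [frobDet]
  congr 1
  refine rowMatrix_ext ?_ ?_ fun i => ?_
  · ext j
    simp
  · ext j
    simp
  · ext j
    have hi : (i.succ.succ : Fin (r + 1 + 1)).val - 2 < r + 1 - 1 := by
      have := i.2
      simp only [Fin.val_succ]
      omega
    simp only [Matrix.of_apply, rowMatrix_succ_succ]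
    rw [if_neg (by simp), if_neg (by simp), dif_pos hi, hκ, hasseDeriv_eq htr ht hτ]
    simp

/-- The minimal order is attained. -/
theorem exists_baseDivisor_eq {n : ℕ} (P : Place K L) (f : Fin (n + 1) → L) :
    ∃ i, baseDivisor f P = -P.ord (f i) ∧ ∀ j, P.ord (f i) ≤ P.ord (f j) := by
  obtain ⟨i, -, hi⟩ := Finset.exists_mem_eq_inf' (Finset.univ_nonempty (α := Fin (n + 1)))
    fun i => P.ord (f i)
  refine ⟨i, by rw [baseDivisor, hi], fun j => ?_⟩
  rw [← hi]
  exact Finset.inf'_le _ (Finset.mem_univ j)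

variable [HasValues K L] {P : Place K L} {π : L} (hπ : P.v π = WithZero.exp (-1))

/-- The derivatives in `π` are lower triangular combinations of the derivatives in `t` with diagonal
entries `(dt/dπ) ^ i`, while the two power rows do not depend on the variable. The factor on the
left is therefore `dt/dπ` to the power `∑ i`. -/
theorem laurent_det_rowMatrix {t : L} (ht : IsSeparating K t) {τ : L →ₐ[K] L⟦X⟧}
    (hτ : IsTaylor t τ) {r : ℕ} (Q₁ Q₂ : ℕ) (f : Fin (r + 2) → P.ring) :
    Place.laurent hπ ((taylorDerivation hτ π)⁻¹ ^ (∑ i : Fin r, (i : ℕ)) *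
      (rowMatrix (fun j => (f j : L) ^ Q₂) (fun j => (f j : L) ^ Q₁)
        fun i j => PowerSeries.coeff (i : ℕ) (τ (f j))).det) =
    algebraMap K⟦X⟧ (LaurentSeries K) (rowMatrix (fun j => Place.expansion hπ (f j) ^ Q₂)
      (fun j => Place.expansion hπ (f j) ^ Q₁)
        fun i j => psHasse (i : ℕ) (Place.expansion hπ (f j))).det := by
  set ι := Place.laurent hπ with hι
  set Z := laurentTaylor K (ι t) - PowerSeries.C (ι t) with hZdef
  have hZ : PowerSeries.constantCoeff Z = 0 := by
    simp [Z, constantCoeff_laurentTaylor]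
  have hZ1 : PowerSeries.coeff 1 Z = ι (taylorDerivation hτ π)⁻¹ := by
    rw [hι, Place.laurent_inv_taylorDerivation hπ ht hτ, Place.laurentDeriv, hZdef, map_sub,
      PowerSeries.coeff_C]
    simp [hι]
  rw [map_mul, map_pow, map_det_rowMatrix, map_det_rowMatrix]
  simp only [map_pow, ← Place.laurent_coe]
  have h1 := det_rowMatrix_triangular (r := r) (1 : LaurentSeries K) 1
    (fun i l => PowerSeries.coeff (i : ℕ) (Z ^ (l : ℕ)))
    (fun i l hil => coeff_pow_eq_zero_of_constantCoeff hZ hil) (fun j => ι (f j) ^ Q₂)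
    (fun j => ι (f j) ^ Q₁) (fun l j => ι (PowerSeries.coeff (l : ℕ) (τ (f j))))
  simp only [one_smul, one_mul, coeff_pow_self hZ, Finset.prod_pow_eq_pow_sum, hZ1] at h1
  rw [← h1]
  congr 2
  ext1 i
  ext1 j
  rw [Finset.sum_apply]
  simp only [Pi.smul_apply, smul_eq_mul]
  have h2 := coeff_laurentTaylor_laurent hπ ht hτ (f j : L) i
  rw [← hι, ← hZdef] at h2
  have h3 : PowerSeries.coeff (i : ℕ) (laurentTaylor K (ι (f j : L))) =
      algebraMap K⟦X⟧ (LaurentSeries K) (psHasse (i : ℕ) (Place.expansion hπ (f j))) := by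
    rw [hι, Place.laurent_coe, laurentTaylor_algebraMap, PowerSeries.coeff_map, coeff_psTaylor]
  rw [← h3, h2, Fin.sum_univ_eq_sum_range (fun l => PowerSeries.coeff (i : ℕ) (Z ^ l) *
    ι (PowerSeries.coeff l (τ (f j)))) r]
  have hi := i.2
  simp only [mul_comm (ι _)]
  refine (Finset.sum_subset (Finset.range_subset_range.2 hi) fun l _ hl => ?_).symm
  rw [Finset.mem_range] at hl
  rw [coeff_pow_eq_zero_of_constantCoeff hZ (by omega), zero_mul]

/-- Dividing by `f i₀`, a function of minimal order, is compensated by the multiple of `E`; passing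
to the local parameter is compensated by the multiple of `div (dt)`. Only the determinant of the
normalised expansions remains. -/
theorem le_frobDivisor {t : L} (htr : Transcendental K t) (ht : IsSeparating K t) {r : ℕ}
    (Q₁ Q₂ : ℕ) (f : Fin (r + 1 + 1) → L) (κ : Fin (r + 1 - 1) → ℕ) (hκ : ∀ i, κ i = i)
    (hdet : frobDet K Q₁ Q₂ t f κ ≠ 0) (i₀ : Fin (r + 1 + 1)) (hi₀ : f i₀ ≠ 0)
    (hbase : baseDivisor f P = -P.ord (f i₀)) (g : Fin (r + 2) → P.ring)
    (hg : ∀ j, (g j : L) = f j / f i₀) {N : ℕ}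
    (hN : PowerSeries.X ^ N ∣ (rowMatrix (fun j => Place.expansion hπ (g j) ^ Q₂)
      (fun j => Place.expansion hπ (g j) ^ Q₁)
        fun i j => psHasse (i : ℕ) (Place.expansion hπ (g j))).det) :
    (N : ℤ) ≤ frobDivisor Q₁ Q₂ t f κ P := by
  obtain ⟨τ, hτ, -⟩ := existsUnique_isTaylor t htr ht
  set h := f i₀
  have hf : ∀ j, f j = h * g j := fun j => by rw [hg, mul_div_cancel₀ _ hi₀]
  set A := (rowMatrix (fun j => (g j : L) ^ Q₂) (fun j => (g j : L) ^ Q₁)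
        fun i j => PowerSeries.coeff (i : ℕ) (τ (g j))).det with hA
  have e1 : frobDet K Q₁ Q₂ t f κ = h ^ Q₂ * h ^ Q₁ * h ^ r * A := by
    rw [frobDet_eq htr ht hτ Q₁ Q₂ f κ hκ]
    refine Eq.trans ?_ (det_rowMatrix_scale (τ : L →+* L⟦X⟧) hτ.1 (h ^ Q₂) (h ^ Q₁) h
      (fun j => (g j : L) ^ Q₂) (fun j => (g j : L) ^ Q₁) fun j => g j)
    congr 2
    · ext j; rw [hf]; simp [mul_pow]
    · ext j; rw [hf]; simp [mul_pow]
    · ext i j; rw [hf]; rfl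
  have hA0 : A ≠ 0 := by
    intro h0
    rw [h0, mul_zero] at e1
    exact hdet e1
  have hd := Place.taylorDerivation_uniformizer_ne_zero hπ ht hτ
  have e2 := Place.v_le_of_laurent_eq hπ (laurent_det_rowMatrix hπ ht hτ Q₁ Q₂ g) hN
  rw [P.v_le_exp_iff (mul_ne_zero (pow_ne_zero _ (inv_ne_zero hd)) hA0),
    P.ord_mul (pow_ne_zero _ (inv_ne_zero hd)) hA0, P.ord_pow, P.ord_inv,
    ← Place.ordDiff_D hπ ht hτ] at e2
  have e3 : ∑ i, (κ i : ℤ) = ((∑ i : Fin r, (i : ℕ) : ℕ) : ℤ) := by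
    push_cast
    exact Finset.sum_congr rfl fun i _ => by rw [hκ]
  rw [frobDivisor, e1, e3, hbase, P.ord_mul (by positivity) hA0, P.ord_mul (by positivity)
    (by positivity), P.ord_mul (by positivity) (by positivity), P.ord_pow, P.ord_pow, P.ord_pow]
  push_cast at e2 ⊢
  linarith

end LocalFormula

/-! ### Local parameters and expansions of functions defined over a finite field -/

section Rational

variable {K L : Type*} [Field K] [Field L] [Algebra K L]

/-- A nonzero polynomial is `X ^ k` times one with nonzero constant term, and the latter takes a
nonzero value where `π` vanishes. -/
theorem Place.v_aeval_eq_zero_or_pow (P : Place K L) {π : L} (hπ : P.v π < 1) (p : Polynomial K) :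
    P.v (Polynomial.aeval π p) = 0 ∨ ∃ k : ℕ, P.v (Polynomial.aeval π p) = P.v π ^ k := by
  by_cases hp : p = 0
  · left; simp [hp]
  right
  obtain ⟨g, hg, hg'⟩ := Polynomial.exists_eq_pow_rootMultiplicity_mul_and_not_dvd p hp 0
  rw [Polynomial.C_0, sub_zero] at hg hg'
  refine ⟨p.rootMultiplicity 0, ?_⟩
  have h0 : g.coeff 0 ≠ 0 := fun h => hg' (Polynomial.X_dvd_iff.2 h)
  have h1 : P.v (Polynomial.aeval π g) = 1 := by
    have e := Polynomial.divX_mul_X_add g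
    rw [← e, map_add, map_mul, Polynomial.aeval_X, Polynomial.aeval_C, Valuation.map_add_eq_of_lt_right,
      P.trivial _ h0]
    rw [P.trivial _ h0, map_mul]
    exact (mul_le_of_le_one_left' (P.v_aeval_le_one hπ.le _)).trans_lt hπ
  conv_lhs => rw [hg]
  rw [map_mul, map_pow, Polynomial.aeval_X, map_mul, map_pow, h1, mul_one]

variable {F : Type*} [Field F] [Algebra F L] {p : ℕ} [hp : Fact p.Prime] [CharP K p]

theorem charP_of_algebra (K : Type*) [Field K] (p : ℕ) [CharP K p] (R : Type*) [CommRing R]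
    [Nontrivial R] [Algebra K R] : CharP R p :=
  charP_of_injective_algebraMap (FaithfulSMul.algebraMap_injective K R) p

theorem sub_pow_of_algebra (K : Type*) [Field K] (p : ℕ) [Fact p.Prime] [CharP K p] {R : Type*}
    [CommRing R] [Nontrivial R] [Algebra K R] (s : ℕ) (x y : R) :
    (x - y) ^ p ^ s = x ^ p ^ s - y ^ p ^ s := by
  have := charP_of_algebra K p R
  exact sub_pow_char_pow x y s

theorem sum_pow_of_algebra (K : Type*) [Field K] (p : ℕ) [Fact p.Prime] [CharP K p] {R : Type*}
    [CommRing R] [Nontrivial R] [Algebra K R] (s : ℕ) {ι : Type*} (t : Finset ι) (x : ι → R) :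
    (∑ i ∈ t, x i) ^ p ^ s = ∑ i ∈ t, x i ^ p ^ s := by
  have := charP_of_algebra K p R
  exact sum_pow_char_pow p s t x

variable [HasValues K L] (P : Place K L)

/-- The value of `f` at `P` is fixed by some `p ^ s`-power map, so `f = f ^ (p ^ s) - π g` with `g`
again in `F` and regular. Approximating `f` and `g` to order `N + 1` approximates both terms to
order `N + 2`: the power multiplies the order by at least two, and `π` adds one. -/
theorem exists_aeval_approx (hK : ∀ c : K, ∃ s : ℕ, s ≠ 0 ∧ c ^ p ^ s = c) {π : L}
    (hπ1 : P.v π < 1)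
    (hπ : ∀ h : F, P.v (algebraMap F L h) < 1 →
      ∃ g : F, P.v (algebraMap F L g) ≤ 1 ∧ algebraMap F L h = π * algebraMap F L g) (N : ℕ) :
    ∀ f : F, P.v (algebraMap F L f) ≤ 1 → ∃ a : Polynomial K,
      P.v (algebraMap F L f - Polynomial.aeval π a) ≤ WithZero.exp (-((N + 1 : ℕ) : ℤ)) := by
  induction N with
  | zero =>
    intro f hf
    obtain ⟨c, hc⟩ := HasValues.exists_value P _ hf
    refine ⟨Polynomial.C c, ?_⟩
    rw [Polynomial.aeval_C]
    simpa using P.v_lt_one_iff_le.1 hc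
  | succ N ih =>
    intro f hf
    obtain ⟨c, hc⟩ := HasValues.exists_value P _ hf
    obtain ⟨s, hs, hcs⟩ := hK c
    have h1 : P.v (algebraMap F L (f ^ p ^ s - f)) < 1 := by
      have e : algebraMap F L (f ^ p ^ s - f) =
          (algebraMap F L f - algebraMap K L c) ^ p ^ s - (algebraMap F L f - algebraMap K L c) := by
        rw [sub_pow_of_algebra K p, ← map_pow (algebraMap K L), hcs, map_sub, map_pow]
        ring
      rw [e]
      refine P.v.map_sub_lt ?_ hc
      rw [map_pow]
      exact pow_lt_one' hc (pow_ne_zero _ hp.out.ne_zero)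
    obtain ⟨g, hg, hfg⟩ := hπ _ h1
    obtain ⟨a, ha⟩ := ih f hf
    obtain ⟨b, hb⟩ := ih g hg
    refine ⟨a ^ p ^ s - Polynomial.X * b, ?_⟩
    have e : algebraMap F L f - Polynomial.aeval π (a ^ p ^ s - Polynomial.X * b) =
        (algebraMap F L f - Polynomial.aeval π a) ^ p ^ s -
          π * (algebraMap F L g - Polynomial.aeval π b) := by
      rw [sub_pow_of_algebra K p, mul_sub, ← hfg]
      simp only [map_sub, map_pow, map_mul, Polynomial.aeval_X]
      ring
    rw [e]
    refine P.v.map_sub_le ?_ ?_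
    · rw [map_pow]
      refine (pow_le_pow_left₀ zero_le ha _).trans ?_
      rw [← WithZero.exp_nsmul, WithZero.exp_le_exp]
      have h2 : 2 ≤ p ^ s := hp.out.two_le.trans (Nat.le_self_pow hs p)
      have h3 : (2 : ℤ) ≤ ((p ^ s : ℕ) : ℤ) := by exact_mod_cast h2
      simp only [nsmul_eq_mul]
      push_cast at h3 ⊢
      nlinarith
    · rw [map_mul]
      refine (mul_le_mul' (P.v_lt_one_iff_le.1 hπ1) hb).trans ?_
      rw [← WithZero.exp_add, WithZero.exp_le_exp]
      push_cast
      omega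

/-- There is a local parameter defined over the field of constants of `F`. -/
theorem exists_uniformizer_algebraMap (hK : ∀ c : K, ∃ s : ℕ, s ≠ 0 ∧ c ^ p ^ s = c)
    (hspan : ∀ y : L, y ∈ Submodule.span K (Set.range (algebraMap F L))) :
    ∃ π : F, P.v (algebraMap F L π) = WithZero.exp (-1) := by
  classical
  -- Take `π` of least positive order among the elements of `F`. If no positive order occurs, then
  -- `0` is the only element of `F` vanishing at `P` and `π = 0` serves; this case is excluded at
  -- the end.
  have hπ : ∃ π : F, P.v (algebraMap F L π) < 1 ∧ ∀ h : F, P.v (algebraMap F L h) < 1 →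
      ∃ g : F, P.v (algebraMap F L g) ≤ 1 ∧
        algebraMap F L h = algebraMap F L π * algebraMap F L g := by
    by_cases hex : ∃ n : ℕ, 0 < n ∧ ∃ h : F, h ≠ 0 ∧ P.ord (algebraMap F L h) = n
    · obtain ⟨hn, π, hπ0, hπn⟩ := Nat.find_spec hex
      have hπ0' : algebraMap F L π ≠ 0 := by simpa using hπ0
      refine ⟨π, ?_, fun h hh => ⟨h / π, ?_, ?_⟩⟩
      · rw [P.v_lt_one_iff hπ0', hπn]
        exact_mod_cast hn
      · by_cases h0 : h = 0
        · simp [h0]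
        have h0' : algebraMap F L h ≠ 0 := by simpa using h0
        rw [P.v_lt_one_iff h0'] at hh
        rw [map_div₀, P.v_le_one_iff (div_ne_zero h0' hπ0'), P.ord_div h0' hπ0', hπn]
        have := Nat.find_min' hex (m := (P.ord (algebraMap F L h)).toNat)
          ⟨by omega, h, h0, by omega⟩
        omega
      · rw [← map_mul, mul_div_cancel₀ _ hπ0]
    · refine ⟨0, by simp, fun h hh => ⟨0, by simp, ?_⟩⟩
      by_contra h0
      have h0' : algebraMap F L h ≠ 0 := fun e => h0 (by simpa using e)
      have hne : h ≠ 0 := by simpa using h0'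
      rw [P.v_lt_one_iff h0'] at hh
      exact hex ⟨(P.ord (algebraMap F L h)).toNat, by omega, h, hne, by omega⟩
  obtain ⟨π, hπ1, hπ⟩ := hπ
  refine ⟨π, ?_⟩
  obtain ⟨y, hy⟩ := P.exists_uniformizer
  -- Up to a power of `π`, every function in the `K`-span of `F` is a limit of polynomials in `π`.
  -- The clause on `M` ensures that multiplying by `π ^ M` never kills a nonzero function, even if
  -- `π = 0`.
  have happrox : ∀ z ∈ Submodule.span K (Set.range (algebraMap F L)), ∃ M : ℕ,
      (π = 0 → M = 0) ∧ ∀ N : ℕ, ∃ a : Polynomial K, P.v (algebraMap F L π ^ M * z - Polynomial.aeval (algebraMap F L π) a) ≤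
        WithZero.exp (-((N + 1 : ℕ) : ℤ)) := by
    intro z hz
    induction hz using Submodule.span_induction with
    | mem z hz =>
      obtain ⟨f, rfl⟩ := hz
      have hM : ∃ M : ℕ, (π = 0 → M = 0) ∧ P.v (algebraMap F L (π ^ M * f)) ≤ 1 := by
        rcases le_or_gt (P.v (algebraMap F L f)) 1 with h1 | h1
        · exact ⟨0, fun _ => rfl, by simpa using h1⟩
        · have hf0 : f ≠ 0 := by
            rintro rfl
            simp at h1
          have hπ0 : π ≠ 0 := by
            rintro rfl
            obtain ⟨g, -, hg⟩ := hπ f⁻¹ (by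
              rw [map_inv₀, map_inv₀]
              exact inv_lt_one_of_one_lt₀ h1)
            simp [hf0] at hg
          have hf0' : algebraMap F L f ≠ 0 := by simpa using hf0
          have hπ0' : algebraMap F L π ≠ 0 := by simpa using hπ0
          refine ⟨(-P.ord (algebraMap F L f)).toNat, fun h => absurd h hπ0, ?_⟩
          rw [P.v_lt_one_iff hπ0'] at hπ1
          rw [map_mul, map_pow, P.v_le_one_iff (by positivity), P.ord_mul (by positivity) hf0',
            P.ord_pow]
          have h2 : -P.ord (algebraMap F L f) ≤ ((-P.ord (algebraMap F L f)).toNat : ℤ) :=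
            Int.self_le_toNat _
          nlinarith
      obtain ⟨M, hM0, hM⟩ := hM
      refine ⟨M, hM0, fun N => ?_⟩
      have := exists_aeval_approx (F := F) P hK hπ1 hπ N _ hM
      rwa [map_mul, map_pow] at this
    | zero => exact ⟨0, fun _ => rfl, fun N => ⟨0, by simp⟩⟩
    | add z₁ z₂ _ _ h₁ h₂ =>
      obtain ⟨M₁, h₁0, h₁⟩ := h₁
      obtain ⟨M₂, h₂0, h₂⟩ := h₂
      refine ⟨M₁ + M₂, fun h => by rw [h₁0 h, h₂0 h], fun N => ?_⟩
      obtain ⟨a₁, ha₁⟩ := h₁ N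
      obtain ⟨a₂, ha₂⟩ := h₂ N
      refine ⟨Polynomial.X ^ M₂ * a₁ + Polynomial.X ^ M₁ * a₂, ?_⟩
      have e : algebraMap F L π ^ (M₁ + M₂) * (z₁ + z₂) - Polynomial.aeval (algebraMap F L π)
          (Polynomial.X ^ M₂ * a₁ + Polynomial.X ^ M₁ * a₂) =
          algebraMap F L π ^ M₂ *
            (algebraMap F L π ^ M₁ * z₁ - Polynomial.aeval (algebraMap F L π) a₁) +
          algebraMap F L π ^ M₁ *
            (algebraMap F L π ^ M₂ * z₂ - Polynomial.aeval (algebraMap F L π) a₂) := by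
        simp only [map_add, map_mul, map_pow, Polynomial.aeval_X]
        ring
      rw [e]
      refine P.v.map_add_le ?_ ?_
      · rw [map_mul, map_pow]
        exact (mul_le_of_le_one_left' (pow_le_one' hπ1.le _)).trans ha₁
      · rw [map_mul, map_pow]
        exact (mul_le_of_le_one_left' (pow_le_one' hπ1.le _)).trans ha₂
    | smul c z _ h =>
      obtain ⟨M, h0, h⟩ := h
      refine ⟨M, h0, fun N => ?_⟩
      obtain ⟨a, ha⟩ := h N
      refine ⟨Polynomial.C c * a, ?_⟩
      have e : algebraMap F L π ^ M * c • z -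
          Polynomial.aeval (algebraMap F L π) (Polynomial.C c * a) = algebraMap K L c *
            (algebraMap F L π ^ M * z - Polynomial.aeval (algebraMap F L π) a) := by
        rw [map_mul, Polynomial.aeval_C, Algebra.smul_def]
        ring
      rw [e, map_mul]
      exact (mul_le_of_le_one_left' (P.v_algebraMap_le_one c)).trans ha
  obtain ⟨M, hM0, hM⟩ := happrox y (hspan y)
  have hy0 : y ≠ 0 := Place.uniformizer_ne_zero hy
  have hyo : P.ord y = 1 := ((P.v_eq_exp_iff 1).1 hy).2
  have hz0 : algebraMap F L π ^ M * y ≠ 0 := by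
    by_cases h : π = 0
    · simpa [hM0 h] using hy0
    · have : algebraMap F L π ≠ 0 := by simpa using h
      positivity
  obtain ⟨a, ha⟩ := hM (P.ord (algebraMap F L π ^ M * y)).toNat
  have hlt : P.v (algebraMap F L π ^ M * y - Polynomial.aeval (algebraMap F L π) a) <
      P.v (algebraMap F L π ^ M * y) := by
    refine ha.trans_lt ?_
    rw [P.v_eq_exp hz0, WithZero.exp_lt_exp]
    push_cast
    have := Int.self_le_toNat (P.ord (algebraMap F L π ^ M * y))
    omega
  -- A close enough approximation has the same order. A polynomial in `π` has order a multiple of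
  -- `ord π`, so for the parameter `y` of `L` the equation `M ord π + 1 = k ord π` forces `ord π =
  -- 1`.
  have hva : P.v (Polynomial.aeval (algebraMap F L π) a) = P.v (algebraMap F L π ^ M * y) := by
    rw [← P.v.map_sub_swap] at hlt
    exact (P.v.map_eq_of_sub_lt hlt)
  rcases P.v_aeval_eq_zero_or_pow hπ1 a with h | ⟨k, h⟩
  · rw [hva] at h
    exact absurd h ((P.v.ne_zero_iff).2 hz0)
  · rw [hva] at h
    by_cases hπ0 : π = 0
    · rw [hM0 hπ0, pow_zero, one_mul, hy, hπ0, map_zero, map_zero] at h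
      rcases Nat.eq_zero_or_pos k with rfl | hk
      · rw [pow_zero, ← WithZero.exp_zero, WithZero.exp_inj] at h
        omega
      · rw [zero_pow hk.ne'] at h
        exact absurd h WithZero.exp_ne_zero
    · have hπ0' : algebraMap F L π ≠ 0 := by simpa using hπ0
      rw [P.v_lt_one_iff hπ0'] at hπ1
      have h' := congrArg (fun x => -WithZero.log x) h
      change P.ord _ = _ at h'
      rw [P.ord_mul (by positivity) hy0, P.ord_pow, hyo, WithZero.log_pow] at h'
      rw [P.v_eq_exp hπ0', WithZero.exp_inj, neg_inj]
      have h'' : (M : ℤ) * P.ord (algebraMap F L π) + 1 = k * P.ord (algebraMap F L π) := by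
        rw [h', Place.ord]
        simp
      have : P.ord (algebraMap F L π) ∣ 1 := ⟨k - M, by linarith⟩
      exact Int.eq_one_of_dvd_one hπ1.le this

end Rational

/-! ### Local bounds for the Frobenius divisor -/

section FixedCoefficients

variable {K : Type*} [Field K] {p : ℕ} [hp : Fact p.Prime] [CharP K p]

/-- For `i > 0` and exponent at least two, coefficient `i` of a `p ^ s`-th power depends only on the
coefficients of `g` below `i`, so `g` may be truncated to a polynomial with fixed coefficients. -/
theorem coeff_pow_char_pow_fixed {s : ℕ} (hs : s ≠ 0) {g : K⟦X⟧} {i : ℕ} (hi : i ≠ 0)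
    (h : ∀ l < i, PowerSeries.coeff l g ^ p ^ s = PowerSeries.coeff l g) :
    PowerSeries.coeff i (g ^ p ^ s) ^ p ^ s = PowerSeries.coeff i (g ^ p ^ s) := by
  have hpK : ExpChar K p := inferInstance
  set φ : K →+* K := iterateFrobenius K p s
  have hφ : ∀ x, φ x = x ^ p ^ s := fun x => iterateFrobenius_def p s x
  set g₀ : K⟦X⟧ := (PowerSeries.trunc i g : K⟦X⟧) with hg₀
  have h1 : PowerSeries.X ^ i ∣ g - g₀ := by
    rw [PowerSeries.X_pow_dvd_iff]
    intro m hm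
    rw [map_sub, hg₀, Polynomial.coeff_coe, PowerSeries.coeff_trunc, if_pos hm, sub_self]
  have h2 : PowerSeries.coeff i (g ^ p ^ s) = PowerSeries.coeff i (g₀ ^ p ^ s) := by
    rw [← sub_eq_zero, ← map_sub, ← sub_pow_of_algebra K p]
    have h3 := pow_dvd_pow_of_dvd h1 (p ^ s)
    rw [← pow_mul] at h3
    refine PowerSeries.X_pow_dvd_iff.1 h3 i ?_
    have h4 : 2 ≤ p ^ s := hp.out.two_le.trans (Nat.le_self_pow hs p)
    have : 0 < i := Nat.pos_of_ne_zero hi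
    nlinarith
  have h5 : PowerSeries.map φ g₀ = g₀ := by
    ext m
    rw [PowerSeries.coeff_map, hg₀, Polynomial.coeff_coe, PowerSeries.coeff_trunc]
    split_ifs with hm
    · rw [hφ, h m hm]
    · simp
  rw [h2, ← hφ, ← PowerSeries.coeff_map, map_pow, h5]

/-- The elimination is carried out over the subfield fixed by `φ`, where all the coefficients lie,
and the result is extended to `K`. -/
theorem exists_adapted_fixed (φ : K →+* K) {N : ℕ} {g : Fin N → K⟦X⟧}
    (hg : ∀ j i, φ (PowerSeries.coeff i (g j)) = PowerSeries.coeff i (g j))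
    (hli : LinearIndependent K g) :
    ∃ (A : Matrix (Fin N) (Fin N) K) (w : Fin N → ℕ), (∀ i j, φ (A i j) = A i j) ∧
      IsUnit A.det ∧ StrictMono w ∧
      ∀ i, PowerSeries.X ^ w i ∣ ∑ j, PowerSeries.C (A i j) * g j ∧
        PowerSeries.coeff (w i) (∑ j, PowerSeries.C (A i j) * g j) ≠ 0 := by
  let κ : Subfield K := RingHom.eqLocusField φ (RingHom.id K)
  let g' : Fin N → κ⟦X⟧ := fun j => PowerSeries.mk fun i => ⟨PowerSeries.coeff i (g j), hg j i⟩
  have hg' : ∀ j, PowerSeries.map κ.subtype (g' j) = g j := by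
    intro j
    ext i
    rw [PowerSeries.coeff_map, PowerSeries.coeff_mk]
    rfl
  have hli' : LinearIndependent κ g' := by
    rw [Fintype.linearIndependent_iff] at hli ⊢
    intro c hc i
    have h1 := hli (fun i => (c i : K)) (by
      have h2 := congrArg (PowerSeries.map κ.subtype) hc
      rw [map_sum, map_zero] at h2
      rw [← h2]
      refine Finset.sum_congr rfl fun j _ => ?_
      rw [PowerSeries.smul_eq_C_mul, PowerSeries.smul_eq_C_mul, map_mul, hg', PowerSeries.map_C]
      rfl) i
    exact Subtype.ext h1
  obtain ⟨A, w, hA, hw, hb⟩ := exists_adapted hli'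
  have e : ∀ i, ∑ j, PowerSeries.C ((A.map κ.subtype) i j) * g j =
      PowerSeries.map κ.subtype (∑ j, A i j • g' j) := by
    intro i
    rw [map_sum]
    refine Finset.sum_congr rfl fun j _ => ?_
    rw [PowerSeries.smul_eq_C_mul, map_mul, hg', PowerSeries.map_C]
    rfl
  refine ⟨A.map κ.subtype, w, fun i j => (A i j).2, ?_, hw, fun i => ?_⟩
  · have : (A.map κ.subtype).det = κ.subtype A.det := (RingHom.map_det κ.subtype A).symm
    rw [this]
    exact hA.map κ.subtype
  · rw [e]
    constructor
    · have := map_dvd (PowerSeries.map κ.subtype) (hb i).1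
      rwa [map_pow, PowerSeries.map_X] at this
    · rw [PowerSeries.coeff_map]
      exact (map_ne_zero _).2 (hb i).2

end FixedCoefficients

/-! ### Change of basis of the linear series -/

section BaseChange

variable {K : Type*} [Field K] {r : ℕ}

theorem X_pow_dvd_mul_det_of_baseChange {A : Matrix (Fin (r + 2)) (Fin (r + 2)) K}
    (hA : IsUnit A.det) (a b : Fin (r + 2) → K⟦X⟧) (H : Fin r → Fin (r + 2) → K⟦X⟧)
    {N : ℕ} {c : K⟦X⟧} (h : PowerSeries.X ^ N ∣ c *
      (rowMatrix ((A.map PowerSeries.C).mulVec a) ((A.map PowerSeries.C).mulVec b)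
        fun i => (A.map PowerSeries.C).mulVec (H i)).det) :
    PowerSeries.X ^ N ∣ c * (rowMatrix a b H).det := by
  rw [← rowMatrix_mul, Matrix.det_mul, Matrix.det_transpose, ← mul_assoc] at h
  have : (A.map PowerSeries.C).det = PowerSeries.C A.det := (RingHom.map_det _ A).symm
  rw [this] at h
  exact (hA.map PowerSeries.C).dvd_mul_right.1 h

/-- The power map is additive in characteristic `p` and fixes the entries of `A`. This is why the
basis has to be adapted over the fixed field. -/
theorem mulVec_pow {p : ℕ} [Fact p.Prime] [CharP K p] {s : ℕ} {N : ℕ}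
    {A : Matrix (Fin N) (Fin N) K} (hA : ∀ i j, A i j ^ p ^ s = A i j)
    (g : Fin N → K⟦X⟧) : (A.map PowerSeries.C).mulVec (fun j => g j ^ p ^ s) =
      fun i => (∑ j, PowerSeries.C (A i j) * g j) ^ p ^ s := by
  ext1 i
  rw [sum_pow_of_algebra K p, Matrix.mulVec, dotProduct]
  refine Finset.sum_congr rfl fun j _ => ?_
  rw [mul_pow, ← map_pow, hA]
  rfl

theorem mulVec_psHasse {N : ℕ} (A : Matrix (Fin N) (Fin N) K) (l : ℕ) (g : Fin N → K⟦X⟧) :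
    (A.map PowerSeries.C).mulVec (fun j => psHasse l (g j)) =
      fun i => psHasse l (∑ j, PowerSeries.C (A i j) * g j) := by
  ext1 i
  rw [Matrix.mulVec, dotProduct, ← coeff_psTaylor, map_sum, map_sum]
  refine Finset.sum_congr rfl fun j _ => ?_
  rw [map_mul, psTaylor_C, PowerSeries.coeff_C_mul, coeff_psTaylor]
  rfl

theorem val_le_of_strictMono {N : ℕ} {w : Fin N → ℕ} (hw : StrictMono w) (i : Fin N) :
    (i : ℕ) ≤ w i := by
  obtain ⟨i, hi⟩ := i
  induction i with
  | zero => exact Nat.zero_le _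
  | succ i ih =>
    have h1 := ih (by omega)
    have h2 : w ⟨i, by omega⟩ < w ⟨i + 1, hi⟩ := hw (by simp)
    simp only at h1 ⊢
    omega

end BaseChange

/-! ### Expansions and orders at rational points -/

section PointBounds

variable {K L F : Type*} [Field K] [Field L] [Algebra K L] [Field F] [Algebra F L]
  {p : ℕ} [hp : Fact p.Prime] [CharP K p] [HasValues K L] {P : Place K L}

/-- At a rational point `f = f ^ (p ^ s) - π g` with `g` in `F` regular, since `π` lies in `F`.
Coefficient `i + 1` of the power is fixed because the earlier coefficients of `f` are, and that of
`π g` is coefficient `i` of `g`. The induction therefore runs over all `f` at once. -/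
theorem coeff_expansion_fixed {s : ℕ} (hs : s ≠ 0) (hP : P ∈ rationalPoints K L F (p ^ s)) {π : F}
    (hπ : P.v (algebraMap F L π) = WithZero.exp (-1)) (i : ℕ) :
    ∀ (f : F) (hf : P.v (algebraMap F L f) ≤ 1),
      PowerSeries.coeff i (Place.expansion hπ ⟨algebraMap F L f, hf⟩) ^ p ^ s =
        PowerSeries.coeff i (Place.expansion hπ ⟨algebraMap F L f, hf⟩) := by
  induction i using Nat.strong_induction_on with
  | _ i ih =>
    intro f hf
    have hlt := hP f hf
    cases i with
    | zero =>
      rw [PowerSeries.coeff_zero_eq_constantCoeff_apply, Place.coeff_zero_expansion, ← map_pow,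
        ← sub_eq_zero, ← map_sub, P.value_eq_zero_iff]
      exact hlt
    | succ i =>
      set y : P.ring := ⟨algebraMap F L f, hf⟩
      have hπ0 : algebraMap F L π ≠ 0 := Place.uniformizer_ne_zero hπ
      have hg : P.v (algebraMap F L ((f ^ p ^ s - f) / π)) ≤ 1 := by
        have := (Place.v_div_uniformizer_le hπ (n := 0)
          (y := algebraMap F L f ^ p ^ s - algebraMap F L f)).2
          (by simpa using P.v_lt_one_iff_le.1 hlt)
        simpa using this
      have hπ1 : P.v (algebraMap F L π) ≤ 1 := (P.v_lt_one_iff_le.2 hπ.le).le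
      have e1 : y ^ p ^ s - y = ⟨algebraMap F L π, hπ1⟩ *
          ⟨algebraMap F L ((f ^ p ^ s - f) / π), hg⟩ := by
        ext
        simp only [y, AddSubgroupClass.coe_sub, SubmonoidClass.coe_pow, MulMemClass.coe_mul, map_div₀,
          map_sub, map_pow]
        field_simp
      have e2 := congrArg (Place.expansion hπ) e1
      rw [map_sub, map_pow, map_mul, Place.expansion_uniformizer] at e2
      have e3 := congrArg (PowerSeries.coeff (i + 1)) e2
      rw [map_sub, PowerSeries.coeff_succ_X_mul, sub_eq_iff_eq_add', ← sub_eq_iff_eq_add] at e3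
      rw [← e3, sub_pow_of_algebra K p, coeff_pow_char_pow_fixed hs (Nat.succ_ne_zero i)
        (fun l hl => ih l hl f hf), ih i (Nat.lt_succ_self i)]

theorem coeff_expansion_sum {π : L} (hπ : P.v π = WithZero.exp (-1)) {N : ℕ} (g : Fin N → P.ring)
    (c : Fin N → K) : Place.expansion hπ (∑ j, P.const (c j) * g j) =
      ∑ j, PowerSeries.C (c j) * Place.expansion hπ (g j) := by
  rw [map_sum]
  exact Finset.sum_congr rfl fun j _ => by rw [map_mul, Place.expansion_const]

theorem linearIndependent_expansion {π : L} (hπ : P.v π = WithZero.exp (-1)) {N : ℕ}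
    {f : Fin N → L} (hf : LinearIndependent K f) {h : L} (hh : h ≠ 0) (g : Fin N → P.ring)
    (hg : ∀ j, (g j : L) = f j / h) : LinearIndependent K fun j => Place.expansion hπ (g j) := by
  rw [Fintype.linearIndependent_iff] at hf ⊢
  intro c hc
  refine hf c ?_
  have h1 : Place.expansion hπ (∑ j, P.const (c j) * g j) = 0 := by
    rw [coeff_expansion_sum, ← hc]
    exact Finset.sum_congr rfl fun j _ => by rw [PowerSeries.smul_eq_C_mul]
  have h2 := congrArg (fun y : P.ring => (y : L)) ((map_eq_zero_iff _
    (Place.expansion_injective hπ)).1 h1)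
  simp only [AddSubmonoidClass.coe_finsetSum, MulMemClass.coe_mul, ZeroMemClass.coe_zero, hg,
    Place.const] at h2
  have h3 : ∑ j, c j • f j = h * ∑ j, algebraMap K L (c j) * (f j / h) := by
    rw [Finset.mul_sum]
    refine Finset.sum_congr rfl fun j _ => ?_
    rw [Algebra.smul_def]
    field_simp
  rw [h3, h2, mul_zero]

theorem ord_eq_of_expansion {π : L} (hπ : P.v π = WithZero.exp (-1)) {y : P.ring} {w : ℕ}
    (h1 : PowerSeries.X ^ w ∣ Place.expansion hπ y)
    (h2 : PowerSeries.coeff w (Place.expansion hπ y) ≠ 0) : (y : L) ≠ 0 ∧ P.ord y = w := by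
  have hy0 : (y : L) ≠ 0 := by
    intro h
    have : y = 0 := Subtype.ext h
    simp [this] at h2
  refine ⟨hy0, ?_⟩
  have h3 := (Place.X_pow_dvd_expansion_iff hπ w y).1 h1
  have h4 : ¬ P.v (y : L) ≤ WithZero.exp (-((w + 1 : ℕ) : ℤ)) := by
    rw [← Place.X_pow_dvd_expansion_iff hπ]
    intro h
    exact h2 (PowerSeries.X_pow_dvd_iff.1 h w (Nat.lt_succ_self w))
  rw [P.v_le_exp_iff hy0] at h3 h4
  push_cast at h4
  omega

theorem nth_range_strictMono {N : ℕ} {w : Fin N → ℕ} (hw : StrictMono w) (i : Fin N) :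
    Nat.nth (fun j => ∃ i, w i = j) i = w i := by
  classical
  have hc : Nat.count (fun j => ∃ i, w i = j) (w i) = i := by
    rw [Nat.count_eq_card_filter_range]
    have : {x ∈ Finset.range (w i) | ∃ i, w i = x} = (Finset.univ.filter (· < i)).image w := by
      ext x
      simp only [Finset.mem_filter, Finset.mem_range, Finset.mem_image, Finset.mem_univ, true_and]
      constructor
      · rintro ⟨h, l, rfl⟩
        exact ⟨l, hw.lt_iff_lt.1 h, rfl⟩
      · rintro ⟨l, h, rfl⟩
        exact ⟨hw h, l, rfl⟩
    rw [this, Finset.card_image_of_injective _ hw.injective, Finset.filter_gt_eq_Iio, Fin.card_Iio]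
  conv_lhs => rw [← hc]
  exact Nat.nth_count (p := fun j => ∃ i, w i = j) ⟨i, rfl⟩

theorem orderAt_eq {n : ℕ} {π : L} (hπ : P.v π = WithZero.exp (-1)) {f : Fin (n + 1) → L}
    (i₀ : Fin (n + 1)) (hi₀ : f i₀ ≠ 0) (hbase : baseDivisor f P = -P.ord (f i₀))
    (g : Fin (n + 1) → P.ring) (hg : ∀ j, (g j : L) = f j / f i₀)
    {A : Matrix (Fin (n + 1)) (Fin (n + 1)) K} {w : Fin (n + 1) → ℕ} (hA : IsUnit A.det)
    (hw : StrictMono w)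
    (hb : ∀ i, PowerSeries.X ^ w i ∣ ∑ j, PowerSeries.C (A i j) * Place.expansion hπ (g j) ∧
      PowerSeries.coeff (w i) (∑ j, PowerSeries.C (A i j) * Place.expansion hπ (g j)) ≠ 0)
    (i : Fin (n + 1)) : orderAt f P i = w i := by
  have hord : ∀ a : Fin (n + 1) → K, ((∑ j, P.const (a j) * g j : P.ring) : L) ≠ 0 →
      P.ord (∑ j, a j • f j) + baseDivisor f P = P.ord ((∑ j, P.const (a j) * g j : P.ring) : L) := by
    intro a ha
    have e : ∑ j, a j • f j = f i₀ * ((∑ j, P.const (a j) * g j : P.ring) : L) := by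
      simp only [AddSubmonoidClass.coe_finsetSum, MulMemClass.coe_mul, hg, Place.const,
        Finset.mul_sum]
      refine Finset.sum_congr rfl fun j _ => ?_
      rw [Algebra.smul_def]
      field_simp
    rw [e, P.ord_mul hi₀ ha, hbase]
    ring
  have key : IsOrderAt f P = fun j => ∃ i, w i = j := by
    ext j
    constructor
    · rintro ⟨D, ⟨a, ha, rfl⟩, hD⟩
      -- In the coordinates `c` of the section in the adapted basis, the first nonzero one, at index
      -- `l`, determines the order `w l`.
      set c : Fin (n + 1) → K := Matrix.vecMul a A⁻¹ with hc
      have hca : Matrix.vecMul c A = a := by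
        rw [hc, Matrix.vecMul_vecMul, Matrix.nonsing_inv_mul _ hA, Matrix.vecMul_one]
      have hc0 : ∃ l, c l ≠ 0 := by
        by_contra! h
        apply ha
        rw [← hca, show c = 0 from funext h, Matrix.zero_vecMul]
      obtain ⟨l, hl, hmin⟩ : ∃ l, c l ≠ 0 ∧ ∀ l' < l, c l' = 0 := by
        obtain ⟨l, hl, hm⟩ := WellFounded.has_min (wellFounded_lt (α := Fin (n + 1)))
          {l | c l ≠ 0} hc0
        refine ⟨l, hl, fun l' hl' => ?_⟩
        by_contra h
        exact hm l' h hl'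
      have hE : Place.expansion hπ (∑ j, P.const (a j) * g j) =
          ∑ i, PowerSeries.C (c i) * ∑ j, PowerSeries.C (A i j) * Place.expansion hπ (g j) := by
        rw [coeff_expansion_sum]
        simp only [Finset.mul_sum]
        rw [Finset.sum_comm]
        refine Finset.sum_congr rfl fun j _ => ?_
        have : a j = ∑ i, c i * A i j := by
          rw [← hca]
          rfl
        rw [this, map_sum, Finset.sum_mul]
        refine Finset.sum_congr rfl fun i _ => ?_
        rw [map_mul, mul_assoc]
      have h1 : PowerSeries.X ^ w l ∣ Place.expansion hπ (∑ j, P.const (a j) * g j) := by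
        rw [hE]
        refine Finset.dvd_sum fun i _ => ?_
        rcases lt_or_ge i l with h | h
        · simp [hmin i h]
        · exact ((pow_dvd_pow _ (hw.monotone h)).trans (hb i).1).mul_left _
      have h2 : PowerSeries.coeff (w l) (Place.expansion hπ (∑ j, P.const (a j) * g j)) ≠ 0 := by
        rw [hE, map_sum, Finset.sum_eq_single l]
        · rw [PowerSeries.coeff_C_mul]
          exact mul_ne_zero hl (hb l).2
        · intro i _ hil
          rcases lt_or_gt_of_ne hil with h | h
          · simp [hmin i h]
          · rw [PowerSeries.coeff_C_mul, PowerSeries.X_pow_dvd_iff.1 (hb i).1 _ (hw h), mul_zero]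
        · simp
      obtain ⟨h3, h4⟩ := ord_eq_of_expansion hπ h1 h2
      refine ⟨l, ?_⟩
      have h5 := hord a h3
      simp only at hD
      rw [h5, h4] at hD
      exact_mod_cast hD
    · rintro ⟨i, rfl⟩
      have h0 := hb i
      rw [← coeff_expansion_sum] at h0
      obtain ⟨h3, h4⟩ := ord_eq_of_expansion hπ h0.1 h0.2
      refine ⟨_, ⟨A i, ?_, rfl⟩, ?_⟩
      · intro h
        apply h3
        simp [h, Place.const]
      · exact (hord _ h3).trans h4
  rw [orderAt, key]
  exact nth_range_strictMono hw i

end PointBounds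

/-! ### Multiplicity of the Frobenius divisor at the rational points -/

section FrobeniusBounds

variable {K L F : Type*} [Field K] [Field L] [Algebra K L] [Field F] [Algebra F L]
  {p : ℕ} [hp : Fact p.Prime] [CharP K p] [HasValues K L]

/-- Local data at a place: a local parameter from `F` and the functions normalised to be regular
without common zero. -/
theorem exists_local_data (hK : ∀ c : K, ∃ s : ℕ, s ≠ 0 ∧ c ^ p ^ s = c)
    (hspan : ∀ y : L, y ∈ Submodule.span K (Set.range (algebraMap F L))) (P : Place K L) {n : ℕ}
    {φ : Fin (n + 1) → F} (hφ : LinearIndependent K fun i => algebraMap F L (φ i)) :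
    ∃ (π : F) (_ : P.v (algebraMap F L π) = WithZero.exp (-1)) (i₀ : Fin (n + 1)) (x : Fin (n + 1) → F)
      (g : Fin (n + 1) → P.ring), algebraMap F L (φ i₀) ≠ 0 ∧
      baseDivisor (fun i => algebraMap F L (φ i)) P = -P.ord (algebraMap F L (φ i₀)) ∧
      (∀ j, (g j : L) = algebraMap F L (φ j) / algebraMap F L (φ i₀)) ∧
      ∀ j, (g j : L) = algebraMap F L (x j) := by
  obtain ⟨π, hπ⟩ := exists_uniformizer_algebraMap P hK hspan
  obtain ⟨i₀, h1, h2⟩ := exists_baseDivisor_eq P fun i => algebraMap F L (φ i)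
  have h0 : ∀ i, algebraMap F L (φ i) ≠ 0 := fun i => hφ.ne_zero i
  refine ⟨π, hπ, i₀, fun j => φ j / φ i₀, fun j => ⟨algebraMap F L (φ j) / algebraMap F L (φ i₀), ?_⟩,
    h0 i₀, h1, fun j => rfl, fun j => by simp⟩
  change P.v _ ≤ 1
  rw [P.v_le_one_iff (div_ne_zero (h0 j) (h0 i₀)), P.ord_div (h0 j) (h0 i₀)]
  have := h2 j
  omega

variable {P : Place K L} {r : ℕ} {φ : Fin (r + 1 + 1) → F} {t : L} {κ : Fin (r + 1 - 1) → ℕ}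

theorem frobDivisor_nonneg
    (hK : ∀ c : K, ∃ s : ℕ, s ≠ 0 ∧ c ^ p ^ s = c)
    (hspan : ∀ y : L, y ∈ Submodule.span K (Set.range (algebraMap F L)))
    (hφ : LinearIndependent K fun i => algebraMap F L (φ i))
    (htr : Transcendental K t) (ht : IsSeparating K t) (hκ : ∀ i, κ i = i) {Q₁ Q₂ : ℕ}
    (hdet : frobDet K Q₁ Q₂ t (fun i => algebraMap F L (φ i)) κ ≠ 0) :
    0 ≤ frobDivisor Q₁ Q₂ t (fun i => algebraMap F L (φ i)) κ P := by
  obtain ⟨π, hπ, i₀, x, g, h0, hb, hg, hx⟩ := exists_local_data hK hspan P hφ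
  simpa using le_frobDivisor hπ htr ht Q₁ Q₂ (fun i => algebraMap F L (φ i)) κ hκ hdet i₀ h0 hb g hg
    (N := 0) (by simp)

theorem expansion_fixed_of_rational {s : ℕ} (hs : s ≠ 0) (hP : P ∈ rationalPoints K L F (p ^ s))
    {π : F} (hπ : P.v (algebraMap F L π) = WithZero.exp (-1)) {g : P.ring} {x : F}
    (hx : (g : L) = algebraMap F L x) (i : ℕ) :
    PowerSeries.coeff i (Place.expansion hπ g) ^ p ^ s =
      PowerSeries.coeff i (Place.expansion hπ g) := by
  have hv : P.v (algebraMap F L x) ≤ 1 := hx ▸ g.2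
  have : g = ⟨algebraMap F L x, hv⟩ := Subtype.ext hx
  rw [this]
  exact coeff_expansion_fixed hs hP hπ i x hv

theorem exists_adapted_of_rational {s : ℕ} (hs : s ≠ 0)
    (hP : P ∈ rationalPoints K L F (p ^ s)) {π : F}
    (hπ : P.v (algebraMap F L π) = WithZero.exp (-1)) {N : ℕ} {f : Fin N → L}
    (hf : LinearIndependent K f) {h : L} (hh : h ≠ 0) (g : Fin N → P.ring)
    (hg : ∀ j, (g j : L) = f j / h) {x : Fin N → F} (hx : ∀ j, (g j : L) = algebraMap F L (x j)) :
    ∃ (A : Matrix (Fin N) (Fin N) K) (w : Fin N → ℕ), (∀ i j, A i j ^ p ^ s = A i j) ∧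
      IsUnit A.det ∧ StrictMono w ∧
      ∀ i, PowerSeries.X ^ w i ∣ ∑ j, PowerSeries.C (A i j) * Place.expansion hπ (g j) ∧
        PowerSeries.coeff (w i) (∑ j, PowerSeries.C (A i j) * Place.expansion hπ (g j)) ≠ 0 := by
  have hpK : ExpChar K p := inferInstance
  obtain ⟨A, w, hA, h⟩ := exists_adapted_fixed (iterateFrobenius K p s)
    (g := fun j => Place.expansion hπ (g j)) (fun j i => by
      rw [iterateFrobenius_def]
      exact expansion_fixed_of_rational hs hP hπ (hx j) i)
    (linearIndependent_expansion hπ hf hh g hg)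
  exact ⟨A, w, fun i j => by rw [← iterateFrobenius_def, hA], h⟩

/-- Only the row of `p ^ s`-th powers has to be compatible with the recombination; the row `a` is
arbitrary and stays arbitrary. The same bound thus serves both Frobenius rows. -/
theorem one_row_bound {s : ℕ} (hs : s ≠ 0) (hP : P ∈ rationalPoints K L F (p ^ s)) {π : F}
    (hπ : P.v (algebraMap F L π) = WithZero.exp (-1)) {f : Fin (r + 2) → L}
    (hf : LinearIndependent K f) {h : L} (hh : h ≠ 0) (g : Fin (r + 2) → P.ring)
    (hg : ∀ j, (g j : L) = f j / h) {x : Fin (r + 2) → F}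
    (hx : ∀ j, (g j : L) = algebraMap F L (x j)) (a : Fin (r + 2) → K⟦X⟧) :
    PowerSeries.X ^ r ∣ (rowMatrix a (fun j => Place.expansion hπ (g j) ^ p ^ s)
      fun i j => psHasse (i : ℕ) (Place.expansion hπ (g j))).det := by
  obtain ⟨A, w, hA, hdet, hw, hb⟩ := exists_adapted_of_rational hs hP hπ hf hh g hg hx
  have := X_pow_dvd_mul_det_of_baseChange hdet a (fun j => Place.expansion hπ (g j) ^ p ^ s)
    (fun i j => psHasse (i : ℕ) (Place.expansion hπ (g j))) (N := r) (c := 1) (by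
      rw [one_mul, mulVec_pow hA]
      simp only [mulVec_psHasse]
      refine X_pow_dvd_det_rowMatrix_of_one_row (Nat.one_le_pow _ _ hp.out.pos) _ _ fun j => ?_
      exact (pow_dvd_pow _ (val_le_of_strictMono hw j)).trans (hb j).1)
  simpa using this

theorem le_frobDivisor_of_rational_left
    (hK : ∀ c : K, ∃ s : ℕ, s ≠ 0 ∧ c ^ p ^ s = c)
    (hspan : ∀ y : L, y ∈ Submodule.span K (Set.range (algebraMap F L)))
    (hφ : LinearIndependent K fun i => algebraMap F L (φ i))
    (htr : Transcendental K t) (ht : IsSeparating K t) (hκ : ∀ i, κ i = i) {s Q₂ : ℕ} (hs : s ≠ 0)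
    (hdet : frobDet K (p ^ s) Q₂ t (fun i => algebraMap F L (φ i)) κ ≠ 0)
    (hP : P ∈ rationalPoints K L F (p ^ s)) :
    (r : ℤ) ≤ frobDivisor (p ^ s) Q₂ t (fun i => algebraMap F L (φ i)) κ P := by
  obtain ⟨π, hπ, i₀, x, g, h0, hb, hg, hx⟩ := exists_local_data hK hspan P hφ
  exact le_frobDivisor hπ htr ht _ Q₂ (fun i => algebraMap F L (φ i)) κ hκ hdet i₀ h0 hb g hg
    (one_row_bound hs hP hπ hφ h0 g hg hx _)

theorem le_frobDivisor_of_rational_right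
    (hK : ∀ c : K, ∃ s : ℕ, s ≠ 0 ∧ c ^ p ^ s = c)
    (hspan : ∀ y : L, y ∈ Submodule.span K (Set.range (algebraMap F L)))
    (hφ : LinearIndependent K fun i => algebraMap F L (φ i))
    (htr : Transcendental K t) (ht : IsSeparating K t) (hκ : ∀ i, κ i = i) {s Q₁ : ℕ} (hs : s ≠ 0)
    (hdet : frobDet K Q₁ (p ^ s) t (fun i => algebraMap F L (φ i)) κ ≠ 0)
    (hP : P ∈ rationalPoints K L F (p ^ s)) :
    (r : ℤ) ≤ frobDivisor Q₁ (p ^ s) t (fun i => algebraMap F L (φ i)) κ P := by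
  obtain ⟨π, hπ, i₀, x, g, h0, hb, hg, hx⟩ := exists_local_data hK hspan P hφ
  refine le_frobDivisor hπ htr ht Q₁ _ (fun i => algebraMap F L (φ i)) κ hκ hdet i₀ h0 hb g hg ?_
  rw [det_rowMatrix_swap, dvd_neg]
  exact one_row_bound hs hP hπ hφ h0 g hg hx _

/-- The Frobenius rows differ by `f ^ (p ^ (s' + s)) - f ^ (p ^ s) = (f ^ (p ^ s') - f) ^ (p ^ s)`,
and the inner difference vanishes at a point rational over `p ^ s'`. -/
theorem le_frobDivisor_of_rational_quotient
    (hK : ∀ c : K, ∃ s : ℕ, s ≠ 0 ∧ c ^ p ^ s = c)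
    (hspan : ∀ y : L, y ∈ Submodule.span K (Set.range (algebraMap F L)))
    (hφ : LinearIndependent K fun i => algebraMap F L (φ i))
    (htr : Transcendental K t) (ht : IsSeparating K t) (hκ : ∀ i, κ i = i) {s s' : ℕ} (hs' : s' ≠ 0)
    (hdet : frobDet K (p ^ s) (p ^ (s' + s)) t (fun i => algebraMap F L (φ i)) κ ≠ 0)
    (hP : P ∈ rationalPoints K L F (p ^ s')) :
    ((p ^ s : ℕ) : ℤ) ≤ frobDivisor (p ^ s) (p ^ (s' + s)) t (fun i => algebraMap F L (φ i)) κ P := by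
  obtain ⟨π, hπ, i₀, x, g, h0, hb, hg, hx⟩ := exists_local_data hK hspan P hφ
  refine le_frobDivisor hπ htr ht _ _ (fun i => algebraMap F L (φ i)) κ hκ hdet i₀ h0 hb g hg ?_
  refine X_pow_dvd_det_rowMatrix_of_row _ _ _ fun j => ?_
  rw [pow_add, pow_mul, ← sub_pow_of_algebra K p]
  refine pow_dvd_pow_of_dvd ?_ _
  rw [PowerSeries.X_dvd_iff, map_sub, map_pow, sub_eq_zero]
  simpa using expansion_fixed_of_rational hs' hP hπ (hx j) 0

theorem le_frobDivisor_of_rational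
    (hK : ∀ c : K, ∃ s : ℕ, s ≠ 0 ∧ c ^ p ^ s = c)
    (hspan : ∀ y : L, y ∈ Submodule.span K (Set.range (algebraMap F L)))
    (hφ : LinearIndependent K fun i => algebraMap F L (φ i))
    (htr : Transcendental K t) (ht : IsSeparating K t) (hκ : ∀ i, κ i = i) {s u m : ℕ} (hs : s ≠ 0)
    (hum : u ≤ m)
    (hdet : frobDet K ((p ^ s) ^ u) ((p ^ s) ^ m) t (fun i => algebraMap F L (φ i)) κ ≠ 0)
    (hP : P ∈ rationalPoints K L F (p ^ s)) :
    ∑ j ∈ Finset.range (r + 2), (orderAt (fun i => algebraMap F L (φ i)) P j : ℤ) +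
        (((p ^ s) ^ u : ℕ) - 1 : ℤ) * orderAt (fun i => algebraMap F L (φ i)) P 1 -
        ∑ i : Fin r, (i : ℤ) ≤
      frobDivisor ((p ^ s) ^ u) ((p ^ s) ^ m) t (fun i => algebraMap F L (φ i)) κ P := by
  obtain ⟨π, hπ, i₀, x, g, h0, hb, hg, hx⟩ := exists_local_data hK hspan P hφ
  obtain ⟨A, w, hA, hAdet, hw, hadapt⟩ := exists_adapted_of_rational hs hP hπ hφ h0 g hg hx
  have hord : ∀ j : Fin (r + 2), orderAt (fun i => algebraMap F L (φ i)) P j = w j :=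
    fun j => orderAt_eq hπ i₀ h0 hb g hg hAdet hw hadapt j
  -- Entries fixed by the `q`-power map are fixed by its iterates, so both Frobenius rows follow the
  -- change of basis.
  have hApow : ∀ (e : ℕ) i j, A i j ^ p ^ (s * e) = A i j := by
    intro e i j
    induction e with
    | zero => simp
    | succ e ih => rw [Nat.mul_succ, pow_add, pow_mul, ih, hA]
  have hpos : 1 ≤ (p ^ s) ^ u := Nat.one_le_pow _ _ (pow_pos hp.out.pos _)
  have hle : (p ^ s) ^ u ≤ (p ^ s) ^ m := Nat.pow_le_pow_right (pow_pos hp.out.pos _) hum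
  have key := X_pow_dvd_mul_det_of_baseChange hAdet
    (fun j => Place.expansion hπ (g j) ^ (p ^ s) ^ m) (fun j => Place.expansion hπ (g j) ^ (p ^ s) ^ u)
    (fun i j => psHasse (i : ℕ) (Place.expansion hπ (g j)))
    (N := ∑ j, w j + ((p ^ s) ^ u - 1) * w 1) (c := PowerSeries.X ^ (∑ i : Fin r, (i : ℕ))) (by
      simp only [← pow_mul p]
      rw [mulVec_pow (hApow m), mulVec_pow (hApow u)]
      simp only [mulVec_psHasse]
      simp only [pow_mul p]
      exact X_pow_dvd_det_rowMatrix_of_two_rows hpos hle _ w hw.monotone fun j => (hadapt j).1)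
  have hsum : ∑ i : Fin r, (i : ℕ) ≤ ∑ j, w j := by
    rw [Fin.sum_univ_succ, Fin.sum_univ_succ]
    have : ∑ i : Fin r, (i : ℕ) ≤ ∑ i : Fin r, w i.succ.succ := by
      refine Finset.sum_le_sum fun i _ => ?_
      have := val_le_of_strictMono hw i.succ.succ
      simp only [Fin.val_succ] at this
      omega
    omega
  obtain ⟨N, hN⟩ : ∃ N, ∑ j, w j + ((p ^ s) ^ u - 1) * w 1 = ∑ i : Fin r, (i : ℕ) + N :=
    ⟨_, (Nat.add_sub_cancel' (hsum.trans (Nat.le_add_right _ _))).symm⟩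
  rw [hN] at key
  have h := le_frobDivisor hπ htr ht _ _ (fun i => algebraMap F L (φ i)) κ hκ hdet i₀ h0 hb g hg
    (X_pow_dvd_of_dvd_mul key)
  refine le_trans (le_of_eq ?_) h
  have hN' := congrArg (fun n : ℕ => (n : ℤ)) hN
  simp only [Nat.cast_add, Nat.cast_mul, Nat.cast_sub hpos, Nat.cast_sum, Nat.cast_one] at hN'
  have e1 : ∑ j ∈ Finset.range (r + 2), (orderAt (fun i => algebraMap F L (φ i)) P j : ℤ) =
      ∑ j, (w j : ℤ) := by
    rw [← Fin.sum_univ_eq_sum_range fun j => (orderAt (fun i => algebraMap F L (φ i)) P j : ℤ)]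
    exact Finset.sum_congr rfl fun j _ => by rw [hord]
  have e2 : orderAt (fun i => algebraMap F L (φ i)) P 1 = w 1 := hord 1
  rw [e1, e2]
  linarith

end FrobeniusBounds

/-! ### Places over a place of a subfield -/

section LiesOver

theorem Place.v_le_one_of_isIntegral {K L : Type*} [Field K] [Field L] [Algebra K L]
    (P : Place K L) {A : Type*} [CommRing A] [Algebra A L]
    (h : ∀ a : A, P.v (algebraMap A L a) ≤ 1) {y : L} (hy : IsIntegral A y) : P.v y ≤ 1 := by
  obtain ⟨f, hf, hfy⟩ := hy
  let g : A →+* P.v.valuationSubring := (algebraMap A L).codRestrict _ h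
  have : IsIntegral P.v.valuationSubring y := by
    refine ⟨f.map g, hf.map g, ?_⟩
    rw [Polynomial.eval₂_map]
    exact hfy
  obtain ⟨z, rfl⟩ := IsIntegrallyClosed.algebraMap_eq_of_integral this
  exact z.2

variable {K M L : Type*} [Field K] [Field M] [Field L] [Algebra K M] [Algebra K L] [Algebra M L]

instance Place.isDiscreteValuationRing_ring (p : Place K M) : IsDiscreteValuationRing p.ring := by
  have : Nontrivial (MonoidWithZeroHom.ofClass p.v).valueGroup := by
    obtain ⟨π, hπ⟩ := p.exists_uniformizer
    rw [Subgroup.nontrivial_iff_exists_ne_one]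
    have h0 : p.v π ≠ 0 := by rw [hπ]; exact WithZero.exp_ne_zero
    refine ⟨Units.mk0 (p.v π) h0, MonoidWithZeroHom.mem_valueGroup _ ⟨π, rfl⟩, fun h => ?_⟩
    have := congr_arg Units.val h
    rw [Units.val_mk0, hπ, Units.val_one, ← WithZero.exp_zero, WithZero.exp_inj] at this
    omega
  have : IsCyclic (MonoidWithZeroHom.ofClass p.v).valueGroup := inferInstance
  exact Valuation.valuationSubring_isDiscreteValuationRing p.v

/-- `P` lies over `p` if functions regular at `p` are regular at `P`. -/
def Place.LiesOver (P : Place K L) (p : Place K M) : Prop :=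
  ∀ c : M, p.v c ≤ 1 → P.v (algebraMap M L c) ≤ 1

theorem Place.exists_unit_mul_zpow (p : Place K M) {s : M} (hs : p.v s = WithZero.exp (-1)) {c : M}
    (hc : c ≠ 0) : p.v (c * s ^ (-p.ord c)) = 1 := by
  rw [map_mul, map_zpow₀, hs, p.v_eq_exp hc, ← WithZero.exp_zsmul, ← WithZero.exp_add]
  simp

/-- If a function vanishing at `p` became a unit at `P`, its powers would clear the pole at `p` of
any element of `M`. All of `M`, and by integrality all of `L`, would be regular at `P`. -/
theorem Place.LiesOver.v_lt_one [Algebra.IsAlgebraic M L] {P : Place K L} {p : Place K M}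
    (h : P.LiesOver p) {c : M} (hc : p.v c < 1) : P.v (algebraMap M L c) < 1 := by
  by_contra hlt
  have h1 : P.v (algebraMap M L c) = 1 := le_antisymm (h c hc.le) (not_lt.1 hlt)
  have hc0 : c ≠ 0 := by
    rintro rfl
    simp at h1
  have hpos := (p.v_lt_one_iff hc0).1 hc
  have key : ∀ y : M, P.v (algebraMap M L y) ≤ 1 := by
    intro y
    by_cases hy : y = 0
    · simp [hy]
    have := h (y * c ^ (p.ord y).natAbs) (by
      rw [p.v_le_one_iff (mul_ne_zero hy (pow_ne_zero _ hc0)), p.ord_mul hy (pow_ne_zero _ hc0),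
        p.ord_pow]
      have : ((p.ord y).natAbs : ℤ) * 1 ≤ (p.ord y).natAbs * p.ord c :=
        mul_le_mul_of_nonneg_left (by omega) (by omega)
      omega)
    simpa [h1] using this
  obtain ⟨π, hπ⟩ := P.exists_uniformizer
  have := P.v_le_one_of_isIntegral key (Algebra.IsIntegral.isIntegral (R := M) π⁻¹)
  rw [map_inv₀, hπ, ← WithZero.exp_neg, ← WithZero.exp_zero, WithZero.exp_le_exp] at this
  omega

theorem Place.LiesOver.v_eq_one {P : Place K L} {p : Place K M}
    (h : P.LiesOver p) {c : M} (hc : p.v c = 1) : P.v (algebraMap M L c) = 1 := by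
  refine le_antisymm (h c hc.le) ?_
  have := h c⁻¹ (by simp [hc])
  rw [map_inv₀, map_inv₀] at this
  have h0 : P.v (algebraMap M L c) ≠ 0 := by
    rw [Valuation.ne_zero_iff, map_ne_zero]
    rintro rfl
    simp at hc
  exact (inv_le_one₀ (zero_lt_iff.2 h0)).1 this

theorem Place.LiesOver.ord_algebraMap {P : Place K L} {p : Place K M}
    (h : P.LiesOver p) {s : M} (hs : p.v s = WithZero.exp (-1)) (c : M) :
    P.ord (algebraMap M L c) = p.ord c * P.ord (algebraMap M L s) := by
  by_cases hc : c = 0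
  · simp [hc]
  have hs0 : s ≠ 0 := ((p.v_eq_exp_iff 1).1 hs).1
  have hz : s ^ (-p.ord c) ≠ 0 := zpow_ne_zero _ hs0
  have h1 := h.v_eq_one (p.exists_unit_mul_zpow hs hc)
  rw [P.v_eq_one_iff ((map_ne_zero _).2 (mul_ne_zero hc hz)), map_mul,
    P.ord_mul ((map_ne_zero _).2 hc) ((map_ne_zero _).2 hz), map_zpow₀, P.ord_zpow] at h1
  linarith

theorem Place.LiesOver.ord_pos [Algebra.IsAlgebraic M L] {P : Place K L} {p : Place K M}
    (h : P.LiesOver p) {s : M} (hs : p.v s = WithZero.exp (-1)) :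
    0 < P.ord (algebraMap M L s) := by
  have hs0 : s ≠ 0 := ((p.v_eq_exp_iff 1).1 hs).1
  rw [← P.v_lt_one_iff (by simpa)]
  exact h.v_lt_one (by rw [p.v_lt_one_iff_le, hs])

/-- Applied with `M = L`, the orders at `P'` are a fixed multiple of those at `P`; as the order `1`
occurs at `P'`, the multiple is `1`. -/
theorem Place.eq_of_forall_le_one {P P' : Place K L} (h : ∀ y, P.v y ≤ 1 → P'.v y ≤ 1) :
    P = P' := by
  have hl : P'.LiesOver P := h
  obtain ⟨π, hπ⟩ := P.exists_uniformizer
  obtain ⟨π', hπ'⟩ := P'.exists_uniformizer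
  have h1 := hl.ord_algebraMap hπ
  have h2 := hl.ord_pos hπ
  simp only [Algebra.algebraMap_self, RingHom.id_apply] at h1 h2
  have h3 := h1 π'
  rw [((P'.v_eq_exp_iff 1).1 hπ').2] at h3
  have h4 : P'.ord π = 1 := by
    have : P'.ord π ∣ 1 := ⟨P.ord π', by rw [h3, mul_comm]⟩
    exact Int.eq_one_of_dvd_one h2.le this
  ext y : 2
  by_cases hy : y = 0
  · simp [hy]
  rw [P.v_eq_exp hy, P'.v_eq_exp hy, h1 y, h4, mul_one]

theorem Place.LiesOver.v_le_one {P : Place K L} {p : Place K M} (h : P.LiesOver p) {y : L}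
    (hy : IsIntegral p.ring y) : P.v y ≤ 1 :=
  P.v_le_one_of_isIntegral (fun a : p.ring => h a a.2) hy

variable [IsScalarTower K M L] [FiniteDimensional M L] [Algebra.IsSeparable M L] (p : Place K M)

/-- The functions on the larger curve regular at all places over `p`. -/
abbrev Place.ringOver (L : Type*) [Field L] [Algebra M L] : Subalgebra p.ring L :=
  integralClosure p.ring L

instance : IsDedekindDomain (p.ringOver L) := integralClosure.isDedekindDomain p.ring M L

instance : IsFractionRing (p.ringOver L) L :=
  integralClosure.isFractionRing_of_finite_extension M L

instance : Module.Finite p.ring (p.ringOver L) := IsIntegralClosure.finite p.ring M L _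

open IsDedekindDomain in
/-- The place of a maximal ideal of `p.ringOver L`. -/
def Place.ofPrime (w : HeightOneSpectrum (p.ringOver L)) : Place K L where
  v := w.valuation L
  surjective := w.valuation_surjective L
  trivial c hc := by
    have key : ∀ c : K, w.valuation L (algebraMap K L c) ≤ 1 := fun c => by
      have : IsIntegral p.ring (algebraMap K L c) := by
        rw [IsScalarTower.algebraMap_apply K M L]
        exact isIntegral_algebraMap (x := (⟨algebraMap K M c, p.v_algebraMap_le_one c⟩ : p.ring))
      exact w.valuation_le_one (⟨_, this⟩ : p.ringOver L)
    refine le_antisymm (key c) ?_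
    have h0 : w.valuation L (algebraMap K L c) ≠ 0 := by simpa using hc
    have := key c⁻¹
    rw [map_inv₀, map_inv₀] at this
    exact (inv_le_one₀ (zero_lt_iff.2 h0)).1 this

open IsDedekindDomain in
theorem Place.ofPrime_liesOver (w : HeightOneSpectrum (p.ringOver L)) :
    (Place.ofPrime p w).LiesOver p := fun c hc =>
  w.valuation_le_one (algebraMap p.ring (p.ringOver L) ⟨c, hc⟩)

/-- The integral closure is a Dedekind domain, hence the intersection of the valuation rings of its
primes, each of which gives a place over `p`. -/
theorem Place.isIntegral_iff_forall_liesOver {y : L} :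
    IsIntegral p.ring y ↔ ∀ P : Place K L, P.LiesOver p → P.v y ≤ 1 := by
  refine ⟨fun h P hP => hP.v_le_one h, fun h => ?_⟩
  obtain ⟨z, rfl⟩ := IsDedekindDomain.HeightOneSpectrum.mem_integers_of_valuation_le_one
    (R := p.ringOver L) L y fun w => h _ (Place.ofPrime_liesOver p w)
  exact z.2

open IsDedekindDomain in
theorem Place.exists_ofPrime_eq {P : Place K L} (h : P.LiesOver p) :
    ∃ w : HeightOneSpectrum (p.ringOver L), Place.ofPrime p w = P := by
  obtain ⟨s, hs⟩ := p.exists_uniformizer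
  have hle : ∀ y : p.ringOver L, P.v y ≤ 1 := fun y => h.v_le_one y.2
  -- The centre of `P`. It is nonzero because it contains a parameter of `p`.
  let I : Ideal (p.ringOver L) :=
    { carrier := {y | P.v (y : L) < 1}
      add_mem' := fun ha hb => P.v.map_add_lt ha hb
      zero_mem' := by simp
      smul_mem' := fun c x hx => by
        change P.v ((c : L) * x) < 1
        rw [map_mul]
        exact (mul_le_of_le_one_left' (hle c)).trans_lt hx }
  have hI : I.IsPrime := by
    refine ⟨fun h1 => ?_, fun {a b} hab => ?_⟩
    · have : (1 : p.ringOver L) ∈ I := h1 ▸ Submodule.mem_top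
      simp [I] at this
    · change P.v ((a : L) * b) < 1 at hab
      by_contra! hc
      have ha : P.v (a : L) = 1 := le_antisymm (hle a) (not_lt.1 hc.1)
      have hb : P.v (b : L) = 1 := le_antisymm (hle b) (not_lt.1 hc.2)
      simp [ha, hb] at hab
  have hI0 : I ≠ ⊥ := by
    intro h0
    have hs1 : p.v s < 1 := by rw [p.v_lt_one_iff_le, hs]
    have : algebraMap p.ring (p.ringOver L) ⟨s, hs1.le⟩ ∈ I := h.v_lt_one hs1
    rw [h0, Ideal.mem_bot] at this
    have := congr_arg (algebraMap (p.ringOver L) L) this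
    rw [← IsScalarTower.algebraMap_apply, IsScalarTower.algebraMap_apply p.ring M L, map_zero,
      map_eq_zero] at this
    exact ((p.v_eq_exp_iff 1).1 hs).1 this
  refine ⟨⟨I, hI, hI0⟩, Place.eq_of_forall_le_one fun y hy => ?_⟩
  obtain ⟨a, d, hd⟩ := HeightOneSpectrum.exists_primeCompl_mul_eq_of_integer _ y hy
  have hd1 : P.v ((d : p.ringOver L) : L) = 1 := le_antisymm (hle _) (not_lt.1 d.2)
  have := congr_arg P.v hd
  rw [map_mul] at this
  change P.v y * P.v ((d : p.ringOver L) : L) = P.v (a : L) at this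
  rw [hd1, mul_one] at this
  rw [this]
  exact hle a

open IsDedekindDomain in
instance : Finite (HeightOneSpectrum (p.ringOver L)) := by
  obtain ⟨s, hs⟩ := p.exists_uniformizer
  have hs1 : p.v s < 1 := by rw [p.v_lt_one_iff_le, hs]
  have hs0 : algebraMap p.ring (p.ringOver L) ⟨s, hs1.le⟩ ≠ 0 := by
    intro h
    have := congr_arg (algebraMap (p.ringOver L) L) h
    rw [← IsScalarTower.algebraMap_apply, IsScalarTower.algebraMap_apply p.ring M L, map_zero,
      map_eq_zero] at this
    exact ((p.v_eq_exp_iff 1).1 hs).1 this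
  -- Every prime contains the parameter of `p`, and a nonzero ideal has only finitely many prime
  -- divisors.
  have := Ideal.finite_factors (R := p.ringOver L)
    (I := Ideal.span {algebraMap p.ring (p.ringOver L) ⟨s, hs1.le⟩}) 
    (by rwa [Ne, Ideal.zero_eq_bot, Ideal.span_singleton_eq_bot])
  refine Set.finite_univ_iff.1 (this.subset fun w _ => ?_)
  rw [Set.mem_ofPred_eq, Ideal.dvd_span_singleton, ← w.valuation_lt_one_iff_mem (K := L)]
  exact (Place.ofPrime_liesOver p w).v_lt_one hs1

theorem Place.finite_liesOver : {P : Place K L | P.LiesOver p}.Finite :=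
  (Set.finite_range (Place.ofPrime p)).subset fun _ h => Place.exists_ofPrime_eq p h

open IsDedekindDomain in
/-- A function that is a local parameter plus a constant at every place over `p`, with distinct
constants. -/
theorem Place.exists_separating_parameter [Infinite K] :
    ∃ (x : L) (c : Place K L → K), Set.InjOn c {P | P.LiesOver p} ∧
      ∀ P : Place K L, P.LiesOver p → P.v (x - algebraMap K L (c P)) = WithZero.exp (-1) := by
  classical
  have := Fintype.ofFinite (HeightOneSpectrum (p.ringOver L))
  obtain ⟨c⟩ : Nonempty (HeightOneSpectrum (p.ringOver L) ↪ K) :=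
    ⟨(Fintype.equivFin _).toEmbedding.trans (Fin.valEmbedding.trans (Infinite.natEmbedding K))⟩
  choose π hπ using fun w : HeightOneSpectrum (p.ringOver L) => w.intValuation_exists_uniformizer
  let C : K → p.ringOver L := fun a => algebraMap p.ring (p.ringOver L)
    ⟨algebraMap K M a, p.v_algebraMap_le_one a⟩
  have hC : ∀ a, ((C a : p.ringOver L) : L) = algebraMap K L a := fun a =>
    (IsScalarTower.algebraMap_apply K M L a).symm
  -- Chinese remainder theorem: the congruence is imposed modulo the squares of the primes, so that
  -- `x - c` keeps the order one of `π w`.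
  obtain ⟨x, hx⟩ := IsDedekindDomain.exists_forall_sub_mem_ideal (s := Finset.univ)
    (fun w : HeightOneSpectrum (p.ringOver L) => w.asIdeal) (fun _ => 2)
    (fun w _ => w.prime) (fun w _ w' _ h h' => h (HeightOneSpectrum.ext h'))
    (fun w => C (c w) + π w)
  refine ⟨x, fun P => if h : ∃ w, Place.ofPrime p w = P then c h.choose else 0, ?_, ?_⟩
  · intro P hP P' hP' hPP
    have h1 := Place.exists_ofPrime_eq p hP
    have h2 := Place.exists_ofPrime_eq p hP'
    simp only [h1, h2, dif_pos] at hPP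
    rw [← h1.choose_spec, ← h2.choose_spec, c.injective hPP]
  · intro P hP
    have h1 := Place.exists_ofPrime_eq p hP
    simp only [h1, dif_pos]
    have h2 := h1.choose_spec
    set w := h1.choose
    have hm := hx w (Finset.mem_univ _)
    rw [← w.intValuation_le_pow_iff_mem] at hm
    have hv : ∀ y : p.ringOver L, P.v (y : L) = w.intValuation y := fun y => by
      rw [← h2]
      exact w.valuation_of_algebraMap y
    have e : ((x : L) - algebraMap K L (c w)) = ((x - (C (c w) + π w) + π w : p.ringOver L) : L) := by
      rw [← hC]
      push_cast
      ring
    rw [e, hv, Valuation.map_add_eq_of_lt_right, hπ]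
    rw [hπ]
    refine lt_of_le_of_lt hm ?_
    rw [WithZero.exp_lt_exp]
    norm_num

end LiesOver

/-! ### Monogenicity over a place -/

section Monogenic

variable {K M L : Type*} [Field K] [Field M] [Field L] [Algebra K M] [Algebra K L] [Algebra M L]

/-- `x` is a local parameter plus a constant at every place over `p`, with distinct constants. -/
structure Place.IsGenerator (p : Place K M) (x : L) (c : Place K L → K) : Prop where
  injOn : Set.InjOn c {P | P.LiesOver p}
  v_sub : ∀ P : Place K L, P.LiesOver p → P.v (x - algebraMap K L (c P)) = WithZero.exp (-1)

/-- The constants among the functions regular at `p`. -/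
def Place.constHom (p : Place K M) : K →+* p.ring :=
  (algebraMap K M).codRestrict p.ring fun c => p.v_algebraMap_le_one c

theorem Place.value_constHom [HasValues K M] (p : Place K M) (c : K) :
    p.value (p.constHom c) = c :=
  p.value_eq_of_lt (by
    change p.v (algebraMap K M c - algebraMap K M c) < 1
    simp)

theorem Place.v_aeval_sub_eval_le {p : Place K M} {P : Place K L} (h : P.LiesOver p) {x y : L}
    (hx : P.v x ≤ 1) (hy : P.v y ≤ 1) (g : Polynomial p.ring) :
    P.v (Polynomial.aeval x g - Polynomial.aeval y g) ≤ P.v (x - y) := by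
  induction g using Polynomial.induction_on' with
  | add a b ha hb =>
    rw [map_add, map_add, add_sub_add_comm]
    exact P.v.map_add_le ha hb
  | monomial n a =>
    obtain ⟨z, hz⟩ : ∃ z, P.v z ≤ 1 ∧ x ^ n - y ^ n = z * (x - y) := by
      refine ⟨∑ i ∈ Finset.range n, x ^ i * y ^ (n - 1 - i), P.v.map_sum_le fun i _ => ?_,
        (geom_sum₂_mul x y n).symm⟩
      rw [map_mul, map_pow, map_pow]
      exact mul_le_one' (pow_le_one' hx _) (pow_le_one' hy _)
    rw [Polynomial.aeval_monomial, Polynomial.aeval_monomial, ← mul_sub, hz.2, ← mul_assoc, map_mul,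
      map_mul]
    exact mul_le_of_le_one_left' (mul_le_one' (h a a.2) hz.1)

/-- As `x - c` is a parameter, the order of `g(x)` is the multiplicity of `c` as a root of `g`. -/
theorem Place.X_sub_C_pow_dvd (P : Place K L) {x : L} {c : K}
    (hx : P.v (x - algebraMap K L c) = WithZero.exp (-1)) {e : ℕ} {g : Polynomial K}
    (hg : P.v (Polynomial.aeval x g) ≤ WithZero.exp (-(e : ℤ))) :
    (Polynomial.X - Polynomial.C c) ^ e ∣ g := by
  by_cases h0 : g = 0
  · simp [h0]
  obtain ⟨q, hq, hdvd⟩ := Polynomial.exists_eq_pow_rootMultiplicity_mul_and_not_dvd g h0 c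
  have hx1 : P.v x ≤ 1 := by
    rw [← sub_add_cancel x (algebraMap K L c)]
    refine P.v.map_add_le ?_ (P.v_algebraMap_le_one c)
    rw [hx, ← WithZero.exp_zero, WithZero.exp_le_exp]
    omega
  have hq1 : P.v (Polynomial.aeval x q) = 1 := by
    obtain ⟨r, hr⟩ := Polynomial.X_sub_C_dvd_sub_C_eval (a := c) (p := q)
    have hc : q.eval c ≠ 0 := fun h => hdvd (Polynomial.dvd_iff_isRoot.2 h)
    have e1 : Polynomial.aeval x q =
        (x - algebraMap K L c) * Polynomial.aeval x r + algebraMap K L (q.eval c) := by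
      have := congr_arg (Polynomial.aeval x) hr
      simp only [map_sub, map_mul, Polynomial.aeval_X, Polynomial.aeval_C] at this
      rw [← this]
      ring
    rw [e1, Valuation.map_add_eq_of_lt_right, P.trivial _ hc]
    rw [P.trivial _ hc, P.v_lt_one_iff_le, map_mul, hx]
    exact mul_le_of_le_one_right' (P.v_aeval_le_one hx1 r)
  rw [hq, map_mul, map_mul, hq1, mul_one, map_pow, map_pow, map_sub, Polynomial.aeval_X,
    Polynomial.aeval_C, hx, ← WithZero.exp_nsmul, WithZero.exp_le_exp] at hg
  rw [hq]
  refine Dvd.dvd.mul_right (pow_dvd_pow _ ?_) _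
  simp at hg
  exact hg

variable {p : Place K M} {x : L} {c : Place K L → K}

theorem Place.IsGenerator.v_sub_of_ne (hx : p.IsGenerator x c) {P P' : Place K L}
    (h : P.LiesOver p) (h' : P'.LiesOver p) (hne : P ≠ P') :
    P'.v (x - algebraMap K L (c P)) = 1 := by
  have h1 := hx.v_sub P' h'
  have hc : c P' - c P ≠ 0 := fun h0 => hne (hx.injOn h h' (sub_eq_zero.1 h0).symm)
  have : x - algebraMap K L (c P) = (x - algebraMap K L (c P')) + algebraMap K L (c P' - c P) := by
    rw [map_sub]; ring
  rw [this, Valuation.map_add_eq_of_lt_right, P'.trivial _ hc]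
  rw [P'.trivial _ hc, P'.v_lt_one_iff_le, h1]

theorem Place.IsGenerator.sub_ne_zero (hx : p.IsGenerator x c) {P : Place K L}
    (h : P.LiesOver p) : x - algebraMap K L (c P) ≠ 0 :=
  ((P.v_eq_exp_iff 1).1 (hx.v_sub P h)).1

theorem Place.IsGenerator.ord_sub [DecidableEq (Place K L)] (hx : p.IsGenerator x c)
    {P P' : Place K L} (h : P.LiesOver p) (h' : P'.LiesOver p) :
    P'.ord (x - algebraMap K L (c P)) = if P = P' then 1 else 0 := by
  split_ifs with e
  · subst e
    exact ((P.v_eq_exp_iff 1).1 (hx.v_sub P h)).2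
  · exact (P'.v_eq_one_iff (hx.sub_ne_zero h)).1 (hx.v_sub_of_ne h h' e)

variable [IsScalarTower K M L]

theorem Place.aeval_map_constHom (p : Place K M) (x : L) (a : Polynomial K) :
    Polynomial.aeval x (a.map p.constHom) = Polynomial.aeval x a := by
  rw [Polynomial.aeval_def, Polynomial.aeval_def, Polynomial.eval₂_map]
  congr 1
  ext b
  exact (IsScalarTower.algebraMap_apply K M L b).symm

theorem Place.isIntegral_algebraMap (p : Place K M) (a : K) :
    IsIntegral p.ring (algebraMap K L a) := by
  rw [IsScalarTower.algebraMap_apply K M L]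
  exact _root_.isIntegral_algebraMap (x := p.constHom a)

variable [FiniteDimensional M L] [Algebra.IsSeparable M L]

theorem Place.IsGenerator.isIntegral_sub (hx : p.IsGenerator x c) {P : Place K L}
    (h : P.LiesOver p) : IsIntegral p.ring (x - algebraMap K L (c P)) := by
  classical
  refine p.isIntegral_iff_forall_liesOver.2 fun P' h' => ?_
  rw [P'.v_le_one_iff (hx.sub_ne_zero h), hx.ord_sub h h']
  split_ifs <;> simp

variable (L) in
/-- The places over `p`, as a finite set. -/
def Place.placesOver (p : Place K M) : Finset (Place K L) := (p.finite_liesOver (L := L)).toFinset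

theorem Place.mem_placesOver {P : Place K L} : P ∈ p.placesOver L ↔ P.LiesOver p := by
  simp [Place.placesOver]

theorem Place.placesOver_nonempty (p : Place K M) : (p.placesOver L).Nonempty := by
  by_contra! h
  obtain ⟨s, hs⟩ := p.exists_uniformizer
  have : IsIntegral p.ring (algebraMap M L s⁻¹) :=
    p.isIntegral_iff_forall_liesOver.2 fun P hP => by
      rw [← mem_placesOver, h] at hP
      simp at hP
  rw [isIntegral_algebraMap_iff (FaithfulSMul.algebraMap_injective M L)] at this
  obtain ⟨z, hz⟩ := IsIntegrallyClosed.algebraMap_eq_of_integral this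
  have h1 : p.v s⁻¹ ≤ 1 := hz ▸ z.2
  rw [map_inv₀, hs, ← WithZero.exp_neg, ← WithZero.exp_zero, WithZero.exp_le_exp] at h1
  omega

theorem Place.IsGenerator.isIntegral (hx : p.IsGenerator x c) : IsIntegral p.ring x := by
  obtain ⟨P, hP⟩ := p.placesOver_nonempty (L := L)
  have := (hx.isIntegral_sub (mem_placesOver.1 hP)).add (p.isIntegral_algebraMap (c P))
  rwa [sub_add_cancel] at this

/-- The polynomial `∏ (X - c_P) ^ e_P` over the places over `p`. -/
def Place.fiberPoly (p : Place K M) (s : M) (c : Place K L → K) : Polynomial K :=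
  ∏ P ∈ p.placesOver L, (Polynomial.X - Polynomial.C (c P)) ^ (P.ord (algebraMap M L s)).toNat

theorem Place.fiberPoly_monic (s : M) : (p.fiberPoly s c).Monic :=
  Polynomial.monic_prod_of_monic _ _ fun _ _ => (Polynomial.monic_X_sub_C _).pow _

variable {s : M}

/-- Only the factor belonging to `P` vanishes at `P`, with multiplicity the ramification index.
Hence the fibre polynomial in `x` and `s` differ by a unit over `p`. -/
theorem Place.IsGenerator.v_aeval_fiberPoly (hx : p.IsGenerator x c)
    (hs : p.v s = WithZero.exp (-1)) {P : Place K L} (h : P.LiesOver p) :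
    P.v (Polynomial.aeval x (p.fiberPoly s c)) = P.v (algebraMap M L s) := by
  classical
  have hs0 : algebraMap M L s ≠ 0 := (map_ne_zero _).2 ((p.v_eq_exp_iff 1).1 hs).1
  rw [fiberPoly, map_prod, P.v_eq_exp hs0, P.v_eq_exp_iff]
  have h0 : ∀ P' ∈ p.placesOver L, Polynomial.aeval x ((Polynomial.X - Polynomial.C (c P')) ^
      (P'.ord (algebraMap M L s)).toNat) ≠ 0 := fun P' hP' => by
    simpa using fun h => absurd h (hx.sub_ne_zero (mem_placesOver.1 hP'))
  refine ⟨Finset.prod_ne_zero_iff.2 h0, ?_⟩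
  rw [P.ord_prod _ _ h0, Finset.sum_eq_single P]
  · rw [map_pow, P.ord_pow]
    simp only [map_sub, Polynomial.aeval_X, Polynomial.aeval_C]
    rw [hx.ord_sub h h, if_pos rfl, mul_one, Int.toNat_of_nonneg (h.ord_pos hs).le]
  · intro P' hP' hne
    rw [map_pow, P.ord_pow]
    simp only [map_sub, Polynomial.aeval_X, Polynomial.aeval_C]
    rw [hx.ord_sub (mem_placesOver.1 hP') h, if_neg hne, mul_zero]
  · intro hP
    exact absurd (mem_placesOver.2 h) hP

variable [HasValues K L]

/-- The polynomials by which one can divide with remainder a polynomial in `x`. -/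
def Place.IsGenerator.divisors (p : Place K M) (x : L) : Submonoid (Polynomial K) where
  carrier := {b | ∀ y : L, IsIntegral p.ring y → ∃ (a : Polynomial K) (y' : L),
    IsIntegral p.ring y' ∧ y = Polynomial.aeval x a + y' * Polynomial.aeval x b}
  one_mem' := fun y hy => ⟨0, y, hy, by simp⟩
  mul_mem' := by
    intro b₁ b₂ h₁ h₂ y hy
    obtain ⟨a₁, y₁, hy₁, e₁⟩ := h₁ y hy
    obtain ⟨a₂, y₂, hy₂, e₂⟩ := h₂ y₁ hy₁
    refine ⟨a₁ + a₂ * b₁, y₂, hy₂, ?_⟩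
    rw [e₁, e₂]
    simp only [map_add, map_mul]
    ring

/-- The remainder is the value of `y` at `P`. The quotient stays regular since `x - c_P` has a
simple zero at `P` and is a unit at the other places over `p`. -/
theorem Place.IsGenerator.X_sub_C_mem_divisors (hx : p.IsGenerator x c) {P : Place K L}
    (h : P.LiesOver p) : Polynomial.X - Polynomial.C (c P) ∈ divisors p x := by
  classical
  intro y hy
  obtain ⟨a, ha⟩ := HasValues.exists_value P y (h.v_le_one hy)
  have h0 := hx.sub_ne_zero h
  refine ⟨Polynomial.C a, (y - algebraMap K L a) / (x - algebraMap K L (c P)), ?_, ?_⟩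
  · refine p.isIntegral_iff_forall_liesOver.2 fun P' h' => ?_
    by_cases hya : y - algebraMap K L a = 0
    · simp [hya]
    have h1 := h'.v_le_one (hy.sub (p.isIntegral_algebraMap a))
    rw [P'.v_le_one_iff (div_ne_zero hya h0), P'.ord_div hya h0, hx.ord_sub h h']
    rw [P'.v_le_one_iff hya] at h1
    split_ifs with e
    · subst e
      rw [P.v_lt_one_iff hya] at ha
      omega
    · omega
  · simp only [Polynomial.aeval_C, map_sub, Polynomial.aeval_X, div_mul_cancel₀ _ h0]
    ring

theorem Place.IsGenerator.exists_aeval_eq (hx : p.IsGenerator x c) {y : L}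
    (hy : IsIntegral p.ring y) : ∃ g : Polynomial p.ring, y = Polynomial.aeval x g := by
  obtain ⟨s, hs⟩ := p.exists_uniformizer
  have hs0 : algebraMap M L s ≠ 0 := (map_ne_zero _).2 ((p.v_eq_exp_iff 1).1 hs).1
  have hs1 : p.v s < 1 := by rw [p.v_lt_one_iff_le, hs]
  -- Nakayama: dividing by the fibre polynomial, which is `s` times a unit, writes every integral
  -- element as a polynomial in `x` plus a multiple of `s`.
  have key : Subalgebra.toSubmodule (p.ringOver L) ≤
      Subalgebra.toSubmodule (Algebra.adjoin p.ring {x}) := by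
    refine Submodule.le_of_le_smul_of_le_jacobson_bot (I := IsLocalRing.maximalIdeal p.ring)
      (Module.Finite.iff_fg.1 (inferInstanceAs (Module.Finite p.ring (p.ringOver L))))
      (IsLocalRing.maximalIdeal_le_jacobson _) fun z hz => ?_
    have hmem : p.fiberPoly s c ∈ divisors p x :=
      Submonoid.prod_mem _ fun P hP => Submonoid.pow_mem _ (hx.X_sub_C_mem_divisors (mem_placesOver.1 hP)) _
    obtain ⟨a, z', hz', e⟩ := hmem z hz
    rw [e]
    refine Submodule.add_mem_sup ?_ ?_
    · rw [← p.aeval_map_constHom, Subalgebra.mem_toSubmodule]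
      exact Polynomial.aeval_mem_adjoin_singleton _ _
    · have : z' * Polynomial.aeval x (p.fiberPoly s c) = (⟨s, hs1.le⟩ : p.ring) •
          (z' * (Polynomial.aeval x (p.fiberPoly s c) / algebraMap M L s)) := by
        rw [Algebra.smul_def]
        change _ = algebraMap M L s * _
        field_simp
      rw [this]
      refine Submodule.smul_mem_smul ?_ ?_
      · rw [IsLocalRing.mem_maximalIdeal, mem_nonunits_iff]
        intro hu
        obtain ⟨w, hw⟩ := hu.exists_right_inv
        have h1 : p.v (s * (w : M)) = 1 := by
          have : s * (w : M) = 1 := congr_arg Subtype.val hw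
          rw [this, map_one]
        rw [map_mul] at h1
        exact (((mul_le_of_le_one_right' w.2).trans_lt hs1).ne h1)
      · refine IsIntegral.mul hz' (p.isIntegral_iff_forall_liesOver.2 fun P hP => ?_)
        rw [map_div₀, hx.v_aeval_fiberPoly hs hP, div_self]
        exact P.v.ne_zero_iff.2 hs0
  have := key (show y ∈ Subalgebra.toSubmodule (p.ringOver L) from hy)
  rw [Subalgebra.mem_toSubmodule, Algebra.adjoin_singleton_eq_range_aeval] at this
  obtain ⟨g, hg⟩ := this
  exact ⟨g, hg.symm⟩

theorem Place.IsGenerator.adjoin_eq_top (hx : p.IsGenerator x c) :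
    Algebra.adjoin M {x} = ⊤ := by
  refine eq_top_iff.2 fun y _ => ?_
  have : Algebra.IsAlgebraic p.ring L := (IsFractionRing.comap_isAlgebraic_iff (K := M)).2
    inferInstance
  obtain ⟨a, ha, hay⟩ := (Algebra.IsAlgebraic.isAlgebraic (R := p.ring) y).exists_integral_multiple
  obtain ⟨g, hg⟩ := hx.exists_aeval_eq hay
  have ha0 : (a : M) ≠ 0 := fun h => ha (Subtype.ext h)
  have : y = (a : M)⁻¹ • Polynomial.aeval x (g.map (algebraMap p.ring M)) := by
    rw [Polynomial.aeval_map_algebraMap, ← hg, eq_inv_smul_iff₀ ha0]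
    rfl
  rw [this]
  exact Subalgebra.smul_mem _ (Polynomial.aeval_mem_adjoin_singleton _ _) _

end Monogenic

/-! ### Norms, traces and discriminants over a place -/

section Different

variable {K M L : Type*} [Field K] [Field M] [Field L] [Algebra K M] [Algebra K L] [Algebra M L]
  [IsScalarTower K M L] [FiniteDimensional M L] [Algebra.IsSeparable M L] {p : Place K M} {x : L} {c : Place K L → K} {s : M}

/-- In `0 = fiberPoly(x) + s g(x)` the first term has the same order as `s`, so `g(x)` is a unit at
`P`. -/
theorem Place.IsGenerator.v_aeval_cofactor (hx : p.IsGenerator x c)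
    (hs : p.v s = WithZero.exp (-1)) (hs1 : p.v s ≤ 1) {g : Polynomial p.ring}
    (hg : minpoly p.ring x =
      (p.fiberPoly s c).map p.constHom + Polynomial.C (⟨s, hs1⟩ : p.ring) * g)
    {P : Place K L} (h : P.LiesOver p) : P.v (Polynomial.aeval x g) = 1 := by
  have hs0 : algebraMap M L s ≠ 0 := (map_ne_zero _).2 ((p.v_eq_exp_iff 1).1 hs).1
  have h1 := minpoly.aeval p.ring x
  rw [hg, map_add, p.aeval_map_constHom, map_mul, Polynomial.aeval_C] at h1
  change _ + algebraMap M L s * _ = 0 at h1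
  have h2 := congr_arg P.v (eq_neg_of_add_eq_zero_left h1)
  rw [hx.v_aeval_fiberPoly hs h, Valuation.map_neg, map_mul] at h2
  exact (mul_eq_left₀ (P.v.ne_zero_iff.2 hs0)).1 h2.symm

theorem Place.IsGenerator.v_eval_cofactor (hx : p.IsGenerator x c)
    (hs : p.v s = WithZero.exp (-1)) (hs1 : p.v s ≤ 1) {g : Polynomial p.ring}
    (hg : minpoly p.ring x =
      (p.fiberPoly s c).map p.constHom + Polynomial.C (⟨s, hs1⟩ : p.ring) * g)
    {P : Place K L} (h : P.LiesOver p) :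
    p.v ((g.eval (p.constHom (c P)) : p.ring) : M) = 1 := by
  have h1 := hx.v_aeval_cofactor hs hs1 hg h
  have h2 := Place.v_aeval_sub_eval_le h (h.v_le_one hx.isIntegral) (P.v_algebraMap_le_one (c P)) g
  have h3 : Polynomial.aeval (algebraMap K L (c P)) g =
      algebraMap M L ((g.eval (p.constHom (c P)) : p.ring) : M) := by
    have : algebraMap K L (c P) = algebraMap p.ring L (p.constHom (c P)) :=
      IsScalarTower.algebraMap_apply K M L _
    rw [this, Polynomial.aeval_algebraMap_apply, Polynomial.coe_aeval_eq_eval]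
    rfl
  refine le_antisymm (g.eval (p.constHom (c P))).2 (not_lt.1 fun hlt => ?_)
  have h4 := h.v_lt_one hlt
  rw [← h3] at h4
  have h5 : P.v (Polynomial.aeval x g) < 1 := by
    rw [← sub_add_cancel (Polynomial.aeval x g) (Polynomial.aeval (algebraMap K L (c P)) g)]
    refine P.v.map_add_lt (h2.trans_lt ?_) h4
    rw [hx.v_sub P h, ← WithZero.exp_zero, WithZero.exp_lt_exp]
    omega
  exact h5.ne h1

theorem norm_zpow_of_field {M L : Type*} [Field M] [Field L] [Algebra M L] [FiniteDimensional M L]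
    (y : L) (n : ℤ) : Algebra.norm M (y ^ n) = Algebra.norm M y ^ n :=
  map_zpow₀ ({ Algebra.norm M with map_zero' := Algebra.norm_zero } : L →*₀ M) y n

theorem norm_div_of_field {M L : Type*} [Field M] [Field L] [Algebra M L] [FiniteDimensional M L]
    (y z : L) : Algebra.norm M (y / z) = Algebra.norm M y / Algebra.norm M z :=
  map_div₀ ({ Algebra.norm M with map_zero' := Algebra.norm_zero } : L →*₀ M) y z

/-- Both `y` and `y⁻¹` are integral over `p`, hence so are their norms. -/
theorem Place.ord_norm_eq_zero {y : L} (hy : y ≠ 0) (h : ∀ P : Place K L, P.LiesOver p → P.ord y = 0) :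
    p.ord (Algebra.norm M y) = 0 := by
  have key : ∀ y : L, y ≠ 0 → (∀ P : Place K L, P.LiesOver p → P.ord y = 0) →
      0 ≤ p.ord (Algebra.norm M y) := by
    intro y hy h
    have h1 : IsIntegral p.ring y := p.isIntegral_iff_forall_liesOver.2 fun P hP => by
      rw [P.v_le_one_iff hy, h P hP]
    obtain ⟨z, hz⟩ := IsIntegrallyClosed.algebraMap_eq_of_integral (Algebra.isIntegral_norm M h1)
    rw [← p.v_le_one_iff (Algebra.norm_ne_zero_iff.2 hy), ← hz]
    exact z.2
  have h1 := key y hy h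
  have h2 := key y⁻¹ (inv_ne_zero hy) fun P hP => by rw [P.ord_inv, h P hP, neg_zero]
  rw [← one_div, norm_div_of_field, map_one, one_div, p.ord_inv] at h2
  omega

variable [HasValues K M]

/-- The reduced minimal polynomial differs from the minimal polynomial by coefficients divisible by
`s`, so at `x` it vanishes at each `P` to order at least the ramification index. -/
theorem Place.IsGenerator.fiberPoly_dvd (hx : p.IsGenerator x c)
    (hs : p.v s = WithZero.exp (-1)) :
    p.fiberPoly s c ∣ (minpoly p.ring x).map p.value := by
  refine Finset.prod_dvd_of_coprime ?_ ?_
  · intro P hP P' hP' hne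
    refine IsCoprime.pow (Polynomial.isCoprime_X_sub_C_of_isUnit_sub (IsUnit.mk0 _ ?_))
    exact fun h0 => hne (hx.injOn (mem_placesOver.1 hP) (mem_placesOver.1 hP') (sub_eq_zero.1 h0))
  · intro P hP
    have h := mem_placesOver.1 hP
    refine P.X_sub_C_pow_dvd (hx.v_sub P h) ?_
    have hs0 : algebraMap M L s ≠ 0 := (map_ne_zero _).2 ((p.v_eq_exp_iff 1).1 hs).1
    rw [Int.toNat_of_nonneg (h.ord_pos hs).le, ← P.v_eq_exp hs0]
    have e : Polynomial.aeval x ((minpoly p.ring x).map p.value) =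
        Polynomial.aeval x (((minpoly p.ring x).map p.value).map p.constHom - minpoly p.ring x) := by
      rw [map_sub, minpoly.aeval, sub_zero, p.aeval_map_constHom]
    rw [e, Polynomial.aeval_eq_sum_range]
    refine P.v.map_sum_le fun i _ => ?_
    rw [Algebra.smul_def, map_mul, map_pow]
    refine (mul_le_of_le_one_right' (pow_le_one' (h.v_le_one hx.isIntegral) _)).trans ?_
    set a := (minpoly p.ring x).coeff i
    have ha : (((minpoly p.ring x).map p.value).map p.constHom - minpoly p.ring x).coeff i =
        p.constHom (p.value a) - a := by simp [a]
    rw [ha]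
    have hlt : p.v ((p.constHom (p.value a) - a : p.ring) : M) ≤ WithZero.exp (-1) := by
      rw [← p.v_lt_one_iff_le]
      change p.v (algebraMap K M (p.value a) - (a : M)) < 1
      rw [Valuation.map_sub_swap]
      exact p.v_sub_value a
    have h2 := h (((p.constHom (p.value a) - a : p.ring) : M) / s) (by
      rw [map_div₀, hs]
      exact div_le_one_of_le₀ hlt zero_le)
    rw [map_div₀, map_div₀, div_le_one₀ (zero_lt_iff.2 (P.v.ne_zero_iff.2 hs0))] at h2
    exact h2

variable [HasValues K L]

/-- This contains the identity between the degree and the sum of the ramification indices. Were the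
fibre polynomial of smaller degree, `fiberPoly(x) / s` would be integral and so equal to `g'(x)`
with `deg g' < deg minpoly`. Then `fiberPoly - s g'` would kill `x` and hence be zero, although its
reduction is monic. -/
theorem Place.IsGenerator.map_value_minpoly (hx : p.IsGenerator x c)
    (hs : p.v s = WithZero.exp (-1)) :
    (minpoly p.ring x).map p.value = p.fiberPoly s c := by
  have hm := minpoly.monic hx.isIntegral
  have hs1 : p.v s ≤ 1 := (p.v_lt_one_iff_le.2 hs.le).le
  have hs0 : algebraMap M L s ≠ 0 := (map_ne_zero _).2 ((p.v_eq_exp_iff 1).1 hs).1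
  refine Polynomial.eq_of_monic_of_dvd_of_natDegree_le (p.fiberPoly_monic s) (hm.map _)
    (hx.fiberPoly_dvd hs) ?_
  rw [hm.natDegree_map]
  by_contra! hlt
  obtain ⟨g, hg⟩ := hx.exists_aeval_eq (y := Polynomial.aeval x (p.fiberPoly s c) / algebraMap M L s)
    (p.isIntegral_iff_forall_liesOver.2 fun P hP => by
      rw [map_div₀, hx.v_aeval_fiberPoly hs hP, div_self]
      exact P.v.ne_zero_iff.2 hs0)
  let g' := g %ₘ minpoly p.ring x
  have hg' : Polynomial.aeval x (p.fiberPoly s c) / algebraMap M L s = Polynomial.aeval x g' := by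
    rw [hg]
    exact (Polynomial.aeval_modByMonic_eq_self_of_root (minpoly.aeval _ _)).symm
  let G := (p.fiberPoly s c).map p.constHom - Polynomial.C (⟨s, hs1⟩ : p.ring) * g'
  have hG : Polynomial.aeval x G = 0 := by
    have : algebraMap p.ring L ⟨s, hs1⟩ = algebraMap M L s := rfl
    rw [map_sub, p.aeval_map_constHom, map_mul, ← hg', Polynomial.aeval_C, this,
      mul_div_cancel₀ _ hs0, sub_self]
  have hdeg : G.degree < (minpoly p.ring x).degree := by
    refine (Polynomial.degree_sub_le _ _).trans_lt (max_lt ?_ ?_)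
    · refine Polynomial.degree_map_le.trans_lt ?_
      rw [Polynomial.degree_eq_natDegree (p.fiberPoly_monic s).ne_zero,
        Polynomial.degree_eq_natDegree hm.ne_zero]
      exact_mod_cast hlt
    · rw [← Polynomial.smul_eq_C_mul]
      exact (Polynomial.degree_smul_le _ _).trans_lt (Polynomial.degree_modByMonic_lt _ hm)
  have hG0 : G = 0 := by
    by_contra h0
    exact absurd (minpoly.IsIntegrallyClosed.degree_le_of_ne_zero h0 hG) (not_le.2 hdeg)
  have h1 : (G.map p.value) = p.fiberPoly s c := by
    have hv : p.value ⟨s, hs1⟩ = 0 := (p.value_eq_zero_iff _).2 (p.v_lt_one_iff_le.2 hs.le)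
    have hcomp : p.value.comp p.constHom = RingHom.id K := by
      ext a
      exact p.value_constHom a
    simp only [G, Polynomial.map_sub, Polynomial.map_mul, Polynomial.map_C, hv, map_zero, zero_mul,
      sub_zero, Polynomial.map_map, hcomp, Polynomial.map_id]
  rw [hG0, Polynomial.map_zero] at h1
  exact (p.fiberPoly_monic (L := L) s).ne_zero h1.symm

theorem Place.IsGenerator.exists_minpoly_eq (hx : p.IsGenerator x c)
    (hs : p.v s = WithZero.exp (-1)) (hs1 : p.v s ≤ 1) : ∃ g : Polynomial p.ring,
      minpoly p.ring x = (p.fiberPoly s c).map p.constHom + Polynomial.C (⟨s, hs1⟩ : p.ring) * g := by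
  have hs0 : s ≠ 0 := ((p.v_eq_exp_iff 1).1 hs).1
  have : Polynomial.C (⟨s, hs1⟩ : p.ring) ∣
      minpoly p.ring x - (p.fiberPoly s c).map p.constHom := by
    rw [Polynomial.C_dvd_iff_dvd_coeff]
    intro i
    rw [← hx.map_value_minpoly hs, Polynomial.coeff_sub, Polynomial.coeff_map, Polynomial.coeff_map]
    set a := (minpoly p.ring x).coeff i
    have hlt : p.v ((a : M) - algebraMap K M (p.value a)) ≤ WithZero.exp (-1) :=
      p.v_lt_one_iff_le.1 (p.v_sub_value a)
    refine ⟨⟨((a : M) - algebraMap K M (p.value a)) / s, ?_⟩, Subtype.ext ?_⟩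
    · change p.v _ ≤ 1
      rw [map_div₀, hs]
      exact div_le_one_of_le₀ hlt zero_le
    · change (a : M) - algebraMap K M (p.value a) =
        s * (((a : M) - algebraMap K M (p.value a)) / s)
      field_simp
  obtain ⟨g, hg⟩ := this
  exact ⟨g, by rw [← hg]; ring⟩

theorem norm_algebraMap_sub {M L : Type*} [Field M] [Field L] [Algebra M L] [FiniteDimensional M L]
    {x : L} (hx : Algebra.adjoin M {x} = ⊤) (a : M) :
    Algebra.norm M (algebraMap M L a - x) = (minpoly M x).eval a := by
  let pb := PowerBasis.ofAdjoinEqTop (Algebra.IsIntegral.isIntegral (R := M) x) hx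
  have hgen : pb.gen = x := PowerBasis.ofAdjoinEqTop_gen _ _
  rw [Algebra.norm_eq_matrix_det pb.basis, map_sub, ← hgen, ← charpoly_leftMulMatrix,
    Matrix.eval_charpoly]
  congr 2
  rw [AlgHom.commutes]
  rfl

/-- The norm of `c_P - x` is the minimal polynomial evaluated at `c_P`, where the fibre polynomial
vanishes; what is left is `s` times a unit. -/
theorem Place.IsGenerator.ord_norm_sub (hx : p.IsGenerator x c) {P : Place K L}
    (h : P.LiesOver p) : p.ord (Algebra.norm M (x - algebraMap K L (c P))) = 1 := by
  obtain ⟨s, hs⟩ := p.exists_uniformizer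
  have hs1 : p.v s ≤ 1 := (p.v_lt_one_iff_le.2 hs.le).le
  obtain ⟨g, hg⟩ := hx.exists_minpoly_eq hs hs1
  have h1 : Algebra.norm M (algebraMap K L (c P) - x) =
      s * ((g.eval (p.constHom (c P)) : p.ring) : M) := by
    rw [IsScalarTower.algebraMap_apply K M L, norm_algebraMap_sub hx.adjoin_eq_top,
      minpoly.isIntegrallyClosed_eq_field_fractions' M hx.isIntegral]
    have : algebraMap K M (c P) = algebraMap p.ring M (p.constHom (c P)) := rfl
    rw [this, Polynomial.eval_map_algebraMap, Polynomial.aeval_algebraMap_apply,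
      Polynomial.coe_aeval_eq_eval, hg, Polynomial.eval_add, Polynomial.eval_map,
      Polynomial.eval₂_hom]
    have h0 : (p.fiberPoly s c).eval (c P) = 0 := by
      rw [Place.fiberPoly, Polynomial.eval_prod]
      refine Finset.prod_eq_zero (mem_placesOver.2 h) ?_
      have := h.ord_pos hs
      simp
      omega
    rw [h0, map_zero, zero_add, Polynomial.eval_mul, Polynomial.eval_C]
    rfl
  have h2 := congr_arg p.v h1
  rw [map_mul, hx.v_eval_cofactor hs hs1 hg h, mul_one, hs] at h2
  have h3 : p.v (Algebra.norm M (x - algebraMap K L (c P))) = WithZero.exp (-1) := by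
    rw [← neg_sub, ← neg_one_mul, map_mul, ← map_one (algebraMap M L), ← map_neg,
      Algebra.norm_algebraMap, map_mul, h2]
    simp
  exact ((p.v_eq_exp_iff 1).1 h3).2

/-- The order of a norm at `p` is the sum of the orders over `p`. -/
theorem Place.ord_norm [Infinite K] (p : Place K M) {y : L} (hy : y ≠ 0) :
    p.ord (Algebra.norm M y) = ∑ P ∈ p.placesOver L, P.ord y := by
  classical
  obtain ⟨x, c, h1, h2⟩ := p.exists_separating_parameter (L := L)
  have hx : p.IsGenerator x c := ⟨h1, h2⟩
  -- `z` has the orders of `y` at all places over `p`, so the norm of `y / z` is a unit and it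
  -- suffices to know the norms of the `x - c_P`.
  set z := ∏ P ∈ p.placesOver L, (x - algebraMap K L (c P)) ^ P.ord y with hz
  have hne : ∀ P ∈ p.placesOver L, (x - algebraMap K L (c P)) ^ P.ord y ≠ 0 := fun P hP =>
    zpow_ne_zero _ (hx.sub_ne_zero (mem_placesOver.1 hP))
  have hz0 : z ≠ 0 := Finset.prod_ne_zero_iff.2 hne
  have hord : ∀ P : Place K L, P.LiesOver p → P.ord (y / z) = 0 := by
    intro P hP
    rw [P.ord_div hy hz0, hz, P.ord_prod _ _ hne, Finset.sum_eq_single P]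
    · rw [P.ord_zpow, hx.ord_sub hP hP, if_pos rfl, mul_one, sub_self]
    · intro P' hP' hne'
      rw [P.ord_zpow, hx.ord_sub (mem_placesOver.1 hP') hP, if_neg hne', mul_zero]
    · intro h
      exact absurd (mem_placesOver.2 hP) h
  have h3 := Place.ord_norm_eq_zero (div_ne_zero hy hz0) hord
  rw [norm_div_of_field, p.ord_div (Algebra.norm_ne_zero_iff.2 hy) (Algebra.norm_ne_zero_iff.2 hz0),
    sub_eq_zero] at h3
  rw [h3, hz, map_prod, p.ord_prod _ _ fun P hP => Algebra.norm_ne_zero_iff.2 (hne P hP)]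
  refine Finset.sum_congr rfl fun P hP => ?_
  rw [norm_zpow_of_field, p.ord_zpow, hx.ord_norm_sub (mem_placesOver.1 hP), mul_one]

end Different

/-! ### Integral bases, discriminants and the trace dual -/

section Discriminant

variable {K M L : Type*} [Field K] [Field M] [Field L] [Algebra K M] [Algebra M L]
  {p : Place K M}

/-- A basis of `L` over `M` is integral at `p` if it generates the functions regular over `p`. -/
def Place.IsIntegralBasis {ι : Type*} (p : Place K M) (b : Module.Basis ι M L) : Prop :=
  ∀ y : L, IsIntegral p.ring y ↔ ∀ i, p.v (b.repr y i) ≤ 1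

theorem Place.v_det_le_one {ι : Type*} [Fintype ι] [DecidableEq ι] (p : Place K M)
    {A : Matrix ι ι M} (h : ∀ i j, p.v (A i j) ≤ 1) : p.v A.det ≤ 1 := by
  rw [Matrix.det_apply]
  refine p.v.map_sum_le fun σ _ => ?_
  have h1 : p.v (∏ i, A (σ i) i) ≤ 1 := by
    rw [map_prod]
    exact Finset.prod_le_one' fun i _ => h _ _
  rcases Int.units_eq_one_or (Equiv.Perm.sign σ) with e | e <;> simpa [e, Units.smul_def] using h1

theorem Place.IsIntegralBasis.isIntegral {ι : Type*} {b : Module.Basis ι M L}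
    (hb : p.IsIntegralBasis b) (i : ι) : IsIntegral p.ring (b i) := by
  classical
  refine (hb _).2 fun j => ?_
  rw [b.repr_self, Finsupp.single_apply]
  split_ifs <;> simp

variable [FiniteDimensional M L] [Algebra.IsSeparable M L]

/-- The transition matrices in both directions are regular at `p` and mutually inverse, so their
determinants are units there. -/
theorem Place.IsIntegralBasis.ord_discr_eq {ι : Type*} [Fintype ι] [DecidableEq ι]
    {b b' : Module.Basis ι M L} (hb : p.IsIntegralBasis b) (hb' : p.IsIntegralBasis b') :
    p.ord (Algebra.discr M b) = p.ord (Algebra.discr M b') := by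
  have h1 : p.v (b.toMatrix b').det ≤ 1 := p.v_det_le_one fun i j => by
    rw [Module.Basis.toMatrix_apply]
    exact (hb _).1 (hb'.isIntegral j) i
  have h2 : p.v (b'.toMatrix b).det ≤ 1 := p.v_det_le_one fun i j => by
    rw [Module.Basis.toMatrix_apply]
    exact (hb' _).1 (hb.isIntegral j) i
  have h3 : (b.toMatrix b').det * (b'.toMatrix b).det = 1 := by
    rw [← Matrix.det_mul, Module.Basis.toMatrix_mul_toMatrix_flip, Matrix.det_one]
  have h4 : (b.toMatrix b').det ≠ 0 := left_ne_zero_of_mul_eq_one h3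
  have h5 : (b'.toMatrix b).det ≠ 0 := right_ne_zero_of_mul_eq_one h3
  rw [p.v_le_one_iff h4] at h1
  rw [p.v_le_one_iff h5] at h2
  have h6 := congr_arg p.ord h3
  rw [p.ord_mul h4 h5, p.ord_one] at h6
  have h7 : Algebra.discr M b' = (b.toMatrix b').det ^ 2 * Algebra.discr M b := by
    rw [← Algebra.discr_of_matrix_vecMul, b.toMatrix_map_vecMul]
  rw [h7, p.ord_mul (pow_ne_zero _ h4) (Algebra.discr_not_zero_of_basis M b), p.ord_pow]
  push_cast
  omega

variable [Algebra K L] [IsScalarTower K M L] [HasValues K L] {x : L} {c : Place K L → K}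

theorem Place.IsGenerator.isIntegralBasis_powerBasis (hx : p.IsGenerator x c)
    {pb : PowerBasis M L} (hgen : pb.gen = x) : p.IsIntegralBasis pb.basis := by
  intro y
  constructor
  · intro hy
    obtain ⟨g, hg⟩ := hx.exists_aeval_eq hy
    have hm := minpoly.monic hx.isIntegral
    let g' := g %ₘ minpoly p.ring x
    have hg' : y = Polynomial.aeval x g' := by
      rw [hg]
      exact (Polynomial.aeval_modByMonic_eq_self_of_root (minpoly.aeval _ _)).symm
    have hdim : pb.dim = (minpoly p.ring x).natDegree := by
      rw [← pb.natDegree_minpoly, hgen,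
        minpoly.isIntegrallyClosed_eq_field_fractions' M hx.isIntegral, hm.natDegree_map]
    have hdeg : g'.natDegree < pb.dim := by
      rw [hdim]
      exact Polynomial.natDegree_modByMonic_lt _ hm (minpoly.ne_one p.ring x)
    have : y = ∑ i : Fin pb.dim, ((g'.coeff i : p.ring) : M) • pb.basis i := by
      rw [hg', Polynomial.aeval_eq_sum_range' hdeg, ← Fin.sum_univ_eq_sum_range
        (fun i => g'.coeff i • x ^ i)]
      refine Finset.sum_congr rfl fun i _ => ?_
      rw [pb.coe_basis, hgen]
      rfl
    intro i
    rw [this, pb.basis.repr_sum_self]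
    exact (g'.coeff i).2
  · intro h
    rw [← pb.basis.sum_repr y]
    refine IsIntegral.sum _ fun i _ => ?_
    rw [Algebra.smul_def]
    refine IsIntegral.mul (_root_.isIntegral_algebraMap (x := (⟨_, h i⟩ : p.ring))) ?_
    rw [pb.coe_basis, hgen]
    exact hx.isIntegral.pow _

-- Euler's formula: the trace dual of the ring generated by `x` is that ring divided by the
-- derivative of the minimal polynomial at `x`.
open scoped Pointwise in
theorem Place.IsGenerator.forall_trace_le_iff (hx : p.IsGenerator x c) (h : L) :
    (∀ y : L, IsIntegral p.ring y → p.v (Algebra.trace M L (h * y)) ≤ 1) ↔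
      IsIntegral p.ring (Polynomial.aeval x (minpoly p.ring x).derivative * h) := by
  have hmin := minpoly.isIntegrallyClosed_eq_field_fractions' M hx.isIntegral
  have e : Polynomial.aeval x (minpoly p.ring x).derivative =
      Polynomial.aeval x (minpoly M x).derivative := by
    rw [hmin, Polynomial.derivative_map, Polynomial.aeval_map_algebraMap]
  have hmem : ∀ y : L, y ∈ Subalgebra.toSubmodule (Algebra.adjoin p.ring {x}) ↔
      IsIntegral p.ring y := by
    intro y
    rw [Subalgebra.mem_toSubmodule]
    constructor
    · exact fun hy => (Algebra.adjoin_le (S := p.ringOver L)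
        (Set.singleton_subset_iff.2 hx.isIntegral)) hy
    · intro hy
      obtain ⟨g, rfl⟩ := hx.exists_aeval_eq hy
      exact Polynomial.aeval_mem_adjoin_singleton _ _
  have hne : Polynomial.aeval x (minpoly M x).derivative ≠ 0 :=
    (Algebra.IsSeparable.isSeparable M x).aeval_derivative_ne_zero (minpoly.aeval M x)
  have key := traceForm_dualSubmodule_adjoin p.ring M hx.adjoin_eq_top hx.isIntegral
  have k2 := SetLike.ext_iff.1 key h
  rw [LinearMap.BilinForm.mem_dualSubmodule] at k2
  have k3 : h ∈ (Polynomial.aeval x (minpoly M x).derivative)⁻¹ •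
      Subalgebra.toSubmodule (Algebra.adjoin p.ring {x}) ↔
      IsIntegral p.ring (Polynomial.aeval x (minpoly p.ring x).derivative * h) := by
    rw [← hmem, e]
    constructor
    · rintro ⟨y, hy, rfl⟩
      change _ * (_⁻¹ * y) ∈ _
      rwa [mul_inv_cancel_left₀ hne]
    · intro hy
      refine ⟨_, hy, ?_⟩
      change _⁻¹ * (_ * h) = h
      rw [inv_mul_cancel_left₀ hne]
  rw [← k3, ← k2]
  refine forall_congr' fun y => ?_
  rw [hmem]
  refine imp_congr_right fun _ => ?_
  rw [Algebra.traceForm_apply, Submodule.mem_one]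
  exact ⟨fun h1 => ⟨⟨_, h1⟩, rfl⟩, fun ⟨z, hz⟩ => hz ▸ z.2⟩

end Discriminant

/-! ### The different as the divisor of the differential of a parameter -/

section DiscriminantOrder

variable {K M L : Type*} [Field K] [Field M] [Field L] [Algebra K M] [Algebra K L] [Algebra M L]
  [HasValues K M] [HasValues K L]
  {p : Place K M} {x : L} {c : Place K L → K} {s : M} {τ : L →ₐ[K] L⟦X⟧}

/-- Writing `a = d + s b` with `d` constant, and iterating, gives `δ a = z + s ^ k δ b` with `z`
regular. The pole of `δ b` at `P` is at most that of `δ π`, and is cancelled by `s ^ k` for `k`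
large. -/
theorem Place.v_taylorDerivation_algebraMap_le [Algebra.IsAlgebraic M L]
    (hs : p.v s = WithZero.exp (-1))
    (ht : IsSeparating K (algebraMap M L s)) (hτ : IsTaylor (algebraMap M L s) τ)
    [IsScalarTower K M L] {P : Place K L}
    (h : P.LiesOver p) {a : M} (ha : p.v a ≤ 1) :
    P.v (taylorDerivation hτ (algebraMap M L a)) ≤ 1 := by
  have hs0 : s ≠ 0 := ((p.v_eq_exp_iff 1).1 hs).1
  set δ := taylorDerivation hτ
  have hδs : δ (algebraMap M L s) = 1 := taylorDerivation_self hτ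
  have step : ∀ k : ℕ, ∃ (z : L) (b : M), P.v z ≤ 1 ∧ p.v b ≤ 1 ∧
      δ (algebraMap M L a) = z + algebraMap M L s ^ k * δ (algebraMap M L b) := by
    intro k
    induction k with
    | zero => exact ⟨0, a, by simp, ha, by simp⟩
    | succ k ih =>
      obtain ⟨z, b, hz, hb, e⟩ := ih
      obtain ⟨d, hd⟩ := HasValues.exists_value p b hb
      have hb' : p.v ((b - algebraMap K M d) / s) ≤ 1 := by
        rw [map_div₀, hs]
        exact div_le_one_of_le₀ (p.v_lt_one_iff_le.1 hd) zero_le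
      set b' := (b - algebraMap K M d) / s with hb'def
      have hbb : b = algebraMap K M d + s * b' := by
        rw [hb'def]
        field_simp
        ring
      have e2 : δ (algebraMap M L b) =
          algebraMap M L b' + algebraMap M L s * δ (algebraMap M L b') := by
        rw [hbb, map_add, map_add, map_mul, Derivation.leibniz, hδs,
          ← IsScalarTower.algebraMap_apply, Derivation.map_algebraMap]
        simp only [smul_eq_mul, mul_one, zero_add]
        ring
      refine ⟨z + algebraMap M L s ^ k * algebraMap M L b', b', ?_, hb', ?_⟩
      · refine P.v.map_add_le hz ?_
        rw [map_mul, map_pow]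
        exact mul_le_one' (pow_le_one' (h s (p.v_lt_one_iff_le.2 hs.le).le) _) (h _ hb')
      · rw [e, e2]
        ring
  obtain ⟨π, hπ⟩ := P.exists_uniformizer
  have hδπ : δ π ≠ 0 := Place.taylorDerivation_uniformizer_ne_zero hπ ht hτ
  obtain ⟨z, b, hz, hb, e⟩ := step (P.ord (δ π)).natAbs
  rw [e]
  refine P.v.map_add_le hz ?_
  have h1 := Place.v_taylorDerivation_div_le hπ ht hτ (h b hb)
  have h2 : P.v (algebraMap M L s ^ (P.ord (δ π)).natAbs * δ π) ≤ 1 := by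
    have hsL : algebraMap M L s ≠ 0 := (map_ne_zero _).2 hs0
    rw [P.v_le_one_iff (mul_ne_zero (pow_ne_zero _ hsL) hδπ), P.ord_mul (pow_ne_zero _ hsL) hδπ,
      P.ord_pow]
    have : ((P.ord (δ π)).natAbs : ℤ) * 1 ≤ (P.ord (δ π)).natAbs * P.ord (algebraMap M L s) :=
      mul_le_mul_of_nonneg_left (h.ord_pos hs) (by omega)
    omega
  have e3 : algebraMap M L s ^ (P.ord (δ π)).natAbs * δ (algebraMap M L b) =
      (algebraMap M L s ^ (P.ord (δ π)).natAbs * δ π) * (δ (algebraMap M L b) / δ π) := by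
    field_simp
  rw [e3, map_mul]
  exact mul_le_one' h2 h1

theorem Place.exists_taylorDerivation_aeval [Algebra.IsAlgebraic M L] [IsScalarTower K M L]
    (hs : p.v s = WithZero.exp (-1))
    (ht : IsSeparating K (algebraMap M L s)) (hτ : IsTaylor (algebraMap M L s) τ) {P : Place K L}
    (h : P.LiesOver p) (hx : P.v x ≤ 1) (g : Polynomial p.ring) : ∃ z : L, P.v z ≤ 1 ∧
      taylorDerivation hτ (Polynomial.aeval x g) =
        Polynomial.aeval x g.derivative * taylorDerivation hτ x + z := by
  induction g using Polynomial.induction_on' with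
  | add a b ha hb =>
    obtain ⟨z, hz, e⟩ := ha
    obtain ⟨z', hz', e'⟩ := hb
    refine ⟨z + z', P.v.map_add_le hz hz', ?_⟩
    simp only [map_add, e, e']
    ring
  | monomial n a =>
    refine ⟨x ^ n * taylorDerivation hτ (algebraMap M L a), ?_, ?_⟩
    · rw [map_mul, map_pow]
      exact mul_le_one' (pow_le_one' hx _) (v_taylorDerivation_algebraMap_le hs ht hτ h a.2)
    · have : algebraMap p.ring L a = algebraMap M L a := rfl
      rw [Polynomial.aeval_monomial, Polynomial.derivative_monomial, Polynomial.aeval_monomial,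
        Derivation.leibniz, Derivation.leibniz_pow, map_mul, map_natCast, this]
      simp only [smul_eq_mul, nsmul_eq_mul]
      ring

variable [IsScalarTower K M L] [FiniteDimensional M L] [Algebra.IsSeparable M L]

/-- Differentiating `fiberPoly(x) + s g(x) = 0` with respect to `s` shows that `minpoly'(x) · dx/ds`
is `-g(x)` plus a multiple of `s`, hence a unit at `P`. As `x - c_P` is a parameter, `dx/ds` has
order `-ordDiff (ds)`. No tameness of the ramification is required. -/
theorem Place.IsGenerator.ord_derivative_minpoly (hx : p.IsGenerator x c)
    (hs : p.v s = WithZero.exp (-1))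
    (ht : IsSeparating K (algebraMap M L s)) (hτ : IsTaylor (algebraMap M L s) τ) {P : Place K L}
    (h : P.LiesOver p) :
    P.ord (Polynomial.aeval x (minpoly p.ring x).derivative) =
      P.ordDiff (KaehlerDifferential.D K L (algebraMap M L s)) := by
  have hs1 : p.v s ≤ 1 := (p.v_lt_one_iff_le.2 hs.le).le
  have hπ := hx.v_sub P h
  obtain ⟨g, hg⟩ := hx.exists_minpoly_eq hs hs1
  obtain ⟨z, hz, e⟩ := exists_taylorDerivation_aeval hs ht hτ h (h.v_le_one hx.isIntegral) g
  set δ := taylorDerivation hτ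
  have hδs : δ (algebraMap M L s) = 1 := taylorDerivation_self hτ
  have hsp : algebraMap p.ring L ⟨s, hs1⟩ = algebraMap M L s := rfl
  have hδx : δ (x - algebraMap K L (c P)) = δ x := by simp
  have h1 : Polynomial.aeval x (minpoly p.ring x).derivative * δ x =
      -(Polynomial.aeval x g + algebraMap M L s * z) := by
    have h0 : δ (Polynomial.aeval x (minpoly p.ring x)) = 0 := by rw [minpoly.aeval, map_zero]
    rw [hg, map_add, p.aeval_map_constHom, map_add, Derivation.map_aeval, map_mul,
      Polynomial.aeval_C, hsp, Derivation.leibniz, hδs, e] at h0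
    rw [hg]
    simp only [Polynomial.derivative_map, map_add,
      p.aeval_map_constHom, Polynomial.derivative_C_mul, map_mul, Polynomial.aeval_C, hsp,
      smul_eq_mul, mul_one] at h0 ⊢
    linear_combination h0
  have h2 : P.v (Polynomial.aeval x (minpoly p.ring x).derivative * δ x) = 1 := by
    have hg1 := hx.v_aeval_cofactor hs hs1 hg h
    rw [h1, Valuation.map_neg, Valuation.map_add_eq_of_lt_left, hg1]
    rw [hg1, map_mul]
    exact (mul_le_of_le_one_right' hz).trans_lt (h.v_lt_one (p.v_lt_one_iff_le.2 hs.le))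
  have hne : Polynomial.aeval x (minpoly p.ring x).derivative * δ x ≠ 0 := by
    intro h0
    rw [h0, map_zero] at h2
    exact zero_ne_one h2
  rw [P.v_eq_one_iff hne, P.ord_mul (left_ne_zero_of_mul hne) (right_ne_zero_of_mul hne)] at h2
  rw [Place.ordDiff_D hπ ht hτ]
  change _ = -P.ord (δ (x - algebraMap K L (c P)))
  rw [hδx]
  omega

/-- The trace dual of the functions regular over `p` consists of the `h` with `h ds` regular over
`p`. -/
theorem Place.forall_trace_le_iff [Infinite K] (hs : p.v s = WithZero.exp (-1))
    (ht : IsSeparating K (algebraMap M L s)) (hτ : IsTaylor (algebraMap M L s) τ) {h : L}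
    (hh : h ≠ 0) :
    (∀ y : L, IsIntegral p.ring y → p.v (Algebra.trace M L (h * y)) ≤ 1) ↔
      ∀ P : Place K L, P.LiesOver p →
        0 ≤ P.ord h + P.ordDiff (KaehlerDifferential.D K L (algebraMap M L s)) := by
  obtain ⟨x, c, h1, h2⟩ := p.exists_separating_parameter (L := L)
  have hx : p.IsGenerator x c := ⟨h1, h2⟩
  have hne : Polynomial.aeval x (minpoly p.ring x).derivative ≠ 0 := by
    have := (Algebra.IsSeparable.isSeparable M x).aeval_derivative_ne_zero (minpoly.aeval M x)
    rwa [minpoly.isIntegrallyClosed_eq_field_fractions' M hx.isIntegral, Polynomial.derivative_map,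
      Polynomial.aeval_map_algebraMap] at this
  rw [hx.forall_trace_le_iff, p.isIntegral_iff_forall_liesOver]
  refine forall_congr' fun P => imp_congr_right fun hP => ?_
  rw [P.v_le_one_iff (mul_ne_zero hne hh), P.ord_mul hne hh,
    hx.ord_derivative_minpoly hs ht hτ hP, add_comm]

theorem Place.IsIntegralBasis.ord_discr [Infinite K] {ι : Type*} [Fintype ι] [DecidableEq ι]
    {b : Module.Basis ι M L} (hb : p.IsIntegralBasis b) (hs : p.v s = WithZero.exp (-1))
    (ht : IsSeparating K (algebraMap M L s)) (hτ : IsTaylor (algebraMap M L s) τ) :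
    p.ord (Algebra.discr M b) =
      ∑ P ∈ p.placesOver L, P.ordDiff (KaehlerDifferential.D K L (algebraMap M L s)) := by
  obtain ⟨x, c, h1, h2⟩ := p.exists_separating_parameter (L := L)
  have hx : p.IsGenerator x c := ⟨h1, h2⟩
  let pb := PowerBasis.ofAdjoinEqTop (Algebra.IsIntegral.isIntegral (R := M) x) hx.adjoin_eq_top
  have hgen : pb.gen = x := PowerBasis.ofAdjoinEqTop_gen _ _
  have hpb := hx.isIntegralBasis_powerBasis hgen
  let e : Fin pb.dim ≃ ι := pb.basis.indexEquiv b
  have hpb' : p.IsIntegralBasis (pb.basis.reindex e) := fun y => by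
    rw [hpb y]
    constructor
    · intro h i
      simpa using h (e.symm i)
    · intro h i
      simpa using h (e i)
  have hmin := minpoly.isIntegrallyClosed_eq_field_fractions' M hx.isIntegral
  have e1 : Polynomial.aeval x (minpoly p.ring x).derivative =
      Polynomial.aeval x (minpoly M x).derivative := by
    rw [hmin, Polynomial.derivative_map, Polynomial.aeval_map_algebraMap]
  have hne : Polynomial.aeval x (minpoly M x).derivative ≠ 0 :=
    (Algebra.IsSeparable.isSeparable M x).aeval_derivative_ne_zero (minpoly.aeval M x)
  rw [hb.ord_discr_eq hpb', Module.Basis.coe_reindex, Algebra.discr_reindex,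
    Algebra.discr_powerBasis_eq_norm, hgen, p.ord_mul (by simp) (Algebra.norm_ne_zero_iff.2 hne),
    p.ord_norm hne, ← e1]
  have h3 : p.ord ((-1 : M) ^ (Module.finrank M L * (Module.finrank M L - 1) / 2)) = 0 := by
    rw [p.ord_pow, p.ord_neg, p.ord_one, mul_zero]
  rw [h3, zero_add]
  exact Finset.sum_congr rfl fun P hP =>
    hx.ord_derivative_minpoly hs ht hτ (mem_placesOver.1 hP)

end DiscriminantOrder

/-! ### The places of the rational function field -/

section RationalPlaces

variable {K : Type*} [Field K]

/-- The ideal of polynomials vanishing at `a`. -/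
def vanishingIdeal (a : K) : IsDedekindDomain.HeightOneSpectrum (Polynomial K) where
  asIdeal := Ideal.span {Polynomial.X - Polynomial.C a}
  isPrime := (Ideal.span_singleton_prime (Polynomial.X_sub_C_ne_zero a)).2 (Polynomial.prime_X_sub_C a)
  ne_bot := by simpa using Polynomial.X_sub_C_ne_zero a

theorem mem_vanishingIdeal (a : K) (f : Polynomial K) :
    f ∈ (vanishingIdeal a).asIdeal ↔ f.eval a = 0 := by
  rw [vanishingIdeal, Ideal.mem_span_singleton, Polynomial.dvd_iff_isRoot, Polynomial.IsRoot.def]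

open Classical in
/-- The places of `K(X)`: those of the points `a` of the affine line, and the one at infinity. -/
def ratPlace : Option K → Place K (RatFunc K)
  | some a =>
    { v := (vanishingIdeal a).valuation (RatFunc K)
      surjective := (vanishingIdeal a).valuation_surjective (RatFunc K)
      trivial := fun c hc => by
        rw [RatFunc.algebraMap_eq_C, ← RatFunc.algebraMap_C,
          IsDedekindDomain.HeightOneSpectrum.valuation_of_algebraMap,
          IsDedekindDomain.HeightOneSpectrum.intValuation_eq_one_iff, mem_vanishingIdeal]
        simpa using hc }
  | none =>
    { v := RatFunc.inftyValuation K
      surjective := fun x => by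
        by_cases hx : x = 0
        · exact ⟨0, by simp [hx]⟩
        · exact ⟨RatFunc.X ^ (WithZero.log x), by
            rw [RatFunc.inftyValuation.X_zpow, WithZero.exp_log hx]⟩
      trivial := fun c hc => by
        rw [RatFunc.algebraMap_eq_C, RatFunc.inftyValuation.C _ hc] }

theorem ratPlace_some_v_le_one (a : K) (f : Polynomial K) :
    (ratPlace (some a)).v (algebraMap (Polynomial K) (RatFunc K) f) ≤ 1 :=
  (vanishingIdeal a).valuation_le_one f

theorem ratPlace_some_v_eq_one_iff (a : K) (f : Polynomial K) :
    (ratPlace (some a)).v (algebraMap (Polynomial K) (RatFunc K) f) = 1 ↔ f.eval a ≠ 0 := by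
  rw [Ne, ← mem_vanishingIdeal]
  exact (vanishingIdeal a).valuation_eq_one_iff_notMem

theorem ratPlace_some_v_X_sub_C (a : K) : (ratPlace (some a)).v
    (algebraMap (Polynomial K) (RatFunc K) (Polynomial.X - Polynomial.C a)) = WithZero.exp (-1) := by
  change (vanishingIdeal a).valuation (RatFunc K) _ = _
  rw [IsDedekindDomain.HeightOneSpectrum.valuation_of_algebraMap]
  exact (vanishingIdeal a).intValuation_singleton (Polynomial.X_sub_C_ne_zero a) rfl

theorem ratPlace_none_ord {f : RatFunc K} (hf : f ≠ 0) : (ratPlace none).ord f = -f.intDegree := by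
  classical
  have : (ratPlace (K := K) none).v f = WithZero.exp (-(-f.intDegree)) := by
    rw [neg_neg]
    exact RatFunc.inftyValuation_of_nonzero (F := K) hf
  exact (((ratPlace none).v_eq_exp_iff _).1 this).2

theorem ratPlace_none_v_inv_X : (ratPlace (K := K) none).v RatFunc.X⁻¹ = WithZero.exp (-1) := by
  rw [(ratPlace none).v_eq_exp_iff]
  refine ⟨inv_ne_zero RatFunc.X_ne_zero, ?_⟩
  rw [Place.ord_inv, ratPlace_none_ord RatFunc.X_ne_zero, RatFunc.intDegree_X, neg_neg]

theorem exists_algebraMap_eq_of_forall_le_one [IsAlgClosed K] {f : RatFunc K}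
    (h : ∀ a : K, (ratPlace (some a)).v f ≤ 1) :
    ∃ g : Polynomial K, algebraMap (Polynomial K) (RatFunc K) g = f := by
  by_cases hd : f.denom.degree = 0
  · have h1 : f.denom = 1 := Polynomial.eq_one_of_monic_natDegree_zero (RatFunc.monic_denom f)
      (Polynomial.natDegree_eq_of_degree_eq_some hd)
    refine ⟨f.num, ?_⟩
    conv_rhs => rw [← RatFunc.num_div_denom f, h1, map_one, div_one]
  · exfalso
    obtain ⟨a, ha⟩ := IsAlgClosed.exists_root _ hd
    have hn : f.num.eval a ≠ 0 := fun h0 => by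
      obtain ⟨u, w, e⟩ := RatFunc.isCoprime_num_denom f
      have := congr_arg (Polynomial.eval a) e
      simp [h0, ha.eq_zero] at this
    have h1 := (ratPlace_some_v_eq_one_iff a f.num).2 hn
    have h2 : (ratPlace (some a)).v (algebraMap (Polynomial K) (RatFunc K) f.denom) < 1 :=
      lt_of_le_of_ne (ratPlace_some_v_le_one a _)
        (fun h => (ratPlace_some_v_eq_one_iff a _).1 h ha)
    have h3 : f * algebraMap (Polynomial K) (RatFunc K) f.denom =
        algebraMap (Polynomial K) (RatFunc K) f.num := by
      have hd0 : algebraMap (Polynomial K) (RatFunc K) f.denom ≠ 0 := by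
        simpa using RatFunc.denom_ne_zero f
      rw [← eq_div_iff hd0, RatFunc.num_div_denom]
    have h4 := congr_arg (ratPlace (some a)).v h3
    rw [map_mul, h1] at h4
    exact ((mul_le_of_le_one_left' (h a)).trans_lt h2).ne h4

/-- Divisors of degree zero. -/
def IsDegreeZero {α : Type*} (D : α → ℤ) : Prop := D.support.Finite ∧ ∑ᶠ P, D P = 0

theorem IsDegreeZero.add {α : Type*} {D D' : α → ℤ} (h : IsDegreeZero D) (h' : IsDegreeZero D') :
    IsDegreeZero (fun P => D P + D' P) :=
  ⟨(h.1.union h'.1).subset (Function.support_add D D'), by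
    rw [finsum_add_distrib h.1 h'.1, h.2, h'.2, add_zero]⟩

theorem IsDegreeZero.neg {α : Type*} {D : α → ℤ} (h : IsDegreeZero D) :
    IsDegreeZero (fun P => -D P) :=
  ⟨by simpa [Function.support_fun_neg] using h.1, by rw [finsum_neg_distrib, h.2, neg_zero]⟩

theorem isDegreeZero_zero {α : Type*} : IsDegreeZero (fun _ : α => 0) := ⟨by simp, by simp⟩

theorem isDegreeZero_X_sub_C (b : K) : IsDegreeZero fun o => (ratPlace o).ord
    (algebraMap (Polynomial K) (RatFunc K) (Polynomial.X - Polynomial.C b)) := by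
  classical
  have h0 : algebraMap (Polynomial K) (RatFunc K) (Polynomial.X - Polynomial.C b) ≠ 0 := 
    RatFunc.algebraMap_ne_zero (Polynomial.X_sub_C_ne_zero b)
  have h1 : ∀ a, (ratPlace (some a)).ord (algebraMap (Polynomial K) (RatFunc K)
      (Polynomial.X - Polynomial.C b)) = if a = b then 1 else 0 := by
    intro a
    split_ifs with e
    · subst e
      exact (((ratPlace (some a)).v_eq_exp_iff 1).1 (ratPlace_some_v_X_sub_C a)).2
    · rw [← (ratPlace (some a)).v_eq_one_iff h0, ratPlace_some_v_eq_one_iff]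
      simpa [sub_eq_zero] using e
  have h2 : (ratPlace none).ord (algebraMap (Polynomial K) (RatFunc K)
      (Polynomial.X - Polynomial.C b)) = -1 := by
    rw [ratPlace_none_ord h0, RatFunc.intDegree_polynomial, Polynomial.natDegree_X_sub_C]
    rfl
  have hsub : (Function.support fun o => (ratPlace o).ord (algebraMap (Polynomial K) (RatFunc K)
      (Polynomial.X - Polynomial.C b))) ⊆ (({some b, none} : Finset (Option K)) : Set (Option K)) := by
    intro o ho
    rcases o with _ | a
    · simp
    · rw [Function.mem_support, h1] at ho
      have : a = b := by
        by_contra hne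
        simp [hne] at ho
      simp [this]
  refine ⟨(Finset.finite_toSet _).subset hsub, ?_⟩
  rw [finsum_eq_sum_of_support_subset _ hsub, Finset.sum_pair (by simp), h1, h2]
  simp

/-- A rational function has as many zeros as poles. -/
theorem isDegreeZero_ratPlace [IsAlgClosed K] {f : RatFunc K} (hf : f ≠ 0) :
    IsDegreeZero fun o => (ratPlace o).ord f := by
  have key : ∀ g : Polynomial K, g ≠ 0 → IsDegreeZero fun o => (ratPlace o).ord
      (algebraMap (Polynomial K) (RatFunc K) g) := by
    intro g hg
    have e := (IsAlgClosed.splits g).eq_prod_roots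
    have hlc := Polynomial.leadingCoeff_ne_zero.2 hg
    have h1 : ∀ m : Multiset K, (algebraMap (Polynomial K) (RatFunc K)
        (m.map fun a => Polynomial.X - Polynomial.C a).prod) ≠ 0 ∧
        IsDegreeZero fun o => (ratPlace o).ord (algebraMap (Polynomial K) (RatFunc K)
        (m.map fun a => Polynomial.X - Polynomial.C a).prod) := by
      intro m
      induction m using Multiset.induction_on with
      | empty => simpa using isDegreeZero_zero
      | cons a m ih =>
        have h0 : algebraMap (Polynomial K) (RatFunc K) (Polynomial.X - Polynomial.C a) ≠ 0 := 
          RatFunc.algebraMap_ne_zero (Polynomial.X_sub_C_ne_zero a)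
        rw [Multiset.map_cons, Multiset.prod_cons, map_mul]
        refine ⟨mul_ne_zero h0 ih.1, ?_⟩
        simp only [Place.ord_mul _ h0 ih.1]
        exact (isDegreeZero_X_sub_C a).add ih.2
    have h2 : ∀ o, (ratPlace o).ord (algebraMap (Polynomial K) (RatFunc K) g) =
        (ratPlace o).ord (algebraMap (Polynomial K) (RatFunc K)
          (g.roots.map fun a => Polynomial.X - Polynomial.C a).prod) := by
      intro o
      have hc : algebraMap (Polynomial K) (RatFunc K) (Polynomial.C g.leadingCoeff) =
          algebraMap K (RatFunc K) g.leadingCoeff := by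
        rw [RatFunc.algebraMap_C, RatFunc.algebraMap_eq_C]
      have hc0 : algebraMap K (RatFunc K) g.leadingCoeff ≠ 0 := by simpa using hg
      conv_lhs => rw [e]
      rw [map_mul, hc, Place.ord_mul _ hc0 (h1 _).1,
        ((ratPlace o).v_eq_one_iff hc0).1 ((ratPlace o).trivial _ hlc), zero_add]
    simp only [h2]
    exact (h1 _).2
  have hn : algebraMap (Polynomial K) (RatFunc K) f.num ≠ 0 := by simpa using hf
  have hd : algebraMap (Polynomial K) (RatFunc K) f.denom ≠ 0 := by simpa using RatFunc.denom_ne_zero f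
  have h3 : ∀ o, (ratPlace o).ord f = (ratPlace o).ord (algebraMap (Polynomial K) (RatFunc K) f.num) +
      -(ratPlace o).ord (algebraMap (Polynomial K) (RatFunc K) f.denom) := by
    -- Numerator and denominator are treated separately; each is a constant times a product of
    -- factors `X - a`, with a zero at `a` and a pole at infinity.
    intro o
    conv_lhs => rw [← RatFunc.num_div_denom f]
    rw [Place.ord_div _ hn hd, sub_eq_add_neg]
  simp only [h3]
  exact (key _ (RatFunc.num_ne_zero hf)).add (key _ (RatFunc.denom_ne_zero f)).neg

variable {L : Type*} [Field L] [Algebra K L] [Algebra (RatFunc K) L] [IsScalarTower K (RatFunc K) L]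

/-- A function regular at `a` is a quotient of polynomials with denominator nonzero at `a`, and such
a denominator is a unit at `P`. -/
theorem liesOver_ratPlace_some {P : Place K L} {a : K}
    (h : P.v (algebraMap (RatFunc K) L RatFunc.X - algebraMap K L a) < 1) :
    P.LiesOver (ratPlace (some a)) := by
  have hX : P.v (algebraMap (RatFunc K) L RatFunc.X) ≤ 1 := by
    rw [← sub_add_cancel (algebraMap (RatFunc K) L RatFunc.X) (algebraMap K L a)]
    exact P.v.map_add_le h.le (P.v_algebraMap_le_one a)
  have e : ∀ g : Polynomial K, algebraMap (RatFunc K) L (algebraMap (Polynomial K) (RatFunc K) g) =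
      Polynomial.aeval (algebraMap (RatFunc K) L RatFunc.X) g := by
    intro g
    rw [Polynomial.aeval_algebraMap_apply, ← RatFunc.algebraMap_X,
      Polynomial.aeval_algebraMap_apply, Polynomial.aeval_X_left_apply]
  intro c hc
  obtain ⟨n, d, hd⟩ := (vanishingIdeal a).exists_primeCompl_mul_eq_of_integer c hc
  have hda : (d : Polynomial K).eval a ≠ 0 := fun h0 => d.2 ((mem_vanishingIdeal a _).2 h0)
  have h1 : P.v (algebraMap (RatFunc K) L (algebraMap (Polynomial K) (RatFunc K) d)) = 1 := by
    obtain ⟨r, hr⟩ := Polynomial.X_sub_C_dvd_sub_C_eval (a := a) (p := (d : Polynomial K))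
    rw [e, ← sub_add_cancel (d : Polynomial K) (Polynomial.C ((d : Polynomial K).eval a)), hr,
      map_add, Polynomial.aeval_C, Valuation.map_add_eq_of_lt_right, P.trivial _ hda]
    rw [P.trivial _ hda, map_mul, map_mul, map_sub, Polynomial.aeval_X, Polynomial.aeval_C]
    exact (mul_le_of_le_one_right' (P.v_aeval_le_one hX r)).trans_lt h
  have h2 := congr_arg (fun z => P.v (algebraMap (RatFunc K) L z)) hd
  simp only [map_mul, h1, mul_one] at h2
  rw [h2, e]
  exact P.v_aeval_le_one hX n

theorem liesOver_ratPlace_none {P : Place K L}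
    (h : 1 < P.v (algebraMap (RatFunc K) L RatFunc.X)) : P.LiesOver (ratPlace none) := by
  intro c hc
  by_cases hc0 : c = 0
  · simp [hc0]
  rw [Place.v_le_one_iff _ hc0, ratPlace_none_ord hc0] at hc
  let w : Valuation (RatFunc K) ℤᵐ⁰ := P.v.comap (algebraMap (RatFunc K) L)
  have : w.IsTrivialOn K := ⟨fun a ha => by
    change P.v (algebraMap (RatFunc K) L (algebraMap K (RatFunc K) a)) = 1
    rw [← IsScalarTower.algebraMap_apply]
    exact P.trivial a ha⟩
  have h1 := RatFunc.valuation_eq_valuation_X_zpow_intDegree_of_one_lt_valuation_X (v := w) h hc0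
  change P.v (algebraMap (RatFunc K) L c) = P.v (algebraMap (RatFunc K) L RatFunc.X) ^ c.intDegree at h1
  rw [h1]
  exact zpow_le_one_of_nonpos₀ h.le (by omega)

theorem exists_liesOver_ratPlace [HasValues K L] (P : Place K L) : ∃ o, P.LiesOver (ratPlace o) := by
  rcases le_or_gt (P.v (algebraMap (RatFunc K) L RatFunc.X)) 1 with h | h
  · obtain ⟨a, ha⟩ := HasValues.exists_value P _ h
    exact ⟨some a, liesOver_ratPlace_some ha⟩
  · exact ⟨none, liesOver_ratPlace_none h⟩

theorem liesOver_ratPlace_some_iff [Algebra.IsAlgebraic (RatFunc K) L] {P : Place K L} {a : K} :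
    P.LiesOver (ratPlace (some a)) ↔
      P.v (algebraMap (RatFunc K) L RatFunc.X - algebraMap K L a) < 1 := by
  refine ⟨fun h => ?_, liesOver_ratPlace_some⟩
  have := h.v_lt_one (c := algebraMap (Polynomial K) (RatFunc K) (Polynomial.X - Polynomial.C a))
    (by rw [Place.v_lt_one_iff_le, ratPlace_some_v_X_sub_C])
  rwa [map_sub, map_sub, RatFunc.algebraMap_X, RatFunc.algebraMap_C, ← RatFunc.algebraMap_eq_C,
    ← IsScalarTower.algebraMap_apply] at this

theorem liesOver_ratPlace_none_iff [Algebra.IsAlgebraic (RatFunc K) L] {P : Place K L} :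
    P.LiesOver (ratPlace none) ↔ 1 < P.v (algebraMap (RatFunc K) L RatFunc.X) := by
  refine ⟨fun h => ?_, liesOver_ratPlace_none⟩
  have := h.v_lt_one (c := RatFunc.X⁻¹) (by rw [Place.v_lt_one_iff_le, ratPlace_none_v_inv_X])
  rw [map_inv₀, map_inv₀] at this
  have h0 : P.v (algebraMap (RatFunc K) L RatFunc.X) ≠ 0 := by
    simpa using RatFunc.X_ne_zero
  exact (inv_lt_one₀ (zero_lt_iff.2 h0)).1 this

theorem eq_of_liesOver_ratPlace [Algebra.IsAlgebraic (RatFunc K) L] {P : Place K L} {o o' : Option K}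
    (h : P.LiesOver (ratPlace o)) (h' : P.LiesOver (ratPlace o')) : o = o' := by
  have key : ∀ a : K, P.LiesOver (ratPlace (some a)) → ¬ P.LiesOver (ratPlace none) := by
    intro a ha hn
    rw [liesOver_ratPlace_none_iff] at hn
    refine hn.not_ge (ha _ ?_)
    rw [← RatFunc.algebraMap_X]
    exact ratPlace_some_v_le_one a _
  rcases o with _ | a <;> rcases o' with _ | b
  · rfl
  · exact absurd h (key _ h')
  · exact absurd h' (key _ h)
  · rw [liesOver_ratPlace_some_iff] at h h'
    rw [P.v_sub_lt_one_unique h h']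

end RationalPlaces

/-! ### Principal divisors -/

section PrincipalDivisors

theorem hasValues_of_finite {K M L : Type*} [Field K] [Field M] [Field L] [Algebra K M]
    [Algebra K L] [Algebra M L] [IsScalarTower K M L] [FiniteDimensional M L]
    [Algebra.IsSeparable M L] [HasValues K L] : HasValues K M where
  exists_value p y hy := by
    obtain ⟨P, hP⟩ := p.placesOver_nonempty (L := L)
    rw [Place.mem_placesOver] at hP
    obtain ⟨c, hc⟩ := HasValues.exists_value P _ (hP y hy)
    refine ⟨c, lt_of_le_of_ne (p.v.map_sub_le hy (p.v_algebraMap_le_one c)) fun h1 => ?_⟩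
    have := hP.v_eq_one h1
    rw [map_sub, ← IsScalarTower.algebraMap_apply] at this
    exact hc.ne this

/-- Away from the finitely many zeros and poles of the nonzero coefficients of its minimal
polynomial, `y` satisfies a monic equation with regular coefficients. -/
theorem finite_not_isIntegral {K L : Type*} [Field K] [IsAlgClosed K] [Field L]
    [Algebra (RatFunc K) L] [Algebra.IsAlgebraic (RatFunc K) L] (y : L) :
    {o : Option K | ¬ IsIntegral (ratPlace o).ring y}.Finite := by
  set f := minpoly (RatFunc K) y
  have hfin : (⋃ i ∈ f.support, Function.support fun o => (ratPlace o).ord (f.coeff i)).Finite := by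
    refine Set.Finite.biUnion f.support.finite_toSet fun i hi => ?_
    exact (isDegreeZero_ratPlace (Polynomial.mem_support_iff.1 hi)).1
  refine hfin.subset fun o ho => ?_
  by_contra hn
  refine ho ?_
  have hc : ∀ i, (ratPlace o).v (f.coeff i) ≤ 1 := by
    intro i
    by_cases hi : f.coeff i = 0
    · simp [hi]
    · rw [Place.v_le_one_iff _ hi]
      by_contra hlt
      refine hn (Set.mem_biUnion (Polynomial.mem_support_iff.2 hi) ?_)
      rw [Function.mem_support]
      omega
  have hl : f ∈ Polynomial.lifts (algebraMap (ratPlace o).ring (RatFunc K)) := by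
    rw [Polynomial.lifts_iff_coeff_lifts]
    exact fun i => ⟨⟨_, hc i⟩, rfl⟩
  obtain ⟨g, hg, -, hm⟩ := Polynomial.lifts_and_natDegree_eq_and_monic hl
    (minpoly.monic (Algebra.IsIntegral.isIntegral y))
  refine ⟨g, hm, ?_⟩
  rw [← Polynomial.aeval_def, ← Polynomial.aeval_map_algebraMap (RatFunc K), hg]
  exact minpoly.aeval _ _

variable {K L : Type*} [Field K] [Field L] [Algebra K L] [Algebra (RatFunc K) L]
  [IsScalarTower K (RatFunc K) L] [FiniteDimensional (RatFunc K) L]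
  [Algebra.IsSeparable (RatFunc K) L] [HasValues K L]

/-- Every place lies over exactly one place of the projective line, so the sum can be taken fibre by
fibre. -/
theorem sum_placesOver_of_finite {D : Place K L → ℤ} (hD : D.support.Finite) :
    (Function.support fun o : Option K => ∑ P ∈ (ratPlace o).placesOver L, D P).Finite ∧
    ∑ᶠ P, D P = ∑ᶠ o : Option K, ∑ P ∈ (ratPlace o).placesOver L, D P := by
  classical
  choose β hβ using exists_liesOver_ratPlace (K := K) (L := L)
  have hsub : (Function.support fun o : Option K => ∑ P ∈ (ratPlace o).placesOver L, D P) ⊆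
      ((hD.toFinset.image β : Finset (Option K)) : Set (Option K)) := by
    intro o ho
    obtain ⟨P, hP, h0⟩ := Finset.exists_ne_zero_of_sum_ne_zero ho
    rw [Finset.mem_coe, Finset.mem_image]
    exact ⟨P, by simpa using h0, eq_of_liesOver_ratPlace (hβ P) (Place.mem_placesOver.1 hP)⟩
  refine ⟨(Finset.finite_toSet _).subset hsub, ?_⟩
  rw [finsum_eq_sum_of_support_subset _ hsub, finsum_eq_sum_of_support_toFinset_subset D hD
    subset_rfl, ← Finset.sum_fiberwise_of_maps_to (t := hD.toFinset.image β) (g := β)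
    fun P hP => Finset.mem_image_of_mem β hP]
  refine Finset.sum_congr rfl fun o _ => ?_
  refine Finset.sum_subset (fun P hP => ?_) fun P hP hn => ?_
  · rw [Place.mem_placesOver, ← (Finset.mem_filter.1 hP).2]
    exact hβ P
  · by_contra h0
    refine hn (Finset.mem_filter.2 ⟨by simpa using h0, ?_⟩)
    exact eq_of_liesOver_ratPlace (hβ P) (Place.mem_placesOver.1 hP)

theorem finite_of_forall_liesOver {S : Set (Place K L)} {T : Set (Option K)} (hT : T.Finite)
    (h : ∀ P ∈ S, ∀ o, P.LiesOver (ratPlace o) → o ∈ T) : S.Finite := by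
  refine (hT.biUnion fun o _ => (ratPlace o).finite_liesOver (L := L)).subset fun P hP => ?_
  obtain ⟨o, ho⟩ := exists_liesOver_ratPlace P
  exact Set.mem_biUnion (h P hP o ho) ho

variable [IsAlgClosed K]

theorem finite_support_ord {y : L} (hy : y ≠ 0) :
    (Function.support fun P : Place K L => P.ord y).Finite := by
  refine finite_of_forall_liesOver ((finite_not_isIntegral (K := K) y).union
    (finite_not_isIntegral (K := K) y⁻¹)) fun P hP o ho => ?_
  by_contra hn
  rw [Set.mem_union, not_or, Set.mem_ofPred_eq, Set.mem_ofPred_eq, not_not, not_not] at hn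
  have h1 := ho.v_le_one hn.1
  have h2 := ho.v_le_one hn.2
  rw [P.v_le_one_iff hy] at h1
  rw [P.v_le_one_iff (inv_ne_zero hy), P.ord_inv] at h2
  rw [Function.mem_support] at hP
  omega

/-- A function has as many zeros as poles. -/
theorem isDegreeZero_ord {y : L} (hy : y ≠ 0) : IsDegreeZero fun P : Place K L => P.ord y := by
  have : HasValues K (RatFunc K) := hasValues_of_finite (L := L)
  have hfin := finite_support_ord (K := K) hy
  refine ⟨hfin, ?_⟩
  rw [(sum_placesOver_of_finite hfin).2]
  simp only [← Place.ord_norm _ hy]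
  exact (isDegreeZero_ratPlace (Algebra.norm_ne_zero_iff.2 hy)).2

end PrincipalDivisors

/-! ### Bases reduced at infinity -/

section ReducedBasis

theorem Place.isIntegral_algebraMap_of_le {K M L : Type*} [Field K] [Field M] [Field L]
    [Algebra K M] [Algebra M L] (p : Place K M) {c : M} (hc : p.v c ≤ 1) :
    IsIntegral p.ring (algebraMap M L c) :=
  _root_.isIntegral_algebraMap (x := (⟨c, hc⟩ : p.ring))

variable {K L : Type*} [Field K] [Field L] [Algebra (Polynomial K) L]

/-- `b` generates the integral closure of `K[X]` in `L` as a `K[X]`-module. -/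
def SpansIntegers {ι : Type*} (b : ι → L) : Prop :=
  Submodule.span (Polynomial K) (Set.range b) =
    Subalgebra.toSubmodule (integralClosure (Polynomial K) L)

theorem SpansIntegers.isIntegral {ι : Type*} {b : ι → L} (hb : SpansIntegers (K := K) b) (i : ι) :
    IsIntegral (Polynomial K) (b i) := by
  have : b i ∈ Subalgebra.toSubmodule (integralClosure (Polynomial K) L) :=
    hb ▸ Submodule.subset_span ⟨i, rfl⟩
  exact this

theorem SpansIntegers.exists_sum_eq {ι : Type*} [Fintype ι] {b : ι → L}
    (hb : SpansIntegers (K := K) b) {y : L} (hy : IsIntegral (Polynomial K) y) :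
    ∃ q : ι → Polynomial K, ∑ i, q i • b i = y := by
  have : y ∈ Submodule.span (Polynomial K) (Set.range b) := by
    rw [hb]
    exact hy
  exact (Submodule.mem_span_range_iff_exists_fun _).1 this

/-- The coefficient at `k` is a nonzero constant, a unit of `K[X]`, so the old `b k` can be
recovered. -/
theorem SpansIntegers.update {ι : Type*} [Fintype ι] [DecidableEq ι] {b : ι → L}
    (hb : SpansIntegers (K := K) b) {k : ι} (q : ι → Polynomial K) {c : K} (hc : c ≠ 0)
    (hq : q k = Polynomial.C c) :
    SpansIntegers (K := K) (Function.update b k (∑ i, q i • b i)) := by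
  rw [SpansIntegers, ← hb]
  refine le_antisymm (Submodule.span_le.2 ?_) (Submodule.span_le.2 ?_)
  · rintro _ ⟨i, rfl⟩
    by_cases hi : i = k
    · subst hi
      rw [Function.update_self]
      exact Submodule.sum_mem _ fun j _ => Submodule.smul_mem _ _ (Submodule.subset_span ⟨j, rfl⟩)
    · rw [Function.update_of_ne hi]
      exact Submodule.subset_span ⟨i, rfl⟩
  · have hmem : ∀ i, i ≠ k → b i ∈ Submodule.span (Polynomial K)
        (Set.range (Function.update b k (∑ i, q i • b i))) := fun i hi =>
      Submodule.subset_span ⟨i, Function.update_of_ne hi _ _⟩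
    rintro _ ⟨i, rfl⟩
    by_cases hi : i = k
    · subst hi
      have h1 : (∑ j, q j • b j) ∈ Submodule.span (Polynomial K)
          (Set.range (Function.update b i (∑ j, q j • b j))) :=
        Submodule.subset_span ⟨i, Function.update_self _ _ _⟩
      have h2 : b i = Polynomial.C c⁻¹ • ((∑ j, q j • b j) - ∑ j ∈ Finset.univ.erase i, q j • b j) := by
        rw [← Finset.add_sum_erase _ _ (Finset.mem_univ i), add_sub_cancel_right, hq, smul_smul,
          ← Polynomial.C_mul, inv_mul_cancel₀ hc, Polynomial.C_1, one_smul]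
      rw [h2]
      exact Submodule.smul_mem _ _ (Submodule.sub_mem _ h1 (Submodule.sum_mem _ fun j hj =>
        Submodule.smul_mem _ _ (hmem j (Finset.ne_of_mem_erase hj))))
    · exact hmem i hi

variable [Algebra (RatFunc K) L] [IsScalarTower (Polynomial K) (RatFunc K) L]

theorem isIntegral_ratPlace_of_isIntegral {y : L} (hy : IsIntegral (Polynomial K) y) (a : K) :
    IsIntegral (ratPlace (some a)).ring y := by
  let g : Polynomial K →+* (ratPlace (some a)).ring :=
    (algebraMap (Polynomial K) (RatFunc K)).codRestrict _ (ratPlace_some_v_le_one a)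
  obtain ⟨f, hf, hfy⟩ := hy
  refine ⟨f.map g, hf.map g, ?_⟩
  rw [Polynomial.eval₂_map, ← hfy]
  congr 1
  exact (IsScalarTower.algebraMap_eq (Polynomial K) (RatFunc K) L).symm

/-- The coefficients of the minimal polynomial over `K(X)` are regular at every finite place, hence
polynomials. -/
theorem isIntegral_iff_forall_ratPlace [IsAlgClosed K] [Algebra.IsAlgebraic (RatFunc K) L] {y : L} :
    IsIntegral (Polynomial K) y ↔ ∀ a : K, IsIntegral (ratPlace (some a)).ring y := by
  refine ⟨isIntegral_ratPlace_of_isIntegral, fun h => ?_⟩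
  have hl : minpoly (RatFunc K) y ∈ Polynomial.lifts (algebraMap (Polynomial K) (RatFunc K)) := by
    rw [Polynomial.lifts_iff_coeff_lifts]
    intro i
    refine exists_algebraMap_eq_of_forall_le_one fun a => ?_
    rw [minpoly.isIntegrallyClosed_eq_field_fractions' (RatFunc K) (h a), Polynomial.coeff_map]
    exact ((minpoly (ratPlace (some a)).ring y).coeff i).2
  obtain ⟨g, hg, -, hm⟩ := Polynomial.lifts_and_natDegree_eq_and_monic hl
    (minpoly.monic (Algebra.IsIntegral.isIntegral y))
  refine ⟨g, hm, ?_⟩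
  rw [← Polynomial.aeval_def, ← Polynomial.aeval_map_algebraMap (RatFunc K), hg]
  exact minpoly.aeval _ _

variable [FiniteDimensional (RatFunc K) L]

theorem exists_polynomial_smul_isIntegral (y : L) :
    ∃ d : Polynomial K, d ≠ 0 ∧ IsIntegral (Polynomial K) (d • y) := by
  have : Algebra.IsAlgebraic (Polynomial K) L :=
    (IsFractionRing.comap_isAlgebraic_iff (K := RatFunc K)).2 inferInstance
  exact (Algebra.IsAlgebraic.isAlgebraic (R := Polynomial K) y).exists_integral_multiple

theorem exists_spansIntegers [Algebra.IsSeparable (RatFunc K) L] :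
    ∃ b : Fin (Module.finrank (RatFunc K) L) → L, SpansIntegers (K := K) b := by
  have : FaithfulSMul (Polynomial K) L := by
    rw [faithfulSMul_iff_algebraMap_injective, IsScalarTower.algebraMap_eq _ (RatFunc K)]
    exact (algebraMap (RatFunc K) L).injective.comp (RatFunc.algebraMap_injective K)
  let C := integralClosure (Polynomial K) L
  have h1 : Module.Free (Polynomial K) C :=
    IsIntegralClosure.module_free (Polynomial K) (RatFunc K) L C
  have h2 : Module.Finite (Polynomial K) C :=
    IsIntegralClosure.finite (Polynomial K) (RatFunc K) L C
  have h3 : Module.finrank (Polynomial K) C = Module.finrank (RatFunc K) L :=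
    IsIntegralClosure.rank (Polynomial K) (RatFunc K) L C
  let b := Module.finBasisOfFinrankEq (Polynomial K) C h3
  refine ⟨fun i => (b i : L), ?_⟩
  have h4 : (Set.range fun i => (b i : L)) = Set.image (Subalgebra.toSubmodule C).subtype (Set.range b) := by
    rw [← Set.range_comp]
    rfl
  rw [SpansIntegers, h4, Submodule.span_image, b.span_eq, Submodule.map_top,
    Submodule.range_subtype]

theorem SpansIntegers.top_le_span {ι : Type*} [Fintype ι] {b : ι → L}
    (hb : SpansIntegers (K := K) b) : ⊤ ≤ Submodule.span (RatFunc K) (Set.range b) := by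
  intro y _
  obtain ⟨d, hd, hdy⟩ := exists_polynomial_smul_isIntegral (K := K) y
  obtain ⟨q, hq⟩ := hb.exists_sum_eq hdy
  have hd' : algebraMap (Polynomial K) (RatFunc K) d ≠ 0 := RatFunc.algebraMap_ne_zero hd
  rw [← algebraMap_smul (RatFunc K) d y] at hq
  rw [← Submodule.smul_mem_iff _ hd', ← hq]
  refine Submodule.sum_mem _ fun i _ => ?_
  rw [← algebraMap_smul (RatFunc K) (q i) (b i)]
  exact Submodule.smul_mem _ _ (Submodule.subset_span ⟨i, rfl⟩)

/-- A generating family of the right size is a basis over `K(X)`. -/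
def SpansIntegers.basis {b : Fin (Module.finrank (RatFunc K) L) → L}
    (hb : SpansIntegers (K := K) b) :
    Module.Basis (Fin (Module.finrank (RatFunc K) L)) (RatFunc K) L :=
  basisOfTopLeSpanOfCardEqFinrank b hb.top_le_span (by simp)

variable {b : Fin (Module.finrank (RatFunc K) L) → L}

theorem SpansIntegers.basis_apply (hb : SpansIntegers (K := K) b)
    (i : Fin (Module.finrank (RatFunc K) L)) : hb.basis i = b i := by
  simp [SpansIntegers.basis]

theorem SpansIntegers.exists_repr_eq (hb : SpansIntegers (K := K) b) {y : L}
    (hy : IsIntegral (Polynomial K) y) (i : Fin (Module.finrank (RatFunc K) L)) :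
    ∃ q : Polynomial K, algebraMap (Polynomial K) (RatFunc K) q = hb.basis.repr y i := by
  obtain ⟨q, hq⟩ := hb.exists_sum_eq hy
  refine ⟨q i, ?_⟩
  have : y = ∑ i, algebraMap (Polynomial K) (RatFunc K) (q i) • hb.basis i := by
    rw [← hq]
    exact Finset.sum_congr rfl fun i _ => by rw [algebraMap_smul, hb.basis_apply]
  rw [this, hb.basis.repr_sum_self]

theorem SpansIntegers.isIntegralBasis [IsAlgClosed K] (hb : SpansIntegers (K := K) b) (a : K) :
    (ratPlace (some a)).IsIntegralBasis hb.basis := by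
  intro y
  constructor
  · intro hy i
    obtain ⟨d, hd, hdy⟩ := exists_polynomial_smul_isIntegral (K := K) y
    -- The power of `X - a` in the denominator is not needed: `d' y` is integral at `a` because `y`
    -- is, and elsewhere because `X - a` is a unit. The factor `d'` is a unit at `a`.
    obtain ⟨d', hd', hndvd⟩ := Polynomial.exists_eq_pow_rootMultiplicity_mul_and_not_dvd d hd a
    set k := Polynomial.rootMultiplicity a d
    have hda : d'.eval a ≠ 0 := fun h => hndvd (Polynomial.dvd_iff_isRoot.2 h)
    have hint : IsIntegral (Polynomial K) (d' • y) := by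
      refine isIntegral_iff_forall_ratPlace.2 fun e => ?_
      have hpoly : ∀ f : Polynomial K, IsIntegral (ratPlace (some e)).ring
          (algebraMap (Polynomial K) L f) := fun f =>
        isIntegral_ratPlace_of_isIntegral isIntegral_algebraMap e
      by_cases hea : e = a
      · subst hea
        rw [Algebra.smul_def]
        exact (hpoly d').mul hy
      · have hu : IsIntegral (ratPlace (some e)).ring (algebraMap (RatFunc K) L
            (algebraMap (Polynomial K) (RatFunc K) ((Polynomial.X - Polynomial.C a) ^ k))⁻¹) := by
          refine Place.isIntegral_algebraMap_of_le _ ?_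
          rw [map_inv₀, (ratPlace_some_v_eq_one_iff e _).2, inv_one]
          simpa [sub_eq_zero] using fun h => absurd h hea
        have := hu.mul (isIntegral_ratPlace_of_isIntegral hdy e)
        have h0 : algebraMap (Polynomial K) (RatFunc K) ((Polynomial.X - Polynomial.C a) ^ k) ≠ 0 :=
          RatFunc.algebraMap_ne_zero (pow_ne_zero _ (Polynomial.X_sub_C_ne_zero a))
        rwa [Algebra.smul_def, hd', map_mul,
          IsScalarTower.algebraMap_apply (Polynomial K) (RatFunc K) L (_ ^ k), map_inv₀, mul_assoc,
          inv_mul_cancel_left₀ ((map_ne_zero _).2 h0), ← Algebra.smul_def] at this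
    obtain ⟨q, hq⟩ := hb.exists_repr_eq hint i
    rw [← algebraMap_smul (RatFunc K) d' y, map_smul, Finsupp.smul_apply, smul_eq_mul] at hq
    have := congr_arg (ratPlace (some a)).v hq
    rw [map_mul, (ratPlace_some_v_eq_one_iff a d').2 hda, one_mul] at this
    rw [← this]
    exact ratPlace_some_v_le_one a q
  · intro h
    rw [← hb.basis.sum_repr y]
    refine IsIntegral.sum _ fun i _ => ?_
    rw [Algebra.smul_def]
    refine IsIntegral.mul (Place.isIntegral_algebraMap_of_le _ (h i)) ?_
    rw [hb.basis_apply]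
    exact isIntegral_ratPlace_of_isIntegral (hb.isIntegral i) a

end ReducedBasis

/-! ### Pole orders at infinity and reduction of bases -/

section PoleOrder

variable {K L : Type*} [Field K] [Field L] [Algebra (RatFunc K) L]

variable (K) in
/-- The least `m` such that `X⁻ᵐ y` is regular at infinity. -/
def poleOrder (y : L) : ℕ :=
  sInf {m : ℕ | IsIntegral (ratPlace (K := K) none).ring ((RatFunc.X⁻¹ : RatFunc K) ^ m • y)}

theorem poleOrder_le {y : L} {m : ℕ}
    (h : IsIntegral (ratPlace (K := K) none).ring ((RatFunc.X⁻¹ : RatFunc K) ^ m • y)) :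
    poleOrder K y ≤ m := Nat.sInf_le h

theorem isIntegral_poleOrder [Algebra.IsAlgebraic (RatFunc K) L] (y : L) :
    IsIntegral (ratPlace (K := K) none).ring ((RatFunc.X⁻¹ : RatFunc K) ^ poleOrder K y • y) := by
  have : Algebra.IsAlgebraic (ratPlace (K := K) none).ring L :=
    (IsFractionRing.comap_isAlgebraic_iff (K := RatFunc K)).2 inferInstance
  obtain ⟨a, ha, hay⟩ := (Algebra.IsAlgebraic.isAlgebraic
    (R := (ratPlace (K := K) none).ring) y).exists_integral_multiple
  have ha0 : (a : RatFunc K) ≠ 0 := fun h => ha (Subtype.ext h)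
  have hX : (RatFunc.X⁻¹ : RatFunc K) ≠ 0 := inv_ne_zero RatFunc.X_ne_zero
  have hord := ((ratPlace (K := K) none).v_le_one_iff ha0).1 a.2
  have hmem : (((ratPlace (K := K) none).ord (a : RatFunc K)).toNat) ∈
      {m : ℕ | IsIntegral (ratPlace (K := K) none).ring ((RatFunc.X⁻¹ : RatFunc K) ^ m • y)} := by
    set m := ((ratPlace (K := K) none).ord (a : RatFunc K)).toNat with hm
    have hw : (ratPlace (K := K) none).v ((RatFunc.X⁻¹ : RatFunc K) ^ m / a) ≤ 1 := by
      rw [Place.v_le_one_iff _ (div_ne_zero (pow_ne_zero _ hX) ha0),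
        Place.ord_div _ (pow_ne_zero _ hX) ha0, Place.ord_pow,
        (((ratPlace (K := K) none).v_eq_exp_iff 1).1 ratPlace_none_v_inv_X).2, hm,
        Int.toNat_of_nonneg hord]
      omega
    have h1 := (Place.isIntegral_algebraMap_of_le (L := L) _ hw).mul hay
    have h2 : algebraMap (RatFunc K) L ((RatFunc.X⁻¹ : RatFunc K) ^ m / a) * a • y =
        (RatFunc.X⁻¹ : RatFunc K) ^ m • y := by
      have : a • y = (a : RatFunc K) • y := rfl
      rw [this, ← Algebra.smul_def, smul_smul, div_mul_cancel₀ _ ha0]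
    rw [h2] at h1
    exact h1
  exact Nat.sInf_mem ⟨_, hmem⟩

variable [Algebra (Polynomial K) L] [IsScalarTower (Polynomial K) (RatFunc K) L]

variable [FiniteDimensional (RatFunc K) L]

/-- Otherwise the norm of `z` would be a nonzero polynomial which, multiplied by `X` to the power
`[L : K(X)]`, stays regular at infinity. -/
theorem eq_zero_of_isIntegral_of_X_smul {z : L} (h1 : IsIntegral (Polynomial K) z)
    (h2 : IsIntegral (ratPlace (K := K) none).ring ((RatFunc.X : RatFunc K) • z)) : z = 0 := by
  by_contra hz
  have hn : Algebra.norm (RatFunc K) z ≠ 0 := Algebra.norm_ne_zero_iff.2 hz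
  obtain ⟨f, hf⟩ := IsIntegrallyClosed.algebraMap_eq_of_integral
    (Algebra.isIntegral_norm (RatFunc K) h1)
  obtain ⟨w, hw⟩ := IsIntegrallyClosed.algebraMap_eq_of_integral
    (Algebra.isIntegral_norm (RatFunc K) h2)
  have h3 : (ratPlace (K := K) none).v (Algebra.norm (RatFunc K) ((RatFunc.X : RatFunc K) • z)) ≤ 1 :=
    hw ▸ w.2
  have hX : (RatFunc.X : RatFunc K) ^ Module.finrank (RatFunc K) L ≠ 0 :=
    pow_ne_zero _ RatFunc.X_ne_zero
  rw [Algebra.smul_def, map_mul, Algebra.norm_algebraMap, Place.v_le_one_iff _ (mul_ne_zero hX hn),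
    Place.ord_mul _ hX hn, Place.ord_pow, ratPlace_none_ord RatFunc.X_ne_zero,
    RatFunc.intDegree_X, ratPlace_none_ord hn, ← hf, RatFunc.intDegree_polynomial] at h3
  have : 0 < Module.finrank (RatFunc K) L := Module.finrank_pos
  omega

/-- The basis `X⁻ᵐⁱ bᵢ` with `mᵢ` the pole order of `bᵢ` at infinity. -/
def SpansIntegers.inftyBasis {b : Fin (Module.finrank (RatFunc K) L) → L}
    (hb : SpansIntegers (K := K) b) :
    Module.Basis (Fin (Module.finrank (RatFunc K) L)) (RatFunc K) L :=
  hb.basis.unitsSMul fun i =>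
    Units.mk0 ((RatFunc.X⁻¹ : RatFunc K) ^ poleOrder K (b i))
      (pow_ne_zero _ (inv_ne_zero RatFunc.X_ne_zero))

theorem SpansIntegers.inftyBasis_apply {b : Fin (Module.finrank (RatFunc K) L) → L}
    (hb : SpansIntegers (K := K) b) (i : Fin (Module.finrank (RatFunc K) L)) :
    hb.inftyBasis i = (RatFunc.X⁻¹ : RatFunc K) ^ poleOrder K (b i) • b i := by
  rw [inftyBasis, Module.Basis.unitsSMul_apply, hb.basis_apply]
  rfl

theorem SpansIntegers.inftyBasis_repr {b : Fin (Module.finrank (RatFunc K) L) → L}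
    (hb : SpansIntegers (K := K) b) (y : L) (i : Fin (Module.finrank (RatFunc K) L)) :
    hb.inftyBasis.repr y i = RatFunc.X ^ poleOrder K (b i) * hb.basis.repr y i := by
  rw [inftyBasis, Module.Basis.repr_unitsSMul, Units.smul_def, Units.val_inv_eq_inv_val,
    Units.val_mk0, inv_pow, inv_inv, smul_eq_mul]

/-- Bases of the integers over `K[X]` exist that are, up to powers of `X`, integral at infinity. -/
theorem exists_reduced_basis [HasValues K (RatFunc K)] [Algebra.IsSeparable (RatFunc K) L] :
    ∃ (b : Fin (Module.finrank (RatFunc K) L) → L) (hb : SpansIntegers (K := K) b),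
      (ratPlace (K := K) none).IsIntegralBasis hb.inftyBasis := by
  classical
  -- A basis with least total pole order is reduced: any failure at infinity allows one element to
  -- be replaced by one of smaller pole order.
  obtain ⟨b, hb, hmin⟩ := (measure fun b : Fin (Module.finrank (RatFunc K) L) → L =>
    ∑ i, poleOrder K (b i)).wf.has_min {b | SpansIntegers (K := K) b} exists_spansIntegers
  refine ⟨b, hb, fun y => ?_⟩
  have hint : ∀ i, IsIntegral (ratPlace (K := K) none).ring (hb.inftyBasis i) := fun i => by
    rw [hb.inftyBasis_apply]
    exact isIntegral_poleOrder _
  constructor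
  swap
  · intro h
    rw [← hb.inftyBasis.sum_repr y]
    refine IsIntegral.sum _ fun i _ => ?_
    rw [Algebra.smul_def]
    exact IsIntegral.mul (Place.isIntegral_algebraMap_of_le _ (h i)) (hint i)
  intro hy
  by_contra! hne
  obtain ⟨i₁, hi₁⟩ := hne
  set p := ratPlace (K := K) none
  set c := fun i => hb.inftyBasis.repr y i with hc
  obtain ⟨i₀, -, hi₀⟩ := Finset.exists_max_image Finset.univ (fun i => p.v (c i)) ⟨i₁, Finset.mem_univ _⟩
  have hlt : 1 < p.v (c i₀) := lt_of_lt_of_le hi₁ (hi₀ i₁ (Finset.mem_univ _))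
  have hc0 : c i₀ ≠ 0 := by
    intro h0
    rw [h0, map_zero] at hlt
    exact absurd hlt (by simp)
  have hreg : ∀ i, p.v (c i / c i₀) ≤ 1 := fun i => by
    rw [map_div₀]
    exact div_le_one_of_le₀ (hi₀ i (Finset.mem_univ _)) zero_le
  -- Divided by a coordinate with the worst pole, the coordinates of `y` have values `lam i` at
  -- infinity, not all zero. They define `z`, which vanishes at infinity so that even `X z` is
  -- integral there.
  choose lam hlam using fun i => HasValues.exists_value p _ (hreg i)
  have hlam0 : lam i₀ = 1 := by
    refine p.v_sub_lt_one_unique (hlam i₀) ?_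
    rw [div_self hc0, map_one, sub_self, map_zero]
    exact zero_lt_one
  set z := ∑ i, algebraMap K (RatFunc K) (lam i) • hb.inftyBasis i with hz
  have hXv : p.v (RatFunc.X : RatFunc K) = WithZero.exp 1 := by
    have := ratPlace_none_v_inv_X (K := K)
    rw [map_inv₀, WithZero.exp_neg] at this
    exact inv_injective this
  have hXint : ∀ w : RatFunc K, p.v w < 1 → p.v (RatFunc.X * w) ≤ 1 := fun w hw => by
    rw [map_mul, hXv]
    rw [p.v_lt_one_iff_le] at hw
    calc _ ≤ WithZero.exp (1 : ℤ) * WithZero.exp (-1) := mul_le_mul_right hw _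
      _ = 1 := by rw [← WithZero.exp_add]; simp
  have hXz : IsIntegral p.ring ((RatFunc.X : RatFunc K) • z) := by
    have e : (RatFunc.X : RatFunc K) • z = algebraMap (RatFunc K) L (RatFunc.X * (c i₀)⁻¹) * y -
        ∑ i, algebraMap (RatFunc K) L (RatFunc.X * (c i / c i₀ - algebraMap K (RatFunc K) (lam i))) *
          hb.inftyBasis i := by
      conv_rhs => rw [← hb.inftyBasis.sum_repr y]
      rw [hz, Finset.smul_sum, Finset.mul_sum, ← Finset.sum_sub_distrib]
      refine Finset.sum_congr rfl fun i _ => ?_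
      simp only [Algebra.smul_def, map_mul, map_sub, map_div₀, map_inv₀, hc]
      ring
    rw [e]
    refine IsIntegral.sub (IsIntegral.mul (p.isIntegral_algebraMap_of_le (hXint _ ?_)) hy)
      (IsIntegral.sum _ fun i _ => IsIntegral.mul (p.isIntegral_algebraMap_of_le (hXint _ (hlam i)))
        (hint i))
    rw [map_inv₀]
    exact inv_lt_one_of_one_lt₀ hlt
  obtain ⟨k, hk, hkmax⟩ := Finset.exists_max_image (Finset.univ.filter fun i => lam i ≠ 0)
    (fun i => poleOrder K (b i)) ⟨i₀, by simp [hlam0]⟩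
  have hk0 : lam k ≠ 0 := (Finset.mem_filter.1 hk).2
  -- With `k` of largest pole order among the `i` with `lam i ≠ 0`, the combination `X ^ m_k z` has
  -- polynomial coefficients and a nonzero constant at `k`. It can replace `b k`, and its pole order
  -- is at most `m_k - 1` if `m_k > 0`.
  let q : Fin (Module.finrank (RatFunc K) L) → Polynomial K := fun i =>
    Polynomial.C (lam i) * Polynomial.X ^ (poleOrder K (b k) - poleOrder K (b i))
  have hq : ∑ i, q i • b i = (RatFunc.X : RatFunc K) ^ poleOrder K (b k) • z := by
    rw [hz, Finset.smul_sum]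
    refine Finset.sum_congr rfl fun i _ => ?_
    by_cases hi : lam i = 0
    · simp [q, hi]
    have hle := hkmax i (Finset.mem_filter.2 ⟨Finset.mem_univ _, hi⟩)
    rw [hb.inftyBasis_apply, smul_smul, smul_smul, ← algebraMap_smul (RatFunc K) (q i) (b i)]
    congr 1
    simp only [q, map_mul, map_pow, RatFunc.algebraMap_X, RatFunc.algebraMap_C,
      RatFunc.algebraMap_eq_C]
    rw [pow_sub₀ _ RatFunc.X_ne_zero hle, inv_pow]
    ring
  have hspan := hb.update q hk0 (k := k) (by simp [q])
  have hz0 : z ≠ 0 := by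
    intro h0
    have := congr_arg (fun w => hb.inftyBasis.repr w k) (hz.symm.trans h0)
    simp only [hb.inftyBasis.repr_sum_self, map_zero, Finsupp.zero_apply] at this
    exact hk0 (by simpa using this)
  -- If the pole order is already zero, `z` itself is integral over `K[X]` while `X z` is integral
  -- at infinity, which forces `z = 0`.
  rcases Nat.eq_zero_or_pos (poleOrder K (b k)) with h0 | hpos
  · rw [h0, pow_zero, one_smul] at hq
    refine hz0 (eq_zero_of_isIntegral_of_X_smul ?_ hXz)
    rw [← hq]
    have := hspan.isIntegral k
    rwa [Function.update_self] at this
  · refine hmin _ hspan ?_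
    change ∑ i, poleOrder K (Function.update b k (∑ i, q i • b i) i) < ∑ i, poleOrder K (b i)
    refine Finset.sum_lt_sum (fun i _ => ?_) ⟨k, Finset.mem_univ _, ?_⟩
    swap
    · rw [Function.update_self]
      refine (poleOrder_le (m := poleOrder K (b k) - 1) ?_).trans_lt (by omega)
      rw [hq, smul_smul]
      have : (RatFunc.X⁻¹ : RatFunc K) ^ (poleOrder K (b k) - 1) * RatFunc.X ^ poleOrder K (b k) =
          RatFunc.X := by
        obtain ⟨n, hn⟩ : ∃ n, poleOrder K (b k) = n + 1 := ⟨_, (Nat.sub_add_cancel hpos).symm⟩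
        rw [hn, Nat.add_sub_cancel, pow_succ, ← mul_assoc, ← mul_pow,
          inv_mul_cancel₀ RatFunc.X_ne_zero, one_pow, one_mul]
      rw [this]
      exact hXz
    · by_cases hi : i = k
      · subst hi
        rw [Function.update_self]
        refine poleOrder_le ?_
        rw [hq, smul_smul, ← mul_pow, inv_mul_cancel₀ RatFunc.X_ne_zero, one_pow, one_smul]
        refine IsIntegral.sum _ fun j _ => ?_
        rw [Algebra.smul_def]
        exact IsIntegral.mul (p.isIntegral_algebraMap_of_le (p.v_algebraMap_le_one _)) (hint j)
      · rw [Function.update_of_ne hi]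

end PoleOrder

/-! ### The degree of a differential and the genus -/

section Separating

variable {K L : Type*} [Field K] [Field L] [Algebra K L] {t : L}

theorem IsSeparating.of_adjoin_le (ht : IsSeparating K t) {t' : L}
    (h : t' ∈ IntermediateField.adjoin K {t}) (h' : t ∈ IntermediateField.adjoin K {t'}) :
    IsSeparating K t' := by
  have e : IntermediateField.adjoin K {t} = IntermediateField.adjoin K {t'} :=
    le_antisymm (IntermediateField.adjoin_le_iff.2 (Set.singleton_subset_iff.2 h'))
      (IntermediateField.adjoin_le_iff.2 (Set.singleton_subset_iff.2 h))
  have key : ∀ E E' : IntermediateField K L, E = E' → Algebra.IsSeparable E L →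
      Algebra.IsSeparable E' L := by
    rintro E _ rfl h
    exact h
  exact key _ _ e ht

theorem IsSeparating.sub_algebraMap (ht : IsSeparating K t) (a : K) :
    IsSeparating K (t - algebraMap K L a) := by
  refine ht.of_adjoin_le (sub_mem (IntermediateField.mem_adjoin_simple_self K t)
    (algebraMap_mem _ a)) ?_
  have := add_mem (IntermediateField.mem_adjoin_simple_self K (t - algebraMap K L a))
    (algebraMap_mem (IntermediateField.adjoin K {t - algebraMap K L a}) a)
  rwa [sub_add_cancel] at this

theorem IsSeparating.inv (ht : IsSeparating K t) : IsSeparating K t⁻¹ := by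
  refine ht.of_adjoin_le (inv_mem (IntermediateField.mem_adjoin_simple_self K t)) ?_
  have := inv_mem (IntermediateField.mem_adjoin_simple_self K t⁻¹)
  rwa [inv_inv] at this

theorem IsTaylor.sub_algebraMap {τ : L →ₐ[K] L⟦X⟧} (hτ : IsTaylor t τ) (a : K) :
    IsTaylor (t - algebraMap K L a) τ := by
  refine ⟨hτ.1, ?_⟩
  rw [map_sub, hτ.2, AlgHom.commutes, PowerSeries.algebraMap_apply, map_sub]
  ring

end Separating

/-! ### Regular differentials and the degree of `dX` through a reduced basis -/

section Genus

theorem Place.IsIntegralBasis.forall_trace_le_iff {K M L : Type*} [Field K] [Field M] [Field L]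
    [Algebra K M] [Algebra M L] [FiniteDimensional M L] {p : Place K M} {ι : Type*} [Fintype ι]
    {b : Module.Basis ι M L} (hb : p.IsIntegralBasis b) (h : L) :
    (∀ y : L, IsIntegral p.ring y → p.v (Algebra.trace M L (h * y)) ≤ 1) ↔
      ∀ i, p.v (Algebra.trace M L (h * b i)) ≤ 1 := by
  refine ⟨fun H i => H _ (hb.isIntegral i), fun H y hy => ?_⟩
  rw [← b.sum_repr y, Finset.mul_sum, map_sum]
  refine p.v.map_sum_le fun i _ => ?_
  rw [mul_smul_comm, map_smul, smul_eq_mul, map_mul]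
  exact mul_le_one' ((hb y).1 hy i) (H i)

variable {K L : Type*} [Field K] [Field L] [Algebra K L] [Algebra (RatFunc K) L]

theorem ordDiff_inv_X [HasValues K L] {τ : L →ₐ[K] L⟦X⟧}
    (ht : IsSeparating K (algebraMap (RatFunc K) L RatFunc.X))
    (hτ : IsTaylor (algebraMap (RatFunc K) L RatFunc.X) τ) (P : Place K L) :
    P.ordDiff (KaehlerDifferential.D K L (algebraMap (RatFunc K) L RatFunc.X⁻¹)) =
      -2 * P.ord (algebraMap (RatFunc K) L RatFunc.X) +
        P.ordDiff (KaehlerDifferential.D K L (algebraMap (RatFunc K) L RatFunc.X)) := by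
  have h0 : algebraMap (RatFunc K) L RatFunc.X ≠ 0 := (map_ne_zero _).2 RatFunc.X_ne_zero
  have hD : KaehlerDifferential.D K L (algebraMap (RatFunc K) L RatFunc.X) ≠ 0 := by
    intro h
    have := smul_D_injective hτ (a₁ := 1) (a₂ := 0) (by simp [h])
    exact one_ne_zero this
  rw [map_inv₀, Derivation.leibniz_inv, Place.ordDiff_smul ht hτ P
    (neg_ne_zero.2 (pow_ne_zero _ (inv_ne_zero h0))) hD, P.ord_neg, P.ord_pow, P.ord_inv]
  push_cast
  ring

variable [IsScalarTower K (RatFunc K) L]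

theorem algebraMap_X_sub_C (a : K) : algebraMap (RatFunc K) L
    (algebraMap (Polynomial K) (RatFunc K) (Polynomial.X - Polynomial.C a)) =
      algebraMap (RatFunc K) L RatFunc.X - algebraMap K L a := by
  rw [map_sub, map_sub, RatFunc.algebraMap_X, RatFunc.algebraMap_C, ← RatFunc.algebraMap_eq_C,
    ← IsScalarTower.algebraMap_apply]

theorem transcendental_algebraMap_X : Transcendental K (algebraMap (RatFunc K) L RatFunc.X) := by
  rw [transcendental_algebraMap_iff (algebraMap (RatFunc K) L).injective]
  exact RatFunc.transcendental_X

variable [IsAlgClosed K] [FiniteDimensional (RatFunc K) L]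
  [Algebra.IsSeparable (RatFunc K) L] [HasValues K L] {τ : L →ₐ[K] L⟦X⟧}

theorem forall_trace_le_iff_some (ht : IsSeparating K (algebraMap (RatFunc K) L RatFunc.X))
    (hτ : IsTaylor (algebraMap (RatFunc K) L RatFunc.X) τ) {h : L} (hh : h ≠ 0) (a : K) :
    (∀ y : L, IsIntegral (ratPlace (some a)).ring y →
        (ratPlace (some a)).v (Algebra.trace (RatFunc K) L (h * y)) ≤ 1) ↔
      ∀ P : Place K L, P.LiesOver (ratPlace (some a)) → 0 ≤ P.ord h +
        P.ordDiff (KaehlerDifferential.D K L (algebraMap (RatFunc K) L RatFunc.X)) := by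
  have : HasValues K (RatFunc K) := hasValues_of_finite (L := L)
  rw [Place.forall_trace_le_iff (τ := τ) (ratPlace_some_v_X_sub_C a)
    (by rw [algebraMap_X_sub_C]; exact ht.sub_algebraMap a)
    (by rw [algebraMap_X_sub_C]; exact hτ.sub_algebraMap a) hh]
  rw [algebraMap_X_sub_C, map_sub, Derivation.map_algebraMap, sub_zero]

/-- The parameter at infinity is `X⁻¹`, and `h dX = -X² h d(X⁻¹)`; this accounts for the factor
`X²`. -/
theorem forall_trace_le_iff_none (ht : IsSeparating K (algebraMap (RatFunc K) L RatFunc.X))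
    (hτ : IsTaylor (algebraMap (RatFunc K) L RatFunc.X) τ) {h : L} (hh : h ≠ 0) :
    (∀ y : L, IsIntegral (ratPlace (K := K) none).ring y → (ratPlace (K := K) none).v
        (Algebra.trace (RatFunc K) L (algebraMap (RatFunc K) L RatFunc.X ^ 2 * h * y)) ≤ 1) ↔
      ∀ P : Place K L, P.LiesOver (ratPlace none) → 0 ≤ P.ord h +
        P.ordDiff (KaehlerDifferential.D K L (algebraMap (RatFunc K) L RatFunc.X)) := by
  have : HasValues K (RatFunc K) := hasValues_of_finite (L := L)
  have h0 : algebraMap (RatFunc K) L RatFunc.X ≠ 0 := (map_ne_zero _).2 RatFunc.X_ne_zero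
  have ht' : IsSeparating K (algebraMap (RatFunc K) L RatFunc.X⁻¹) := by
    rw [map_inv₀]
    exact ht.inv
  have htr : Transcendental K (algebraMap (RatFunc K) L RatFunc.X⁻¹) := by
    rw [map_inv₀]
    exact fun h => transcendental_algebraMap_X (IsAlgebraic.inv_iff.1 h)
  obtain ⟨τ', hτ', -⟩ := existsUnique_isTaylor _ htr ht'
  rw [Place.forall_trace_le_iff ratPlace_none_v_inv_X ht' hτ' (mul_ne_zero (pow_ne_zero _ h0) hh)]
  refine forall_congr' fun P => imp_congr_right fun _ => ?_
  rw [ordDiff_inv_X ht hτ, P.ord_mul (pow_ne_zero _ h0) hh, P.ord_pow]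
  push_cast
  constructor <;> intro <;> linarith

variable [Algebra (Polynomial K) L] [IsScalarTower (Polynomial K) (RatFunc K) L]
  {b : Fin (Module.finrank (RatFunc K) L) → L}

theorem SpansIntegers.ord_discr_some (hb : SpansIntegers (K := K) b)
    (ht : IsSeparating K (algebraMap (RatFunc K) L RatFunc.X))
    (hτ : IsTaylor (algebraMap (RatFunc K) L RatFunc.X) τ) (a : K) :
    (ratPlace (some a)).ord (Algebra.discr (RatFunc K) hb.basis) =
      ∑ P ∈ (ratPlace (some a)).placesOver L,
        P.ordDiff (KaehlerDifferential.D K L (algebraMap (RatFunc K) L RatFunc.X)) := by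
  have : HasValues K (RatFunc K) := hasValues_of_finite (L := L)
  rw [(hb.isIntegralBasis a).ord_discr (τ := τ) (ratPlace_some_v_X_sub_C a)
    (by rw [algebraMap_X_sub_C]; exact ht.sub_algebraMap a)
    (by rw [algebraMap_X_sub_C]; exact hτ.sub_algebraMap a)]
  rw [algebraMap_X_sub_C, map_sub, Derivation.map_algebraMap, sub_zero]

/-- The discriminants of the two bases differ by `X` to the power `-2 ∑ m_i`, of order `2 ∑ m_i` at
infinity. Passing from `d(X⁻¹)` to `dX` adds `2 ord X` at each place, in total `-2 [L : K(X)]` by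
the norm of `X`. -/
theorem SpansIntegers.ord_discr_none (hb : SpansIntegers (K := K) b)
    (hinf : (ratPlace (K := K) none).IsIntegralBasis hb.inftyBasis)
    (ht : IsSeparating K (algebraMap (RatFunc K) L RatFunc.X))
    (hτ : IsTaylor (algebraMap (RatFunc K) L RatFunc.X) τ) :
    (ratPlace none).ord (Algebra.discr (RatFunc K) hb.basis) +
        (2 * ∑ i, (poleOrder K (b i) : ℤ) - 2 * Module.finrank (RatFunc K) L) =
      ∑ P ∈ (ratPlace (K := K) none).placesOver L,
        P.ordDiff (KaehlerDifferential.D K L (algebraMap (RatFunc K) L RatFunc.X)) := by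
  have : HasValues K (RatFunc K) := hasValues_of_finite (L := L)
  have h0 : algebraMap (RatFunc K) L RatFunc.X ≠ 0 := (map_ne_zero _).2 RatFunc.X_ne_zero
  have hX : (RatFunc.X⁻¹ : RatFunc K) ≠ 0 := inv_ne_zero RatFunc.X_ne_zero
  have ht' : IsSeparating K (algebraMap (RatFunc K) L RatFunc.X⁻¹) := by
    rw [map_inv₀]
    exact ht.inv
  have htr : Transcendental K (algebraMap (RatFunc K) L RatFunc.X⁻¹) := by
    rw [map_inv₀]
    exact fun h => transcendental_algebraMap_X (IsAlgebraic.inv_iff.1 h)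
  obtain ⟨τ', hτ', -⟩ := existsUnique_isTaylor _ htr ht'
  have h1 := hinf.ord_discr ratPlace_none_v_inv_X ht' hτ'
  simp only [ordDiff_inv_X ht hτ, Finset.sum_add_distrib, ← Finset.mul_sum] at h1
  rw [← Place.ord_norm _ h0, Algebra.norm_algebraMap, Place.ord_pow,
    ratPlace_none_ord RatFunc.X_ne_zero, RatFunc.intDegree_X] at h1
  have h2 : Algebra.discr (RatFunc K) hb.inftyBasis =
      (∏ i, (RatFunc.X⁻¹ : RatFunc K) ^ poleOrder K (b i)) ^ 2 * Algebra.discr (RatFunc K) hb.basis := by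
    conv_lhs => rw [← hb.basis.toMatrix_map_vecMul hb.inftyBasis]
    rw [Algebra.discr_of_matrix_vecMul, SpansIntegers.inftyBasis, Module.Basis.toMatrix_unitsSMul,
      Matrix.det_diagonal]
    rfl
  have h3 : ∀ i ∈ Finset.univ, (RatFunc.X⁻¹ : RatFunc K) ^ poleOrder K (b i) ≠ 0 := fun i _ =>
    pow_ne_zero _ hX
  rw [h2, Place.ord_mul _ (pow_ne_zero _ (Finset.prod_ne_zero_iff.2 h3))
    (Algebra.discr_not_zero_of_basis _ _), Place.ord_pow, Place.ord_prod _ _ _ h3] at h1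
  simp only [Place.ord_pow, (((ratPlace (K := K) none).v_eq_exp_iff 1).1 ratPlace_none_v_inv_X).2,
    mul_one] at h1
  push_cast at h1
  linarith

/-- Fibre by fibre the divisor of `dX` is the divisor of the discriminant, which has degree zero,
apart from the correction at infinity. -/
theorem SpansIntegers.degree_ordDiff (hb : SpansIntegers (K := K) b)
    (hinf : (ratPlace (K := K) none).IsIntegralBasis hb.inftyBasis)
    (ht : IsSeparating K (algebraMap (RatFunc K) L RatFunc.X))
    (hτ : IsTaylor (algebraMap (RatFunc K) L RatFunc.X) τ) :
    (Function.support fun P : Place K L => P.ordDiff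
        (KaehlerDifferential.D K L (algebraMap (RatFunc K) L RatFunc.X))).Finite ∧
    ∑ᶠ P : Place K L, P.ordDiff (KaehlerDifferential.D K L (algebraMap (RatFunc K) L RatFunc.X)) =
      2 * ∑ i, (poleOrder K (b i) : ℤ) - 2 * Module.finrank (RatFunc K) L := by
  classical
  have hdisc := isDegreeZero_ratPlace (Algebra.discr_not_zero_of_basis (RatFunc K) hb.basis)
  -- Traces of integral elements are integral, so `h = 1` belongs to the trace dual. Nonnegativity
  -- is what makes a vanishing sum over a fibre force each of its terms to vanish.
  have hnonneg : ∀ a : K, ∀ P : Place K L, P.LiesOver (ratPlace (some a)) → 0 ≤ P.ordDiff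
      (KaehlerDifferential.D K L (algebraMap (RatFunc K) L RatFunc.X)) := by
    intro a P hP
    have := (forall_trace_le_iff_some ht hτ one_ne_zero a).1 (fun y hy => by
      rw [one_mul]
      obtain ⟨w, hw⟩ := IsIntegrallyClosed.algebraMap_eq_of_integral
        (Algebra.isIntegral_trace (L := RatFunc K) hy)
      rw [← hw]
      exact w.2) P hP
    rwa [P.ord_one, zero_add] at this
  have hfin : (Function.support fun P : Place K L => P.ordDiff
      (KaehlerDifferential.D K L (algebraMap (RatFunc K) L RatFunc.X))).Finite := by
    refine finite_of_forall_liesOver (hdisc.1.union (Set.finite_singleton none)) fun P hP o ho => ?_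
    rcases o with _ | a
    · simp
    · refine Or.inl ?_
      rw [Function.mem_support, hb.ord_discr_some ht hτ]
      have h1 := Finset.single_le_sum (f := fun P : Place K L => P.ordDiff
        (KaehlerDifferential.D K L (algebraMap (RatFunc K) L RatFunc.X)))
        (fun P hP => hnonneg a P (Place.mem_placesOver.1 hP)) (Place.mem_placesOver.2 ho)
      have h2 := hnonneg a P ho
      rw [Function.mem_support] at hP
      omega
  refine ⟨hfin, ?_⟩
  rw [(sum_placesOver_of_finite hfin).2]
  set A := 2 * ∑ i, (poleOrder K (b i) : ℤ) - 2 * Module.finrank (RatFunc K) L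
  have h4 : ∀ o : Option K, ∑ P ∈ (ratPlace o).placesOver L,
      P.ordDiff (KaehlerDifferential.D K L (algebraMap (RatFunc K) L RatFunc.X)) =
      (ratPlace o).ord (Algebra.discr (RatFunc K) hb.basis) + if o = none then A else 0 := by
    intro o
    rcases o with _ | a
    · rw [if_pos rfl, ← hb.ord_discr_none hinf ht hτ]
    · rw [if_neg (by simp), add_zero, hb.ord_discr_some ht hτ]
  simp only [h4]
  rw [finsum_add_distrib hdisc.1, hdisc.2, zero_add, finsum_eq_single _ none (by simp +contextual),
    if_pos rfl]
  exact (Set.finite_singleton none).subset fun o ho => by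
    by_contra hne
    rw [Set.mem_singleton_iff] at hne
    simp [hne] at ho

theorem SpansIntegers.smul_D_mem_iff (hb : SpansIntegers (K := K) b)
    (hinf : (ratPlace (K := K) none).IsIntegralBasis hb.inftyBasis)
    (ht : IsSeparating K (algebraMap (RatFunc K) L RatFunc.X))
    (hτ : IsTaylor (algebraMap (RatFunc K) L RatFunc.X) τ) (h : L) :
    h • KaehlerDifferential.D K L (algebraMap (RatFunc K) L RatFunc.X) ∈
        (⨅ P : Place K L, P.regularDiff : Submodule K Ω[L⁄K]) ↔
      ∀ i, ∃ q ∈ Polynomial.degreeLT K (poleOrder K (b i) - 1),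
        algebraMap (Polynomial K) (RatFunc K) q = Algebra.trace (RatFunc K) L (h * b i) := by
  by_cases hh : h = 0
  · subst hh
    refine iff_of_true (by simp) fun i => ⟨0, Submodule.zero_mem _, by simp⟩
  rw [Submodule.mem_iInf]
  simp only [Place.smul_D_mem_regularDiff_iff ht hτ _ hh]
  have h1 : (∀ P : Place K L, 0 ≤ P.ord h +
      P.ordDiff (KaehlerDifferential.D K L (algebraMap (RatFunc K) L RatFunc.X))) ↔
      ∀ o : Option K, ∀ P : Place K L, P.LiesOver (ratPlace o) → 0 ≤ P.ord h +
        P.ordDiff (KaehlerDifferential.D K L (algebraMap (RatFunc K) L RatFunc.X)) :=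
    ⟨fun H _ P _ => H P, fun H P => by
      obtain ⟨o, ho⟩ := exists_liesOver_ratPlace P
      exact H o P ho⟩
  rw [h1, Option.forall, ← forall_trace_le_iff_none ht hτ hh, hinf.forall_trace_le_iff]
  simp only [← forall_trace_le_iff_some ht hτ hh, (hb.isIntegralBasis _).forall_trace_le_iff,
    hb.basis_apply]
  have h2 : ∀ i, algebraMap (RatFunc K) L RatFunc.X ^ 2 * h * hb.inftyBasis i =
      (RatFunc.X ^ 2 * (RatFunc.X⁻¹ : RatFunc K) ^ poleOrder K (b i)) • (h * b i) := by
    intro i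
    rw [hb.inftyBasis_apply, Algebra.smul_def, Algebra.smul_def, map_mul, map_pow, map_pow]
    ring
  simp only [h2, map_smul, smul_eq_mul]
  have hXX : ∀ n : ℕ, RatFunc.X ^ 2 * (RatFunc.X⁻¹ : RatFunc K) ^ n ≠ 0 := fun n =>
    mul_ne_zero (pow_ne_zero _ RatFunc.X_ne_zero)
      (pow_ne_zero _ (inv_ne_zero RatFunc.X_ne_zero))
  -- Regularity at infinity means `deg q ≤ m_i - 2`. For `m_i ≤ 1` only `q = 0` qualifies, in
  -- agreement with the truncated `m_i - 1`.
  have h3 : ∀ (i : Fin (Module.finrank (RatFunc K) L)) (q : Polynomial K),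
      (ratPlace (K := K) none).v (RatFunc.X ^ 2 * (RatFunc.X⁻¹ : RatFunc K) ^ poleOrder K (b i) *
        algebraMap (Polynomial K) (RatFunc K) q) ≤ 1 ↔
      q ∈ Polynomial.degreeLT K (poleOrder K (b i) - 1) := by
    intro i q
    by_cases hq : q = 0
    · subst hq
      simp
    have hq' : algebraMap (Polynomial K) (RatFunc K) q ≠ 0 := RatFunc.algebraMap_ne_zero hq
    rw [Place.v_le_one_iff _ (mul_ne_zero (hXX _) hq'), Place.ord_mul _ (hXX _) hq',
      Place.ord_mul _ (pow_ne_zero _ RatFunc.X_ne_zero)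
        (pow_ne_zero _ (inv_ne_zero RatFunc.X_ne_zero)), Place.ord_pow, Place.ord_pow, Place.ord_inv,
      ratPlace_none_ord RatFunc.X_ne_zero, ratPlace_none_ord hq', RatFunc.intDegree_X,
      RatFunc.intDegree_polynomial, Polynomial.mem_degreeLT, Polynomial.degree_eq_natDegree hq]
    push_cast
    rw [Nat.cast_lt]
    omega
  constructor
  · rintro ⟨hn, hs⟩ i
    obtain ⟨q, hq⟩ := exists_algebraMap_eq_of_forall_le_one fun a => hs a i
    refine ⟨q, (h3 i q).1 ?_, hq⟩
    rw [hq]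
    exact hn i
  · intro H
    refine ⟨fun i => ?_, fun a i => ?_⟩
    · obtain ⟨q, hq, e⟩ := H i
      rw [← e]
      exact (h3 i q).2 hq
    · obtain ⟨q, hq, e⟩ := H i
      rw [← e]
      exact ratPlace_some_v_le_one a q

end Genus

/-! ### The genus from the pole orders -/

section GenusFormula

variable {K L : Type*} [Field K] [Field L] [Algebra (RatFunc K) L] [FiniteDimensional (RatFunc K) L]
  [Algebra (Polynomial K) L] [IsScalarTower (Polynomial K) (RatFunc K) L]
  {b : Fin (Module.finrank (RatFunc K) L) → L}

/-- A nonzero coordinate of the function `1` is a polynomial that remains regular at infinity after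
multiplication by `X ^ m_i`, which forces `m_i = 0`. -/
theorem SpansIntegers.exists_poleOrder_eq_zero (hb : SpansIntegers (K := K) b)
    (hinf : (ratPlace (K := K) none).IsIntegralBasis hb.inftyBasis) :
    ∃ i, poleOrder K (b i) = 0 := by
  have h1 : hb.basis.repr (1 : L) ≠ 0 := by simp
  obtain ⟨i, hi⟩ := Finsupp.ne_iff.1 h1
  refine ⟨i, ?_⟩
  rw [Finsupp.zero_apply] at hi
  obtain ⟨q, hq⟩ := hb.exists_repr_eq isIntegral_one i
  have h2 := (hinf 1).1 isIntegral_one i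
  have hX : RatFunc.X ^ poleOrder K (b i) ≠ (0 : RatFunc K) := pow_ne_zero _ RatFunc.X_ne_zero
  rw [hb.inftyBasis_repr, Place.v_le_one_iff _ (mul_ne_zero hX hi), Place.ord_mul _ hX hi,
    Place.ord_pow, ratPlace_none_ord RatFunc.X_ne_zero, RatFunc.intDegree_X, ratPlace_none_ord hi,
    ← hq, RatFunc.intDegree_polynomial] at h2
  omega

variable [Algebra.IsSeparable (RatFunc K) L]

theorem SpansIntegers.trace_sum_dualBasis (hb : SpansIntegers (K := K) b)
    (c : Fin (Module.finrank (RatFunc K) L) → RatFunc K) (i : Fin (Module.finrank (RatFunc K) L)) :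
    Algebra.trace (RatFunc K) L ((∑ j, c j • (Algebra.traceForm (RatFunc K) L).dualBasis
      (traceForm_nondegenerate _ _) hb.basis j) * b i) = c i := by
  set B := (Algebra.traceForm (RatFunc K) L).dualBasis (traceForm_nondegenerate _ _) hb.basis
  have h1 := LinearMap.BilinForm.dualBasis_repr_apply (traceForm_nondegenerate (RatFunc K) L)
    hb.basis (∑ j, c j • B j) i
  rw [Algebra.traceForm_apply, hb.basis_apply] at h1
  rw [← h1]
  exact congr_fun (B.repr_sum_self c) i

variable [Algebra K L] [IsScalarTower K (RatFunc K) L]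

/-- The differential `h dX` such that `Tr (h bᵢ) = qᵢ`. -/
def SpansIntegers.differential (hb : SpansIntegers (K := K) b) :
    (∀ i, Polynomial.degreeLT K (poleOrder K (b i) - 1)) →ₗ[K] Ω[L⁄K] where
  toFun q := (∑ i, algebraMap (Polynomial K) (RatFunc K) (q i : Polynomial K) •
    (Algebra.traceForm (RatFunc K) L).dualBasis (traceForm_nondegenerate _ _) hb.basis i) •
      KaehlerDifferential.D K L (algebraMap (RatFunc K) L RatFunc.X)
  map_add' q q' := by
    simp only [Pi.add_apply, Submodule.coe_add, map_add, add_smul, Finset.sum_add_distrib]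
  map_smul' c q := by
    rw [RingHom.id_apply, ← smul_assoc, Finset.smul_sum]
    congr 1
    refine Finset.sum_congr rfl fun i _ => ?_
    rw [Pi.smul_apply, Submodule.coe_smul, Polynomial.smul_eq_C_mul, map_mul, mul_smul,
      RatFunc.algebraMap_C, ← RatFunc.algebraMap_eq_C, algebraMap_smul]

variable [IsAlgClosed K] [HasValues K L] {τ : L →ₐ[K] L⟦X⟧}

/-- By nondegeneracy of the trace form `h` is determined by the traces `Tr (h b_i)`, which for
regular `h dX` run independently through the polynomials of degree less than `m_i - 1`. -/
theorem SpansIntegers.genus_eq (hb : SpansIntegers (K := K) b)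
    (hinf : (ratPlace (K := K) none).IsIntegralBasis hb.inftyBasis)
    (ht : IsSeparating K (algebraMap (RatFunc K) L RatFunc.X))
    (hτ : IsTaylor (algebraMap (RatFunc K) L RatFunc.X) τ) :
    genus K L = ∑ i, (poleOrder K (b i) - 1) := by
  have hinj : Function.Injective hb.differential := by
    intro q q' h
    have h1 := smul_D_injective hτ h
    funext i
    have h2 := congr_arg (fun y => Algebra.trace (RatFunc K) L (y * b i)) h1
    simp only [hb.trace_sum_dualBasis] at h2
    exact Subtype.ext (RatFunc.algebraMap_injective K h2)
  have hrange : LinearMap.range hb.differential =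
      (⨅ P : Place K L, P.regularDiff : Submodule K Ω[L⁄K]) := by
    ext ω
    rw [LinearMap.mem_range]
    constructor
    · rintro ⟨q, rfl⟩
      exact (hb.smul_D_mem_iff hinf ht hτ _).2 fun i =>
        ⟨q i, (q i).2, (hb.trace_sum_dualBasis (fun i => algebraMap _ _ (q i : Polynomial K)) i).symm⟩
    · intro hω
      obtain ⟨h, rfl⟩ := exists_eq_smul_D ht ω
      have hq := (hb.smul_D_mem_iff hinf ht hτ _).1 hω
      choose q hq1 hq2 using hq
      refine ⟨fun i => ⟨q i, hq1 i⟩, ?_⟩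
      refine congr_arg
        (fun y : L => y • KaehlerDifferential.D K L (algebraMap (RatFunc K) L RatFunc.X)) ?_
      simp only [hq2]
      conv_rhs => rw [← ((Algebra.traceForm (RatFunc K) L).dualBasis
        (traceForm_nondegenerate _ _) hb.basis).sum_repr h]
      simp only [LinearMap.BilinForm.dualBasis_repr_apply, Algebra.traceForm_apply, hb.basis_apply]
  have hfin : ∀ n, Module.Finite K (Polynomial.degreeLT K n) := fun n =>
    Module.Finite.equiv (Polynomial.degreeLTEquiv K n).symm
  rw [genus, ← hrange, LinearMap.finrank_range_of_inj hinj, Module.finrank_pi_fintype]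
  refine Finset.sum_congr rfl fun i _ => ?_
  rw [(Polynomial.degreeLTEquiv K _).finrank_eq, Module.finrank_fin_fun]

/-- The divisor of the differential `dX` has degree at most `2 g - 2`. -/
theorem degree_ordDiff_X_le (ht : IsSeparating K (algebraMap (RatFunc K) L RatFunc.X))
    (hτ : IsTaylor (algebraMap (RatFunc K) L RatFunc.X) τ) :
    (Function.support fun P : Place K L => P.ordDiff
        (KaehlerDifferential.D K L (algebraMap (RatFunc K) L RatFunc.X))).Finite ∧
    ∑ᶠ P : Place K L, P.ordDiff (KaehlerDifferential.D K L (algebraMap (RatFunc K) L RatFunc.X)) ≤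
      2 * (genus K L : ℤ) - 2 := by
  have : HasValues K (RatFunc K) := hasValues_of_finite (L := L)
  obtain ⟨b, hb, hinf⟩ := exists_reduced_basis (K := K) (L := L)
  obtain ⟨h1, h2⟩ := hb.degree_ordDiff hinf ht hτ
  refine ⟨h1, ?_⟩
  rw [h2, hb.genus_eq hinf ht hτ]
  obtain ⟨i₀, hi₀⟩ := hb.exists_poleOrder_eq_zero hinf
  -- With truncated subtraction `m ≤ (m - 1) + 1`, strictly for `m = 0`; one such index supplies the
  -- `1`, hence the `-2` in the bound.
  have h3 : ∑ i, (poleOrder K (b i) : ℤ) + 1 ≤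
      ∑ i, ((poleOrder K (b i) - 1 : ℕ) : ℤ) + Module.finrank (RatFunc K) L := by
    have h4 : (Module.finrank (RatFunc K) L : ℤ) =
        ∑ _i : Fin (Module.finrank (RatFunc K) L), (1 : ℤ) := by simp
    rw [h4, ← Finset.sum_add_distrib, Int.add_one_le_iff]
    refine Finset.sum_lt_sum (fun i _ => ?_) ⟨i₀, Finset.mem_univ _, ?_⟩
    · omega
    · rw [hi₀]
      simp
  push_cast
  linarith

end GenusFormula

/-! ### Divisors on the curve -/

section SeparatingVariable

variable {K L : Type*} [Field K] [Field L] [Algebra K L] [IsAlgClosed K] [HasValues K L] {t : L}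

/-- The degree formulas for principal divisors and for the divisor of `dt`, over the rational function
field `K(t)` of a separating variable `t`. -/
theorem degree_formulas (htr : Transcendental K t) (ht : IsSeparating K t)
    [FiniteDimensional (IntermediateField.adjoin K {t}) L] :
    (∀ y : L, y ≠ 0 → IsDegreeZero fun P : Place K L => P.ord y) ∧
    (Function.support fun P : Place K L => P.ordDiff (KaehlerDifferential.D K L t)).Finite ∧
    ∑ᶠ P : Place K L, P.ordDiff (KaehlerDifferential.D K L t) ≤ 2 * (genus K L : ℤ) - 2 := by
  have hsep : Algebra.IsSeparable (IntermediateField.adjoin K {t}) L := ht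
  -- The abstract rational function field acts on `L` through `X ↦ t`.
  let e := RatFunc.algEquivOfTranscendental t htr
  let ι : RatFunc K →ₐ[K] L := (IntermediateField.val _).comp e.toAlgHom
  let : Algebra (RatFunc K) L := ι.toRingHom.toAlgebra
  let : Algebra (Polynomial K) L :=
    (ι.toRingHom.comp (algebraMap (Polynomial K) (RatFunc K))).toAlgebra
  have : IsScalarTower K (RatFunc K) L := .of_algebraMap_eq fun c => (ι.commutes c).symm
  have : IsScalarTower (Polynomial K) (RatFunc K) L := .of_algebraMap_eq fun c => rfl
  have he : (algebraMap (RatFunc K) L).comp (e.symm.toRingEquiv : _ →+* RatFunc K) =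
      ((RingEquiv.refl L : L ≃+* L) : L →+* L).comp
        (algebraMap (IntermediateField.adjoin K {t}) L) := by
    ext x
    change ((e (e.symm x) : IntermediateField.adjoin K {t}) : L) = x
    rw [e.apply_symm_apply]
  have : FiniteDimensional (RatFunc K) L := Module.Finite.of_equiv_equiv _ _ he
  have : Algebra.IsSeparable (RatFunc K) L := Algebra.IsSeparable.of_equiv_equiv _ _ he
  have hX : algebraMap (RatFunc K) L RatFunc.X = t := RatFunc.algEquivOfTranscendental_X t htr
  obtain ⟨τ, hτ, -⟩ := existsUnique_isTaylor t htr ht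
  refine ⟨fun y hy => isDegreeZero_ord hy, ?_⟩
  have := degree_ordDiff_X_le (K := K) (L := L) (τ := τ) (by rwa [hX]) (by rwa [hX])
  rwa [hX] at this

end SeparatingVariable

/-! ### Extension of the constant field -/

section ConstantExtension

variable {k K F L : Type*} [Field k] [Field K] [Field F] [Field L]
  [Algebra k K] [Algebra k F] [Algebra k L] [Algebra K L] [Algebra F L]
  [IsScalarTower k K L] [IsScalarTower k F L]

theorem mem_span_range_of_isPushout [h : Algebra.IsPushout k K F L] (y : L) :
    y ∈ Submodule.span K (Set.range (algebraMap F L)) :=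
  h.out.inductionOn y _ (zero_mem _) (fun f => Submodule.subset_span ⟨f, rfl⟩)
    (fun c _ => Submodule.smul_mem _ c) fun _ _ => add_mem

theorem essFiniteType_of_isPushout [Algebra.IsPushout k K F L] [Algebra.EssFiniteType k F] :
    Algebra.EssFiniteType K L :=
  (Algebra.EssFiniteType.iff_of_algEquiv (Algebra.IsPushout.equiv k K F L)).1
    (Algebra.EssFiniteType.baseChange k F K)

theorem algebraMap_mem_adjoin {t x : F} (hx : x ∈ IntermediateField.adjoin k {t}) :
    algebraMap F L x ∈ IntermediateField.adjoin K {algebraMap F L t} := by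
  induction hx using IntermediateField.adjoin_induction with
  | mem x hx =>
    rw [Set.mem_singleton_iff.1 hx]
    exact IntermediateField.mem_adjoin_simple_self _ _
  | algebraMap c =>
    rw [← IsScalarTower.algebraMap_apply, IsScalarTower.algebraMap_apply k K L]
    exact IntermediateField.algebraMap_mem _ _
  | add x y _ _ hx hy => rw [map_add]; exact add_mem hx hy
  | inv x _ hx => rw [map_inv₀]; exact inv_mem hx
  | mul x y _ _ hx hy => rw [map_mul]; exact mul_mem hx hy

/-- Elements of `F` remain separable over `K(t)`, since their old minimal polynomials stay
separable; together with `K` they span `L`. -/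
theorem IsSeparating.baseChange [Algebra.IsPushout k K F L] {t : F} (ht : IsSeparating k t) :
    IsSeparating K (algebraMap F L t) := by
  have hsep : Algebra.IsSeparable (IntermediateField.adjoin k {t}) F := ht
  set N := IntermediateField.adjoin K {algebraMap F L t}
  let ψ : IntermediateField.adjoin k {t} →+* N :=
    ((algebraMap F L).comp (algebraMap (IntermediateField.adjoin k {t}) F)).codRestrict N
      fun x => algebraMap_mem_adjoin x.2
  have key : ∀ x : F, algebraMap F L x ∈ separableClosure N L := fun x => by
    rw [mem_separableClosure_iff]
    have h1 : (minpoly (IntermediateField.adjoin k {t}) x).Separable :=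
      Algebra.IsSeparable.isSeparable _ x
    refine (h1.map (f := ψ)).of_dvd (minpoly.dvd _ _ ?_)
    have h2 : (algebraMap N L).comp ψ =
      (algebraMap F L).comp (algebraMap (IntermediateField.adjoin k {t}) F) := rfl
    rw [Polynomial.aeval_def, Polynomial.eval₂_map, h2, ← Polynomial.hom_eval₂,
      ← Polynomial.aeval_def, minpoly.aeval, map_zero]
  refine ⟨fun y => ?_⟩
  rw [← mem_separableClosure_iff]
  induction mem_span_range_of_isPushout (k := k) (K := K) (F := F) y using
    Submodule.span_induction with
  | mem x hx => obtain ⟨x, rfl⟩ := hx; exact key x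
  | zero => exact zero_mem _
  | add x y _ _ hx hy => exact add_mem hx hy
  | smul c x _ hx =>
    rw [Algebra.smul_def, IsScalarTower.algebraMap_apply K N L]
    exact mul_mem ((separableClosure N L).algebraMap_mem _) hx

theorem IsSeparating.isAlgebraic_adjoin {t : F} (ht : IsSeparating k t) :
    Algebra.IsAlgebraic (Algebra.adjoin k {t}) F := by
  open scoped IntermediateField.algebraAdjoinAdjoin in
  have hsep : Algebra.IsSeparable (IntermediateField.adjoin k {t}) F := ht
  have : IsScalarTower (Algebra.adjoin k {t}) (IntermediateField.adjoin k {t}) F :=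
    .of_algebraMap_eq fun _ => rfl
  exact (IsFractionRing.comap_isAlgebraic_iff (K := IntermediateField.adjoin k {t})).2 inferInstance

theorem IsSeparating.trdeg_le {t : F} (ht : IsSeparating k t) : Algebra.trdeg k F ≤ 1 := by
  have := ht.isAlgebraic_adjoin
  simpa using Algebra.IsAlgebraic.trdeg_le_cardinalMk k ({t} : Set F)

theorem IsSeparating.transcendental {t : F} (ht : IsSeparating k t)
    (hF : Algebra.trdeg k F = 1) : Transcendental k t := by
  intro halg
  have hsep : Algebra.IsSeparable (IntermediateField.adjoin k {t}) F := ht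
  have : Algebra.IsAlgebraic k (IntermediateField.adjoin k {t}) :=
    IntermediateField.isAlgebraic_adjoin_simple halg.isIntegral
  have : Algebra.IsAlgebraic k F := Algebra.IsAlgebraic.trans k (IntermediateField.adjoin k {t}) F
  rw [trdeg_eq_zero] at hF
  exact zero_ne_one hF

theorem transcendental_algebraMap_of_isAlgebraic [Algebra.IsAlgebraic k K] {t : F}
    (ht : Transcendental k t) : Transcendental K (algebraMap F L t) := fun h =>
  ht ((isAlgebraic_algebraMap_iff (algebraMap F L).injective).1 (h.restrictScalars k))

/-- An essentially finitely generated, formally unramified extension of fields is finite. -/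
theorem IsSeparating.finiteDimensional [Algebra.EssFiniteType k F] {t : F} (ht : IsSeparating k t) :
    FiniteDimensional (IntermediateField.adjoin k {t}) F := by
  have hsep : Algebra.IsSeparable (IntermediateField.adjoin k {t}) F := ht
  have := Algebra.EssFiniteType.of_comp k (IntermediateField.adjoin k {t}) F
  have := Algebra.FormallyUnramified.of_isSeparable (IntermediateField.adjoin k {t}) F
  exact Algebra.FormallyUnramified.finite_of_free _ _

end ConstantExtension

/-- The element `c` lies in the finite field `k(c)`. -/
theorem exists_pow_card_pow_eq {k K : Type*} [Field k] [Finite k] [Field K] [Algebra k K]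
    [Algebra.IsAlgebraic k K] (c : K) : ∃ s : ℕ, s ≠ 0 ∧ c ^ Nat.card k ^ s = c := by
  have : FiniteDimensional k (IntermediateField.adjoin k {c}) :=
    IntermediateField.adjoin.finiteDimensional (Algebra.IsIntegral.isIntegral c)
  have : Finite (IntermediateField.adjoin k {c}) := Module.finite_of_finite k
  have := Fintype.ofFinite (IntermediateField.adjoin k {c})
  refine ⟨Module.finrank k (IntermediateField.adjoin k {c}), Module.finrank_pos.ne', ?_⟩
  rw [← Module.natCard_eq_pow_finrank, Nat.card_eq_fintype_card]
  exact congr_arg Subtype.val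
    (FiniteField.pow_card (⟨c, IntermediateField.mem_adjoin_simple_self k c⟩ :
      IntermediateField.adjoin k {c}))

/-! ### Counting rational points -/

section RationalPoints

variable {K L F : Type*} [Field K] [Field L] [Algebra K L] [Field F] [Algebra F L]

theorem mem_rationalPoints_iff [HasValues K L] {P : Place K L} {Q : ℕ} :
    P ∈ rationalPoints K L F Q ↔ ∀ (x : F) (hx : algebraMap F L x ∈ P.ring),
      P.value ⟨algebraMap F L x, hx⟩ ^ Q = P.value ⟨algebraMap F L x, hx⟩ := by
  refine forall₂_congr fun x hx => ?_
  have := P.value_eq_zero_iff ((⟨algebraMap F L x, hx⟩ : P.ring) ^ Q - ⟨algebraMap F L x, hx⟩)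
  rw [map_sub, map_pow, sub_eq_zero] at this
  exact this.symm

theorem rationalPoints_subset_pow [HasValues K L] (q a : ℕ) :
    rationalPoints K L F q ⊆ rationalPoints K L F (q ^ a) := by
  intro P hP
  rw [mem_rationalPoints_iff] at hP ⊢
  intro x hx
  have := Function.IsFixedPt.iterate (f := (· ^ q)) (hP x hx) a
  rw [pow_iterate] at this
  exact this

/-- The values at `P` are periodic under the `q`-power map with periods `a` and `b`, hence with
period `gcd(a, b) = 1`. -/
theorem mem_rationalPoints_of_coprime [HasValues K L] {q a b : ℕ} (hab : a.Coprime b)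
    {P : Place K L} (ha : P ∈ rationalPoints K L F (q ^ a)) (hb : P ∈ rationalPoints K L F (q ^ b)) :
    P ∈ rationalPoints K L F q := by
  rw [mem_rationalPoints_iff] at ha hb ⊢
  intro x hx
  have h : ∀ c, P.value ⟨algebraMap F L x, hx⟩ ^ q ^ c = P.value ⟨algebraMap F L x, hx⟩ →
      Function.IsPeriodicPt (· ^ q) c (P.value ⟨algebraMap F L x, hx⟩) := fun c hc => by
    rw [Function.IsPeriodicPt, pow_iterate]
    exact hc
  have := (h a (ha x hx)).gcd (h b (hb x hx))
  rw [hab.gcd_eq_one] at this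
  exact this

/-- A rational point is either a pole of `t` or a zero of `t ^ Q - t`, which is not the zero
function because `t` is transcendental. -/
theorem finite_rationalPoints
    (hfin : ∀ y : L, y ≠ 0 → (Function.support fun P : Place K L => P.ord y).Finite) {t : F}
    (htr : Transcendental K (algebraMap F L t)) {Q : ℕ} (hQ : 1 < Q) :
    (rationalPoints K L F Q).Finite := by
  have h0 : algebraMap F L t ≠ 0 := fun h => htr (h ▸ isAlgebraic_zero)
  have h1 : algebraMap F L t ^ Q - algebraMap F L t ≠ 0 := by
    intro h
    refine htr ⟨Polynomial.X ^ Q - Polynomial.X, FiniteField.X_pow_card_sub_X_ne_zero K hQ, ?_⟩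
    simpa using h
  refine ((hfin _ h0).union (hfin _ h1)).subset fun P hP => ?_
  by_cases hv : P.v (algebraMap F L t) ≤ 1
  · right
    have := hP t hv
    rw [P.v_lt_one_iff h1] at this
    exact this.ne'
  · left
    rw [P.v_le_one_iff h0] at hv
    exact (not_le.1 hv).ne

theorem finite_support_baseDivisor
    (hfin : ∀ y : L, y ≠ 0 → (Function.support fun P : Place K L => P.ord y).Finite)
    {n : ℕ} {f : Fin (n + 1) → L} (hf : ∀ i, f i ≠ 0) :
    (Function.support (baseDivisor f : Place K L → ℤ)).Finite := by
  refine (Set.finite_iUnion fun i => hfin _ (hf i)).subset fun P hP => ?_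
  obtain ⟨i, hi, -⟩ := exists_baseDivisor_eq P f
  rw [Function.mem_support, hi, neg_ne_zero] at hP
  exact Set.mem_iUnion.2 ⟨i, hP⟩

end RationalPoints

/-- Weighted counting of three finite sets that meet pairwise in the same set `D`. -/
theorem ncard_add_ncard_add_ncard_le {α : Type*} {T : α → ℤ} (hT : T.support.Finite) (h0 : ∀ P, 0 ≤ T P)
    {A B C D : Set α} (hA : A.Finite) (hB : B.Finite) (hC : C.Finite) (hDA : D ⊆ A) (hDB : D ⊆ B)
    (hDC : D ⊆ C) (hAB : A ∩ B ⊆ D) (hAC : A ∩ C ⊆ D) (hBC : B ∩ C ⊆ D) {a b c : ℤ}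
    (ha : ∀ P ∈ A, a ≤ T P) (hb : ∀ P ∈ B, b ≤ T P) (hc : ∀ P ∈ C, c ≤ T P) :
    a * A.ncard + b * B.ncard + c * C.ncard ≤
      ∑ᶠ P, T P - ∑ᶠ P ∈ D, (T P - (a + b + c)) := by
  classical
  obtain ⟨S, hS⟩ : ∃ S : Finset α, (S : Set α) = T.support ∪ A ∪ B ∪ C :=
    ⟨(((hT.union hA).union hB).union hC).toFinset, by simp⟩
  have card : ∀ E : Set α, E ⊆ S → ∀ e : ℤ, e * E.ncard = ∑ P ∈ S, if P ∈ E then e else 0 := by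
    intro E hE e
    have : E = ((S.filter (· ∈ E) : Finset α) : Set α) := by
      ext P
      simpa using fun h => hE h
    rw [← Finset.sum_filter, Finset.sum_const, nsmul_eq_mul, mul_comm]
    conv_lhs => rw [this, Set.ncard_coe_finset]
  have hsub : T.support ⊆ S ∧ A ⊆ S ∧ B ⊆ S ∧ C ⊆ S := by
    rw [hS]
    refine ⟨?_, ?_, ?_, ?_⟩ <;> intro P hP <;> simp only [Set.mem_union] <;> tauto
  have hD : ∑ᶠ P ∈ D, (T P - (a + b + c)) =
      ∑ P ∈ S, if P ∈ D then T P - (a + b + c) else 0 := by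
    simp only [← finsum_eq_if]
    refine finsum_eq_sum_of_support_subset _ fun P hP => hsub.2.1 (hDA ?_)
    by_contra h
    simp [h] at hP
  rw [card A hsub.2.1, card B hsub.2.2.1, card C hsub.2.2.2, hD,
    finsum_eq_sum_of_support_subset T hsub.1, ← Finset.sum_add_distrib, ← Finset.sum_add_distrib,
    ← Finset.sum_sub_distrib]
  refine Finset.sum_le_sum fun P _ => ?_
  have h1 := h0 P
  have h2 := ha P
  have h3 := hb P
  have h4 := hc P
  -- Pointwise comparison: on `D` both sides equal `a + b + c`; off `D` at most one of the three
  -- sets contains `P`.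
  by_cases hPD : P ∈ D
  · simp [hPD, hDA hPD, hDB hPD, hDC hPD]
  · have h5 : ¬ (P ∈ A ∧ P ∈ B) := fun h => hPD (hAB h)
    have h6 : ¬ (P ∈ A ∧ P ∈ C) := fun h => hPD (hAC h)
    have h7 : ¬ (P ∈ B ∧ P ∈ C) := fun h => hPD (hBC h)
    by_cases hPA : P ∈ A <;> by_cases hPB : P ∈ B <;> by_cases hPC : P ∈ C <;>
      simp_all

/-! ### The degree of the Frobenius divisor -/

section FrobeniusDivisorDegree

variable {K L : Type*} [Field K] [Field L] [Algebra K L] [IsAlgClosed K] [HasValues K L] {t : L}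

theorem two_mul_sum_val (r : ℕ) : 2 * ∑ i : Fin r, (i : ℤ) = r * (r - 1) := by
  induction r with
  | zero => simp
  | succ r ih =>
    rw [Fin.sum_univ_castSucc, mul_add]
    simp only [Fin.val_castSucc, Fin.val_last, ih]
    push_cast
    ring

/-- The Frobenius divisor has finite support, and its degree is bounded through the genus. -/
theorem degree_frobDivisor_le (htr : Transcendental K t) (ht : IsSeparating K t)
    [FiniteDimensional (IntermediateField.adjoin K {t}) L] {r : ℕ} {f : Fin (r + 1 + 1) → L}
    (hf : ∀ i, f i ≠ 0) {κ : Fin (r + 1 - 1) → ℕ} (hκ : ∀ i, κ i = i) {Q₁ Q₂ : ℕ}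
    (hdet : frobDet K Q₁ Q₂ t f κ ≠ 0) :
    (Function.support fun P : Place K L => frobDivisor Q₁ Q₂ t f κ P).Finite ∧
    ∑ᶠ P : Place K L, frobDivisor Q₁ Q₂ t f κ P ≤
      (r : ℤ) * (r - 1) * ((genus K L : ℤ) - 1) + seriesDegree K f * ((Q₂ : ℤ) + Q₁ + r) := by
  obtain ⟨hprin, hfin, hdeg⟩ := degree_formulas htr ht
  have hE := finite_support_baseDivisor (fun y hy => (hprin y hy).1) hf
  have hκ' : ∑ i, (κ i : ℤ) = ∑ i : Fin r, (i : ℤ) :=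
    Finset.sum_congr rfl fun i _ => congr_arg _ (hκ i)
  have s1 : (Function.support fun P : Place K L => (∑ i : Fin r, (i : ℤ)) *
      P.ordDiff (KaehlerDifferential.D K L t)).Finite :=
    hfin.subset (Function.support_mul_subset_right _ _)
  have s2 : (Function.support fun P : Place K L => ((Q₂ : ℤ) + Q₁ + (r + 1 : ℕ) - 1) *
      baseDivisor f P).Finite := hE.subset (Function.support_mul_subset_right _ _)
  have s3 : (Function.support fun P : Place K L => P.ord (frobDet K Q₁ Q₂ t f κ) +
      (∑ i : Fin r, (i : ℤ)) * P.ordDiff (KaehlerDifferential.D K L t)).Finite :=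
    ((hprin _ hdet).1.union s1).subset (Function.support_add _ _)
  simp only [frobDivisor, hκ']
  refine ⟨(s3.union s2).subset (Function.support_add _ _), ?_⟩
  rw [finsum_add_distrib s3 s2, finsum_add_distrib (hprin _ hdet).1 s1, (hprin _ hdet).2,
    ← mul_finsum, ← mul_finsum, ← two_mul_sum_val, seriesDegree, degree]
  -- The sum of the `κ i` is nonnegative, so the upper bound `2g - 2` for the degree of `dt` is
  -- enough.
  have h0 : (0 : ℤ) ≤ ∑ i : Fin r, (i : ℤ) := Finset.sum_nonneg fun i _ => by positivity
  have := mul_le_mul_of_nonneg_left hdeg h0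
  push_cast
  linarith

end FrobeniusDivisorDegree

end FrobeniusCurve

end

/-! ### The bound for the numbers of rational points -/

open FrobeniusCurve in
theorem corollary4p6
    {k K F L : Type*} [Field k] [Finite k] [Field K] [Field F] [Field L]
    [Algebra k K] [Algebra k F] [Algebra k L] [Algebra K L] [Algebra F L]
    [IsScalarTower k K L] [IsScalarTower k F L]
    [IsAlgClosure k K] (hF : IsFunctionField k F) [Algebra.IsPushout k K F L]
    (n : ℕ) (hn : 2 ≤ n) (u m : ℕ) (hu : 1 ≤ u) (hum : u < m) (hcop : Nat.Coprime u m)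
    (φ : Fin (n + 1) → F)
    (hφ : LinearIndependent K fun i => algebraMap F L (φ i))
    (t : F) (ht : IsSeparating k t)
    (q : ℕ) (hq : q = Nat.card k)
    (f : Fin (n + 1) → L) (hf : f = fun i => algebraMap F L (φ i))
    (κ : Fin (n - 1) → ℕ)
    (hκ : IsFrobOrderSeq K (q ^ u) (q ^ m) (algebraMap F L t) f κ)
    (hclassical : ∀ i, κ i = i)
    (B : Place K L → ℤ)
    (hB : ∀ P, B P = frobDivisor (q ^ u) (q ^ m) (algebraMap F L t) f κ P
      - ((q : ℤ) ^ u + 2 * ((n : ℤ) - 1))) :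
    ((n : ℤ) - 1) * numPoints K L F (q ^ u) + ((n : ℤ) - 1) * numPoints K L F (q ^ m)
          + (q : ℤ) ^ u * numPoints K L F (q ^ (m - u))
        ≤ ((n : ℤ) - 1) * (n - 2) * ((genus K L : ℤ) - 1)
          + seriesDegree K f * ((q : ℤ) ^ m + (q : ℤ) ^ u + n - 1)
          - ∑ᶠ P ∈ rationalPoints K L F q, B P
      ∧ ∀ P ∈ rationalPoints K L F q,
        (q : ℤ) ^ u * ((orderAt f P 1 : ℤ) - 1)
          + ∑ i ∈ Finset.Icc 2 n, ((orderAt f P i : ℤ) - i) ≤ B P := by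
  obtain ⟨r, rfl⟩ : ∃ r, n = r + 1 := ⟨n - 1, by omega⟩
  subst hf
  have := hF.essFiniteType
  have : IsAlgClosed K := IsAlgClosure.isAlgClosed k
  have : Algebra.IsAlgebraic k K := IsAlgClosure.isAlgebraic
  have : Algebra.EssFiniteType K L := essFiniteType_of_isPushout (k := k) (F := F)
  have htL : IsSeparating K (algebraMap F L t) := ht.baseChange
  have htr : Transcendental K (algebraMap F L t) :=
    transcendental_algebraMap_of_isAlgebraic (ht.transcendental hF.trdeg_eq_one)
  have : HasValues K L := hasValues_of_trdeg_le htL.trdeg_le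
  have := htL.finiteDimensional
  obtain ⟨p, a, hp, hcar, ha, hqp⟩ : ∃ p a : ℕ, p.Prime ∧ CharP k p ∧ a ≠ 0 ∧ Nat.card k = p ^ a := by
    have := Fintype.ofFinite k
    obtain ⟨p, hchar, a, hp, hcard⟩ := FiniteField.card' k
    exact ⟨p, a, hp, hchar, a.ne_zero, Nat.card_eq_fintype_card.trans hcard⟩
  have : Fact p.Prime := ⟨hp⟩
  have : CharP K p := charP_of_injective_algebraMap (algebraMap k K).injective p
  have hK : ∀ c : K, ∃ s : ℕ, s ≠ 0 ∧ c ^ p ^ s = c := fun c => by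
    obtain ⟨s, hs, h⟩ := exists_pow_card_pow_eq (k := k) c
    exact ⟨a * s, mul_ne_zero ha hs, by rwa [hqp, ← pow_mul] at h⟩
  have hspan := mem_span_range_of_isPushout (k := k) (K := K) (F := F) (L := L)
  have hdet := hκ.det_ne_zero
  have hqa : q = p ^ a := hq.trans hqp
  have hq1 : 1 < q := hqa ▸ Nat.one_lt_pow ha hp.one_lt
  obtain ⟨hprin, -⟩ := degree_formulas htr htL
  have hfin : ∀ s, s ≠ 0 → (rationalPoints K L F (q ^ s)).Finite := fun s hs =>
    finite_rationalPoints (fun y hy => (hprin y hy).1) htr (Nat.one_lt_pow hs hq1)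
  obtain ⟨hTfin, hTdeg⟩ := degree_frobDivisor_le htr htL (fun i => hφ.ne_zero i) hclassical hdet
  have hqs : ∀ s, q ^ s = p ^ (a * s) := fun s => by rw [hqa, pow_mul]
  have hT0 : ∀ P, 0 ≤ frobDivisor (q ^ u) (q ^ m) (algebraMap F L t)
      (fun i => algebraMap F L (φ i)) κ P := fun P =>
    frobDivisor_nonneg hK hspan hφ htr htL hclassical hdet
  have hTu : ∀ P ∈ rationalPoints K L F (q ^ u), (r : ℤ) ≤ frobDivisor (q ^ u) (q ^ m)
      (algebraMap F L t) (fun i => algebraMap F L (φ i)) κ P := fun P hP => by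
    rw [hqs u] at hdet hP ⊢
    exact le_frobDivisor_of_rational_left hK hspan hφ htr htL hclassical
      (mul_ne_zero ha (by omega)) hdet hP
  have hTm : ∀ P ∈ rationalPoints K L F (q ^ m), (r : ℤ) ≤ frobDivisor (q ^ u) (q ^ m)
      (algebraMap F L t) (fun i => algebraMap F L (φ i)) κ P := fun P hP => by
    rw [hqs m] at hdet hP ⊢
    exact le_frobDivisor_of_rational_right hK hspan hφ htr htL hclassical
      (mul_ne_zero ha (by omega)) hdet hP
  have hTmu : ∀ P ∈ rationalPoints K L F (q ^ (m - u)), ((q ^ u : ℕ) : ℤ) ≤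
      frobDivisor (q ^ u) (q ^ m) (algebraMap F L t) (fun i => algebraMap F L (φ i)) κ P :=
    fun P hP => by
    have e : a * m = a * (m - u) + a * u := by rw [← mul_add, Nat.sub_add_cancel hum.le]
    rw [hqs m, hqs u, e] at hdet ⊢
    rw [hqs] at hP
    exact le_frobDivisor_of_rational_quotient hK hspan hφ htr htL hclassical
      (mul_ne_zero ha (by omega)) hdet hP
  constructor
  -- The exponents `u`, `m`, `m - u` are pairwise coprime, so any two of the three sets of rational
  -- points meet only in the points over `q`.
  · have hmu : (m - u).Coprime u := (Nat.coprime_sub_self_left hum.le).2 hcop.symm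
    have hmu' : m.Coprime (m - u) := (Nat.coprime_self_sub_right hum.le).2 hcop.symm
    have key := ncard_add_ncard_add_ncard_le hTfin hT0 (hfin u (by omega)) (hfin m (by omega))
      (hfin (m - u) (by omega)) (rationalPoints_subset_pow q u) (rationalPoints_subset_pow q m)
      (rationalPoints_subset_pow q (m - u)) (fun P h => mem_rationalPoints_of_coprime hcop h.1 h.2)
      (fun P h => mem_rationalPoints_of_coprime hmu.symm h.1 h.2)
      (fun P h => mem_rationalPoints_of_coprime hmu' h.1 h.2) hTu hTm hTmu
    have hBeq : ∑ᶠ P ∈ rationalPoints K L F q, B P = ∑ᶠ P ∈ rationalPoints K L F q,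
        (frobDivisor (q ^ u) (q ^ m) (algebraMap F L t) (fun i => algebraMap F L (φ i)) κ P -
          ((r : ℤ) + r + (q ^ u : ℕ))) := by
      refine finsum_mem_congr rfl fun P _ => ?_
      rw [hB]
      push_cast
      ring
    rw [hBeq]
    simp only [numPoints]
    push_cast at key hTdeg ⊢
    linarith
  · intro P hP
    subst hqa
    have h1 := le_frobDivisor_of_rational hK hspan hφ htr htL hclassical ha hum.le hdet hP
    have e1 : Finset.Icc 2 (r + 1) = Finset.Ico 2 (r + 2) := by
      ext i
      simp only [Finset.mem_Icc, Finset.mem_Ico]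
      omega
    rw [Finset.sum_range_succ', Finset.sum_range_succ'] at h1
    rw [hB, e1, Finset.sum_Ico_eq_sum_range, Nat.add_sub_cancel, Finset.sum_sub_distrib]
    have e2 : ∑ i ∈ Finset.range r, (((2 + i : ℕ) : ℕ) : ℤ) = ∑ i : Fin r, (i : ℤ) + 2 * r := by
      rw [Fin.sum_univ_eq_sum_range fun i => (i : ℤ)]
      push_cast
      rw [Finset.sum_add_distrib, Finset.sum_const, Finset.card_range, nsmul_eq_mul]
      ring
    simp only [Nat.add_comm 2] at e2 ⊢
    rw [e2]
    push_cast at h1 ⊢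
    -- The local bound also contains `j₀(P)`, which is dropped as nonnegative. The rest matches
    -- because `∑_{i=2}^{r+1} i = ∑_{i<r} i + 2r`.
    have h2 := Int.natCast_nonneg (orderAt (fun i => algebraMap F L (φ i)) P 0)
    simp only [Nat.add_assoc, Nat.reduceAdd] at h1 ⊢
    linarith
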